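/- Setting. Let $\mathcal X\subset\mathbb R^d$, let $f\sim\mathcal{GP}(0,k)$ be a centred Gaussian process on $\mathcal X$ with stationary kernel $k$ satisfying $k(\mathbf x,\mathbf x)=1$, and let $\epsilon_1,\epsilon_2,\dots$ be i.i.d. $\mathcal N(0,\sigma^2)$, $\sigma>0$, independent of $f$. Let $\mathbf x^*\in\arg\max_{\mathbf x\in\mathcal X}f(\mathbf x)$. At step $t\ge 1$ an algorithm queries $\mathbf x_t\in\mathcal X$ and observes $y_t=f(\mathbf x_t)+\epsilon_t$. Given $\mathcal D_{t-1}=\{(\mathbf x_i,y_i)\}_{i<t}$, let $\mathbf k_{t-1}(\mathbf x)=(k(\mathbf x,\mathbf x_i))_{i<t}$, $\mathbf K=(k(\mathbf x_i,\mathbf x_j))_{i,j<t}$, $\mathbf y_{t-1}=(y_i)_{i<t}$, and $$\mu_{t-1}(\mathbf x)=\mathbf k_{t-1}(\mathbf x)^\top(\mathbf K+\sigma^2\mathbf I)^{-1}\mathbf y_{t-1},\qquad \sigma_{t-1}^2(\mathbf x)=k(\mathbf x,\mathbf x)-\mathbf k_{t-1}(\mathbf x)^\top(\mathbf K+\sigma^2\mathbf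 I)^{-1}\mathbf k_{t-1}(\mathbf x).$$ GP-UCB with parameters $(\beta_t)_{t\ge1}$ chooses $\mathbf x_t\in\arg\max_{\mathbf x\in\mathcal X}\mu_{t-1}(\mathbf x)+\beta_t^{1/2}\sigma_{t-1}(\mathbf x)$, ties being broken by a measurable function of $\mathcal D_{t-1}$. Let $\mathrm{BCR}_T=\mathbb E\bigl[\sum_{t=1}^T(f(\mathbf x^*)-f(\mathbf x_t))\bigr]$, $C_1=2/\log(1+\sigma^{-2})$, and let $\gamma_T=\sup I(\mathbf y_A;\mathbf f_A)$, the supremum over all $A=(\mathbf a_1,\dots,\mathbf a_T)\in\mathcal X^T$ (repetitions allowed), where $\mathbf f_A=(f(\mathbf a_i))_{i\le T}$, $\mathbf y_A=(f(\mathbf a_i)+\epsilon_i)_{i\le T}$ and $I$ is Shannon mutual information. Square roots of negative numbers are read as $0$ (this concerns only degenerate parameter values where $\beta_t<0$ or $\log(ad)<0$). Theorem. In both cases below, for every $T$, $\gamma_T<\infty$ and the cumulative regret is integrable. (i) If $\mathcal X$ is finite, GP-UCB with $\beta_t=2\log\bigl(|\mathcal X|t^2/\sqrt{2\pi}\bigr)$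 satisfies $$\mathrm{BCR}_T\le\frac{\pi^2}{6}+\sqrt{C_1T\beta_T\gamma_T}.$$ (ii) Let $\mathcal X$ be infinite, compact and convex with $\mathcal X\subset[0,r]^d$, $r>0$. Suppose that almost every sample path of $f$ is differentiable on $\mathcal X$ and that there are $a,b>0$ such that $\Pr\bigl(\sup_{\mathbf x\in\mathcal X}|\partial f/\partial x_j|>L\bigr)\le a\exp(-(L/b)^2)$ for all $L>0$ and $j=1,\dots,d$. Then GP-UCB with $$\beta_t=2d\log\Bigl(bdrt^2\bigl(\sqrt{\log(ad)}+\sqrt\pi/2\bigr)\Bigr)+2\log\bigl(t^2/\sqrt{2\pi}\bigr)$$ satisfies $$\mathrm{BCR}_T\le\frac{\pi^2}{3}+\sqrt{C_1T\beta_T\gamma_T}.$$ Moreover, for fixed $d,r,b,t$, this $\beta_t$ is $O(\log\log a)$ as $a\to\infty$. -/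

import Mathlib

open MeasureTheory ProbabilityTheory InformationTheory
open scoped NNReal ENNReal

noncomputable section

namespace GPUCB

/-- Points of `ℝ^d`. -/
abbrev Pt (d : ℕ) : Type := EuclideanSpace ℝ (Fin d)

/-- A data set `{(x_i, y_i)}` of `n` query/observation pairs. -/
abbrev Data (d n : ℕ) : Type := Fin n → Pt d × ℝ

/-! ### The GP posterior and the upper confidence bound -/

/-- The vector `(k(x, x_1), …, k(x, x_n))`. -/
def kernelVec {d n : ℕ} (k : Pt d → Pt d → ℝ) (D : Data d n) (x : Pt d) : Fin n → ℝ :=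
  fun i => k x (D i).1

/-- The matrix `K + s² I` with `K_{ij} = k(x_i, x_j)`. -/
def regKernelMatrix {d n : ℕ} (k : Pt d → Pt d → ℝ) (s : ℝ≥0) (D : Data d n) :
    Matrix (Fin n) (Fin n) ℝ :=
  Matrix.of (fun i j => k (D i).1 (D j).1) + ((s : ℝ) ^ 2) • (1 : Matrix (Fin n) (Fin n) ℝ)

/-- Posterior mean of `f(x)` given the data `D`, for the noise variance `s²`. -/
def postMean {d n : ℕ} (k : Pt d → Pt d → ℝ) (s : ℝ≥0) (D : Data d n) (x : Pt d) : ℝ :=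
  kernelVec k D x ⬝ᵥ ((regKernelMatrix k s D)⁻¹).mulVec (fun i => (D i).2)

/-- Posterior variance of `f(x)` given the data `D`, for the noise variance `s²`. -/
def postVar {d n : ℕ} (k : Pt d → Pt d → ℝ) (s : ℝ≥0) (D : Data d n) (x : Pt d) : ℝ :=
  k x x - kernelVec k D x ⬝ᵥ ((regKernelMatrix k s D)⁻¹).mulVec (kernelVec k D x)

/-- The upper confidence bound `μ(x) + β^{1/2} σ(x)` computed from the data `D`. -/
def ucb {d n : ℕ} (k : Pt d → Pt d → ℝ) (s : ℝ≥0) (β : ℝ) (D : Data d n) (x : Pt d) : ℝ :=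
  postMean k s D x + Real.sqrt β * Real.sqrt (postVar k s D x)

/-! ### The algorithm and its run -/

/-- A decision rule: the next query point as a function of the data collected so far. -/
abbrev Rule (d : ℕ) : Type := (n : ℕ) → Data d n → Pt d

/-- `π` is a GP-UCB rule with confidence parameters `β_1, β_2, …`: after `n` observations the query
`x_{n+1}` maximizes over `X` the upper confidence bound with parameter `β_{n+1}`. Ties may be broken
by an arbitrary measurable function of the data. -/
structure IsGPUCB {d : ℕ} (X : Set (Pt d)) (k : Pt d → Pt d → ℝ) (s : ℝ≥0) (β : ℕ → ℝ)
    (π : Rule d) : Prop where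
  measurable : ∀ n, Measurable (π n)
  mem : ∀ (n : ℕ) (D : Data d n), (∀ i, (D i).1 ∈ X) → π n D ∈ X
  isMaxOn : ∀ (n : ℕ) (D : Data d n), (∀ i, (D i).1 ∈ X) →
    IsMaxOn (ucb k s (β (n + 1)) D) X (π n D)

/-- The data set after `n` steps of running `π` on the objective `f` with noise `ε`;
step `n + 1` queries `π n` of the current data and observes `f` there with the noise `ε n`. -/
def history {d : ℕ} {Ω : Type*} (π : Rule d) (f : Pt d → Ω → ℝ) (ε : ℕ → Ω → ℝ) (ω : Ω) :
    (n : ℕ) → Data d n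
  | 0 => Fin.elim0
  | n + 1 =>
    Fin.snoc (α := fun _ => Pt d × ℝ) (history π f ε ω n)
      (π n (history π f ε ω n), f (π n (history π f ε ω n)) ω + ε n ω)

/-- The query point `x_{n+1}`. -/
def query {d : ℕ} {Ω : Type*} (π : Rule d) (f : Pt d → Ω → ℝ) (ε : ℕ → Ω → ℝ) (n : ℕ) (ω : Ω) :
    Pt d :=
  π n (history π f ε ω n)

/-- The cumulative regret `∑_{t=1}^T (f(x^*) - f(x_t))` as a random variable. -/
def cumRegret {d : ℕ} {Ω : Type*} (π : Rule d) (f : Pt d → Ω → ℝ) (ε : ℕ → Ω → ℝ)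
    (xstar : Ω → Pt d) (T : ℕ) (ω : Ω) : ℝ :=
  ∑ n ∈ Finset.range T, (f (xstar ω) ω - f (query π f ε n ω) ω)

/-- The Bayesian cumulative regret: the expectation of the cumulative regret. -/
def bcr {d : ℕ} {Ω : Type*} [MeasurableSpace Ω] (P : Measure Ω) (π : Rule d) (f : Pt d → Ω → ℝ)
    (ε : ℕ → Ω → ℝ) (xstar : Ω → Pt d) (T : ℕ) : ℝ :=
  ∫ ω, cumRegret π f ε xstar T ω ∂P

/-! ### The probabilistic model -/

/-- `f ∼ GP(0, k)` on `X`, and `ε` is i.i.d. `N(0, s²)` noise, independent of `f`.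
Only the values of `f` and `k` on `X` matter. -/
structure IsGPModel {d : ℕ} {Ω : Type*} [MeasurableSpace Ω] (P : Measure Ω) (X : Set (Pt d))
    (k : Pt d → Pt d → ℝ) (s : ℝ≥0) (f : Pt d → Ω → ℝ) (ε : ℕ → Ω → ℝ) : Prop where
  measurable_f : ∀ x ∈ X, Measurable (f x)
  measurable_noise : ∀ n, Measurable (ε n)
  gaussian : IsGaussianProcess (fun x : X => f x) P
  mean : ∀ x ∈ X, ∫ ω, f x ω ∂P = 0
  cov : ∀ x ∈ X, ∀ y ∈ X, cov[f x, f y; P] = k x y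
  noise_law : ∀ n, P.map (ε n) = gaussianReal 0 (s ^ 2)
  noise_indep : iIndepFun ε P
  indep : IndepFun (fun ω (x : X) => f x ω) (fun ω (n : ℕ) => ε n ω) P

/-- `k` is stationary on `X`: `k(x, y)` depends only on `x - y`. -/
def IsStationaryOn {d : ℕ} (X : Set (Pt d)) (k : Pt d → Pt d → ℝ) : Prop :=
  ∃ φ : Pt d → ℝ, ∀ x ∈ X, ∀ y ∈ X, k x y = φ (x - y)

/-- The regularity assumption for continuous domains: `X ⊆ [0, r]^d` is compact and convex, almost
every sample path of `f` is differentiable on `X` (with derivative `G ω x` at `x`, which is unique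
when `X` has non-empty interior), and the suprema of its partial derivatives satisfy
`Pr(sup_{x ∈ X} |∂f/∂x_j| > L) ≤ a exp(-(L/b)²)`. -/
structure DerivTail {d : ℕ} {Ω : Type*} [MeasurableSpace Ω] (P : Measure Ω) (X : Set (Pt d))
    (f : Pt d → Ω → ℝ) (r a b : ℝ) : Prop where
  r_pos : 0 < r
  a_pos : 0 < a
  b_pos : 0 < b
  compact : IsCompact X
  convex : Convex ℝ X
  subset_box : ∀ x ∈ X, ∀ j, x j ∈ Set.Icc 0 r
  tail : ∃ G : Ω → Pt d → (Pt d →L[ℝ] ℝ),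
    (∀ᵐ ω ∂P, ∀ x ∈ X, HasFDerivWithinAt (fun z => f z ω) (G ω x) X x) ∧
    ∀ (j : Fin d) (L : ℝ), 0 < L →
      P {ω | ENNReal.ofReal L < ⨆ x ∈ X, ‖G ω x (EuclideanSpace.single j 1)‖ₑ} ≤
        ENNReal.ofReal (a * Real.exp (-(L / b) ^ 2))

/-! ### Information gain -/

/-- Shannon mutual information `I(U; V)`: the Kullback–Leibler divergence of the joint law from the
product of the marginal laws. -/
def mutualInfo {Ω α β : Type*} [MeasurableSpace Ω] [MeasurableSpace α] [MeasurableSpace β]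
    (P : Measure Ω) (U : Ω → α) (V : Ω → β) : ℝ≥0∞ :=
  klDiv (P.map (fun ω => (U ω, V ω))) ((P.map U).prod (P.map V))

/-- The maximum information gain `γ_T = sup I(y_A; f_A)` over `A = (a_1, …, a_T)` in `X`,
where `f_A = (f(a_i))_i` and `y_A = (f(a_i) + ε_i)_i`. Points may be repeated. -/
def maxInfoGain {d : ℕ} {Ω : Type*} [MeasurableSpace Ω] (P : Measure Ω) (X : Set (Pt d))
    (f : Pt d → Ω → ℝ) (ε : ℕ → Ω → ℝ) (T : ℕ) : ℝ≥0∞ :=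
  ⨆ A : Fin T → X,
    mutualInfo P (fun ω (i : Fin T) => f (A i) ω + ε i ω) (fun ω (i : Fin T) => f (A i) ω)

/-! ### Constants -/

/-- `C₁ = 2 / log(1 + s⁻²)`. -/
def constC1 (s : ℝ≥0) : ℝ := 2 / Real.log (1 + ((s : ℝ) ^ 2)⁻¹)

/-- `β_t = 2 log(|X| t² / √(2π))` for a domain with `N = |X|` points. -/
def betaFinite (N : ℕ) (t : ℕ) : ℝ :=
  2 * Real.log ((N : ℝ) * (t : ℝ) ^ 2 / Real.sqrt (2 * Real.pi))

/-- `β_t = 2 d log(b d r t² (√(log(a d)) + √π / 2)) + 2 log(t² / √(2π))`. -/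
def betaContinuous (d : ℕ) (r a b : ℝ) (t : ℕ) : ℝ :=
  2 * (d : ℝ) * Real.log (b * d * r * (t : ℝ) ^ 2 *
      (Real.sqrt (Real.log (a * d)) + Real.sqrt Real.pi / 2)) +
    2 * Real.log ((t : ℝ) ^ 2 / Real.sqrt (2 * Real.pi))

end GPUCB

end

/-
With respect to a fixed reference measure on data sets, in which the query is the point prescribed
by the rule and the observation is Lebesgue distributed, the law of the history of an adaptive run
given the objective has a density: the product of the Gaussian likelihoods of the observations. The
rule enters the reference measure only. Integrating the likelihood against the Gaussian prior
therefore shows that, conditionally on the history, `f x` is `N(μ(x), σ²(x))` even though the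
queries were chosen adaptively. Hence `μ(x) + √β σ(x)` is exceeded on average by at most
`exp (-β / 2) / √(2π)` at every point `x`, and summing over a net of `X` bounds
`f x⋆ - max UCB`, up to the oscillation of `f` at the scale of the net. The remaining regret
`√β σ(x_t)` is summed by Cauchy–Schwarz and the chain rule
`I(y; f) = ½ ∑ log (1 + σ²(x_t) / s²)`.

In the continuous case the tail of the partial derivatives bounds the mean of a random Lipschitz
constant. When this bound is too small to allow a net with at least one cell per coordinate, the
oscillation of `f` on all of `X` is already of order `t⁻²`.
-/

namespace GPUCB

/-! ### Adaptive runs -/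

section Noise

variable {Ω E α β γ : Type*} [MeasurableSpace Ω] [MeasurableSpace E] [MeasurableSpace α]
  [MeasurableSpace β] [MeasurableSpace γ] {P : Measure Ω}

lemma indepFun_prodMk_left [IsProbabilityMeasure P] {U : Ω → α} {V : Ω → β} {W : Ω → γ}
    (hU : Measurable U) (hV : Measurable V) (hW : Measurable W)
    (h : IndepFun U (fun ω => (V ω, W ω)) P) (hVW : IndepFun V W P) :
    IndepFun (fun ω => (U ω, V ω)) W P := by
  have := Measure.isProbabilityMeasure_map (μ := P) hU.aemeasurable
  have := Measure.isProbabilityMeasure_map (μ := P) hV.aemeasurable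
  have := Measure.isProbabilityMeasure_map (μ := P) hW.aemeasurable
  have hUV : IndepFun U V P := h.comp measurable_id measurable_fst
  rw [indepFun_iff_map_prod_eq_prod_map_map (hU.prodMk hV).aemeasurable hW.aemeasurable,
    (indepFun_iff_map_prod_eq_prod_map_map hU.aemeasurable hV.aemeasurable).1 hUV]
  apply MeasurableEquiv.prodAssoc.map_measurableEquiv_injective
  rw [Measure.prodAssoc_prod,
    ← (indepFun_iff_map_prod_eq_prod_map_map hV.aemeasurable hW.aemeasurable).1 hVW,
    ← (indepFun_iff_map_prod_eq_prod_map_map hU.aemeasurable (hV.prodMk hW).aemeasurable).1 h,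
    Measure.map_map MeasurableEquiv.prodAssoc.measurable ((hU.prodMk hV).prodMk hW)]
  rfl

/-- `ε` is a sequence of i.i.d. `N(0, s²)` variables independent of the random element `p`, which
carries all the randomness of the objective. -/
structure IsGaussianNoise (P : Measure Ω) (s : ℝ≥0) (p : Ω → E) (ε : ℕ → Ω → ℝ) : Prop where
  measurable_param : Measurable p
  measurable_noise : ∀ n, Measurable (ε n)
  noise_law : ∀ n, P.map (ε n) = gaussianReal 0 (s ^ 2)
  noise_indep : iIndepFun ε P
  indep : IndepFun p (fun ω n => ε n ω) P

namespace IsGaussianNoise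

variable {s : ℝ≥0} {p : Ω → E} {ε : ℕ → Ω → ℝ}

lemma hasLaw (h : IsGaussianNoise P s p ε) (n : ℕ) : HasLaw (ε n) (gaussianReal 0 (s ^ 2)) P :=
  ⟨(h.measurable_noise n).aemeasurable, h.noise_law n⟩

lemma hasGaussianLaw (h : IsGaussianNoise P s p ε) (n : ℕ) : HasGaussianLaw (ε n) P where
  isGaussian_map := by rw [h.noise_law n]; infer_instance

lemma memLp (h : IsGaussianNoise P s p ε) (n : ℕ) : MemLp (ε n) 2 P :=
  (h.hasGaussianLaw n).memLp_two

lemma integral_eq_zero (h : IsGaussianNoise P s p ε) (n : ℕ) : ∫ ω, ε n ω ∂P = 0 := by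
  simpa using (h.hasLaw n).integral_eq

lemma variance_eq (h : IsGaussianNoise P s p ε) (n : ℕ) : Var[ε n; P] = (s : ℝ) ^ 2 := by
  simpa using (h.hasLaw n).variance_eq

lemma covariance_eq (h : IsGaussianNoise P s p ε) (i j : ℕ) :
    cov[ε i, ε j; P] = if i = j then (s : ℝ) ^ 2 else 0 := by
  split_ifs with hij
  · subst hij
    rw [covariance_self (h.measurable_noise i).aemeasurable, h.variance_eq]
  · exact (h.noise_indep.indepFun hij).covariance_eq_zero (h.memLp i) (h.memLp j)

lemma indepFun_past [IsProbabilityMeasure P] (h : IsGaussianNoise P s p ε) (n : ℕ) :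
    IndepFun (fun ω => (p ω, fun i : Fin n => ε i ω)) (ε n) P := by
  have hpast : IndepFun (fun ω (i : Fin n) => ε i ω) (ε n) P :=
    (h.noise_indep.indepFun_finset (Finset.range n) {n} (by simp) h.measurable_noise).comp
      (φ := fun (u : Finset.range n → ℝ) (i : Fin n) => u ⟨i, by simp⟩)
      (ψ := fun u : ({n} : Finset ℕ) → ℝ => u ⟨n, by simp⟩) (by fun_prop) (by fun_prop)
  have hparam : IndepFun p (fun ω => ((fun i : Fin n => ε i ω), ε n ω)) P :=
    h.indep.comp (φ := id) (ψ := fun u : ℕ → ℝ => ((fun i : Fin n => u i), u n))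
      measurable_id (by fun_prop)
  exact indepFun_prodMk_left h.measurable_param
    (measurable_pi_lambda _ fun i => h.measurable_noise i) (h.measurable_noise n) hparam hpast

end IsGaussianNoise

end Noise

section Run

variable {d n : ℕ} {Ω Ω' : Type*} {X : Set (Pt d)} {π : Rule d}

/-- The data set `D` followed by one more query/observation pair. -/
abbrev Data.snoc (D : Data d n) (q : Pt d × ℝ) : Data d (n + 1) :=
  Fin.snoc (α := fun _ => Pt d × ℝ) D q

/-- The rule `π` queries points of `X` as long as all earlier queries lie in `X`. -/
def Rule.StaysIn (π : Rule d) (X : Set (Pt d)) : Prop :=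
  ∀ (n : ℕ) (D : Data d n), (∀ i, (D i).1 ∈ X) → π n D ∈ X

/-- The data set `D` followed by the query which `π` makes next and the observation `y`. -/
def Rule.step (π : Rule d) (D : Data d n) (y : ℝ) : Data d (n + 1) := D.snoc (π n D, y)

lemma Rule.StaysIn.step_mem (hπ : π.StaysIn X) {D : Data d n} (hD : ∀ i, (D i).1 ∈ X) (y : ℝ) :
    ∀ i, (π.step D y i).1 ∈ X := by
  refine Fin.lastCases ?_ fun i => ?_
  · simpa [Rule.step] using hπ n D hD
  · simpa [Rule.step] using hD i

/-- The observation `y_{n+1}`. -/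
def observation (π : Rule d) (f : Pt d → Ω → ℝ) (ε : ℕ → Ω → ℝ) (n : ℕ) (ω : Ω) : ℝ :=
  f (query π f ε n ω) ω + ε n ω

lemma history_succ (π : Rule d) (f : Pt d → Ω → ℝ) (ε : ℕ → Ω → ℝ) (ω : Ω) (n : ℕ) :
    history π f ε ω (n + 1) = π.step (history π f ε ω n) (observation π f ε n ω) := rfl

lemma history_eq (π : Rule d) (f : Pt d → Ω → ℝ) (ε : ℕ → Ω → ℝ) (ω : Ω) (n : ℕ) :
    history π f ε ω n = fun i : Fin n => (query π f ε i ω, observation π f ε i ω) := by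
  induction n with
  | zero => exact Subsingleton.elim _ _
  | succ n ih =>
    rw [history_succ, ih]
    funext i
    refine Fin.lastCases ?_ (fun j => ?_) i <;> simp [Rule.step, query, ih]

lemma history_mem (hπ : π.StaysIn X) (f : Pt d → Ω → ℝ) (ε : ℕ → Ω → ℝ) (ω : Ω) (n : ℕ) :
    ∀ i, (history π f ε ω n i).1 ∈ X := by
  induction n with
  | zero => exact fun i => i.elim0
  | succ n ih => exact hπ.step_mem ih _

lemma query_mem (hπ : π.StaysIn X) (f : Pt d → Ω → ℝ) (ε : ℕ → Ω → ℝ) (n : ℕ) (ω : Ω) :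
    query π f ε n ω ∈ X :=
  hπ n _ (history_mem hπ f ε ω n)

lemma history_congr (hπ : π.StaysIn X) {f : Pt d → Ω → ℝ} {f' : Pt d → Ω' → ℝ}
    {ε : ℕ → Ω → ℝ} {ε' : ℕ → Ω' → ℝ} {ω : Ω} {ω' : Ω'} (hf : ∀ x ∈ X, f x ω = f' x ω')
    (hε : ∀ i < n, ε i ω = ε' i ω') : history π f ε ω n = history π f' ε' ω' n := by
  induction n with
  | zero => rfl
  | succ n ih =>
    have hhist := ih fun i hi => hε i (hi.trans n.lt_succ_self)
    have hquery : query π f ε n ω = query π f' ε' n ω' := by simp only [query, hhist]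
    rw [history_succ, history_succ, hhist, observation, observation, hquery,
      hf _ (query_mem hπ f' ε' n ω'), hε n n.lt_succ_self]

lemma measurable_snoc :
    Measurable fun q : Data d n × (Pt d × ℝ) => q.1.snoc q.2 := by
  refine measurable_pi_iff.2 (Fin.lastCases ?_ fun j => ?_)
  · simpa using measurable_snd
  · simp only [Data.snoc, Fin.snoc_castSucc]
    exact (measurable_pi_apply j).comp measurable_fst

lemma measurable_step (hπ : Measurable (π n)) :
    Measurable fun q : Data d n × ℝ => π.step q.1 q.2 :=
  measurable_snoc.comp (measurable_fst.prodMk ((hπ.comp measurable_fst).prodMk measurable_snd))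

lemma measurable_history [MeasurableSpace Ω] (hπ : ∀ n, Measurable (π n)) {f : Pt d → Ω → ℝ}
    (hf : Measurable fun q : Pt d × Ω => f q.1 q.2) {ε : ℕ → Ω → ℝ} (hε : ∀ n, Measurable (ε n))
    (n : ℕ) : Measurable fun ω => history π f ε ω n := by
  induction n with
  | zero => exact measurable_const
  | succ n ih =>
    have hobs : Measurable (observation π f ε n) :=
      (hf.comp (((hπ n).comp ih).prodMk measurable_id)).add (hε n)
    exact (measurable_step (hπ n)).comp (ih.prodMk hobs)

lemma indepFun_history_noise {E : Type*} [MeasurableSpace Ω] [MeasurableSpace E] {P : Measure Ω}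
    [IsProbabilityMeasure P] {s : ℝ≥0} {p : Ω → E} {ε : ℕ → Ω → ℝ} (hε : IsGaussianNoise P s p ε)
    {Φ : Pt d → E → ℝ} (hΦ : Measurable fun q : Pt d × E => Φ q.1 q.2)
    (hπ : ∀ n, Measurable (π n)) (n : ℕ) :
    IndepFun (fun ω => (p ω, history π (fun x ω => Φ x (p ω)) ε ω n)) (ε n) P := by
  let past (i : ℕ) (q : E × (Fin n → ℝ)) : ℝ := if h : i < n then q.2 ⟨i, h⟩ else 0
  have hpast (i : ℕ) : Measurable (past i) := by
    by_cases h : i < n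
    · simp only [past, h, dite_true]; fun_prop
    · simp only [past, h, dite_false]; fun_prop
  have hhist : Measurable fun q => history π (fun x q => Φ x q.1) past q n :=
    measurable_history hπ (f := fun x (q : E × (Fin n → ℝ)) => Φ x q.1)
      (hΦ.comp (measurable_fst.prodMk measurable_snd.fst)) hpast n
  refine ((hε.indepFun_past n).comp (measurable_fst.prodMk hhist) measurable_id).congr
    (.of_forall fun ω => Prod.ext rfl ?_) .rfl
  exact history_congr (X := Set.univ) (fun _ _ _ => trivial) (fun _ _ => rfl)
    fun i hi => by simp [past, hi]

/-- The measure on data sets under which the queries follow the rule `π` and the observations are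
distributed according to Lebesgue measure. The laws of the data for all objectives have densities
with respect to it. -/
noncomputable def refMeasure (π : Rule d) : (n : ℕ) → Measure (Data d n)
  | 0 => Measure.dirac Fin.elim0
  | n + 1 => ((refMeasure π n).prod volume).map fun q => π.step q.1 q.2

lemma lintegral_refMeasure_succ (hπ : Measurable (π n)) {g : Data d (n + 1) → ℝ≥0∞}
    (hg : Measurable g) :
    ∫⁻ D, g D ∂refMeasure π (n + 1) = ∫⁻ D, (∫⁻ y, g (π.step D y)) ∂refMeasure π n := by
  rw [refMeasure, lintegral_map hg (measurable_step hπ)]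
  exact lintegral_prod _ (hg.comp (measurable_step hπ)).aemeasurable

lemma ae_refMeasure_mem (hX : MeasurableSet X) (hπm : ∀ n, Measurable (π n))
    (hπ : π.StaysIn X) (n : ℕ) : ∀ᵐ D ∂refMeasure π n, ∀ i, (D i).1 ∈ X := by
  induction n with
  | zero => exact .of_forall fun D i => i.elim0
  | succ n ih =>
    have hmeas : MeasurableSet {D : Data d (n + 1) | ∀ i, (D i).1 ∈ X} := by
      simp only [Set.ofPred_forall]
      exact MeasurableSet.iInter fun i => hX.preimage ((measurable_pi_apply i).fst)
    rw [refMeasure, ae_map_iff (measurable_step (hπm n)).aemeasurable hmeas]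
    filter_upwards [Measure.quasiMeasurePreserving_fst.ae ih] with q hq
    exact hπ.step_mem hq _

end Run

/-! ### Likelihood of adaptively collected data -/

section Likelihood

variable {d n : ℕ} {Ω E : Type*} [MeasurableSpace Ω] [MeasurableSpace E] {s : ℝ≥0}

/-- The likelihood of the objective `h`: the density, with respect to Lebesgue measure, of the
observations recorded in `D` when the noise variance is `s²`. -/
noncomputable def lik (s : ℝ≥0) (h : Pt d → ℝ) (D : Data d n) : ℝ≥0∞ :=
  ∏ i, gaussianPDF (h (D i).1) (s ^ 2) (D i).2

lemma lik_snoc (s : ℝ≥0) (h : Pt d → ℝ) (D : Data d n) (q : Pt d × ℝ) :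
    lik s h (D.snoc q) = lik s h D * gaussianPDF (h q.1) (s ^ 2) q.2 := by
  simp [lik, Fin.prod_univ_castSucc]

lemma measurable_gaussianPDF_comp {m y : Ω → ℝ} (hm : Measurable m) (hy : Measurable y)
    (v : ℝ≥0) : Measurable fun ω => gaussianPDF (m ω) v (y ω) :=
  measurable_uncurry_gaussianPDF.comp (hm.prodMk (measurable_const.prodMk hy))

lemma measurable_lik {f : Pt d → Ω → ℝ} (hf : Measurable fun q : Pt d × Ω => f q.1 q.2)
    (s : ℝ≥0) (n : ℕ) : Measurable fun q : Ω × Data d n => lik s (f · q.1) q.2 := by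
  refine Finset.measurable_fun_prod _ fun i _ => ?_
  have hi : Measurable fun q : Ω × Data d n => q.2 i :=
    (measurable_pi_apply i).comp measurable_snd
  exact measurable_gaussianPDF_comp (hf.comp (hi.fst.prodMk measurable_fst)) hi.snd _

lemma lintegral_gaussianReal_add_left {v : ℝ≥0} (hv : v ≠ 0) (m : ℝ) {g : ℝ → ℝ≥0∞}
    (hg : Measurable g) :
    ∫⁻ e, g (m + e) ∂gaussianReal 0 v = ∫⁻ y, gaussianPDF m v y * g y := by
  rw [← lintegral_map (g := (m + ·)) hg (by fun_prop), gaussianReal_map_const_add, zero_add,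
    gaussianReal_of_var_ne_zero _ hv,
    lintegral_withDensity_eq_lintegral_mul _ (measurable_gaussianPDF _ _) hg]
  rfl

variable {P : Measure Ω} {π : Rule d} {Φ : Pt d → E → ℝ} {p : Ω → E}
  {ε : ℕ → Ω → ℝ}

lemma measurable_mul_lik (hp : Measurable p) (hΦ : Measurable fun q : Pt d × E => Φ q.1 q.2)
    (s : ℝ≥0) {g : E × Data d n → ℝ≥0∞} (hg : Measurable g) :
    Measurable fun q : Ω × Data d n => g (p q.1, q.2) * lik s (Φ · (p q.1)) q.2 :=
  (hg.comp ((hp.comp measurable_fst).prodMk measurable_snd)).mul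
    (measurable_lik (f := fun x ω => Φ x (p ω))
      (hΦ.comp (measurable_fst.prodMk (hp.comp measurable_snd))) s n)

lemma measurable_gaussianPDF_mul_step (hπ : Measurable (π n))
    (hΦ : Measurable fun q : Pt d × E => Φ q.1 q.2) (s : ℝ≥0)
    {g : E × Data d (n + 1) → ℝ≥0∞} (hg : Measurable g) :
    Measurable fun q : (E × Data d n) × ℝ =>
      gaussianPDF (Φ (π n q.1.2) q.1.1) (s ^ 2) q.2 * g (q.1.1, π.step q.1.2 q.2) := by
  have hmean : Measurable fun q : (E × Data d n) × ℝ => Φ (π n q.1.2) q.1.1 :=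
    hΦ.comp ((hπ.comp measurable_fst.snd).prodMk measurable_fst.fst)
  have hstep : Measurable fun q : (E × Data d n) × ℝ => π.step q.1.2 q.2 :=
    (measurable_step hπ).comp (measurable_fst.snd.prodMk measurable_snd)
  exact (measurable_gaussianPDF_comp hmean measurable_snd _).mul
    (hg.comp (measurable_fst.fst.prodMk hstep))

lemma lintegral_lintegral_step_mul_lik [SFinite P] (hp : Measurable p)
    (hΦ : Measurable fun q : Pt d × E => Φ q.1 q.2) (hπ : Measurable (π n)) (s : ℝ≥0)
    {g : E × Data d (n + 1) → ℝ≥0∞} (hg : Measurable g) (D : Data d n) :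
    ∫⁻ y, ∫⁻ ω, g (p ω, π.step D y) * lik s (Φ · (p ω)) (π.step D y) ∂P =
      ∫⁻ ω, (∫⁻ y, gaussianPDF (Φ (π n D) (p ω)) (s ^ 2) y * g (p ω, π.step D y)) *
        lik s (Φ · (p ω)) D ∂P := by
  have hstep : Measurable fun y => π.step D y :=
    (measurable_step hπ).comp (measurable_const.prodMk measurable_id)
  have hjoint : Measurable fun q : ℝ × Ω =>
      g (p q.2, π.step D q.1) * lik s (Φ · (p q.2)) (π.step D q.1) :=
    (measurable_mul_lik hp hΦ s hg).comp (measurable_snd.prodMk (hstep.comp measurable_fst))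
  have hcond (ω : Ω) : Measurable fun y =>
      gaussianPDF (Φ (π n D) (p ω)) (s ^ 2) y * g (p ω, π.step D y) :=
    (measurable_gaussianPDF _ _).mul (hg.comp (measurable_const.prodMk hstep))
  rw [lintegral_lintegral_swap hjoint.aemeasurable]
  refine lintegral_congr fun ω => ?_
  rw [← lintegral_mul_const _ (hcond ω)]
  exact lintegral_congr fun y => by simp only [Rule.step, lik_snoc]; ring

variable [IsProbabilityMeasure P]

lemma lintegral_history_succ (hε : IsGaussianNoise P s p ε) (hs : 0 < s)
    (hΦ : Measurable fun q : Pt d × E => Φ q.1 q.2) (hπ : ∀ n, Measurable (π n))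
    {g : E × Data d (n + 1) → ℝ≥0∞} (hg : Measurable g) :
    ∫⁻ ω, g (p ω, history π (fun x ω => Φ x (p ω)) ε ω (n + 1)) ∂P =
      ∫⁻ ω, (∫⁻ y, gaussianPDF (Φ (query π (fun x ω => Φ x (p ω)) ε n ω) (p ω)) (s ^ 2) y *
        g (p ω, π.step (history π (fun x ω => Φ x (p ω)) ε ω n) y)) ∂P := by
  have hp := hε.measurable_param
  have hhist : Measurable fun ω => history π (fun x ω => Φ x (p ω)) ε ω n :=
    measurable_history (f := fun x ω => Φ x (p ω)) hπ
      (hΦ.comp (measurable_fst.prodMk (hp.comp measurable_snd))) hε.measurable_noise n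
  have hstep : Measurable fun q : (E × Data d n) × ℝ => g (q.1.1, π.step q.1.2 q.2) :=
    hg.comp (measurable_fst.fst.prodMk
      ((measurable_step (hπ n)).comp (measurable_fst.snd.prodMk measurable_snd)))
  have hobs : Measurable fun q : (E × Data d n) × ℝ =>
      g (q.1.1, π.step q.1.2 (Φ (π n q.1.2) q.1.1 + q.2)) :=
    hstep.comp (measurable_fst.prodMk
      ((hΦ.comp (((hπ n).comp measurable_fst.snd).prodMk measurable_fst.fst)).add measurable_snd))
  have hlaw := (indepFun_iff_map_prod_eq_prod_map_map (hp.prodMk hhist).aemeasurable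
    (hε.measurable_noise n).aemeasurable).1 (indepFun_history_noise hε hΦ hπ n)
  calc _ = ∫⁻ q, g (q.1.1, π.step q.1.2 (Φ (π n q.1.2) q.1.1 + q.2))
        ∂(P.map fun ω => ((p ω, history π (fun x ω => Φ x (p ω)) ε ω n), ε n ω)) := by
        rw [lintegral_map hobs ((hp.prodMk hhist).prodMk (hε.measurable_noise n))]
        rfl
    _ = _ := by
        rw [hlaw, hε.noise_law, lintegral_prod _ hobs.aemeasurable,
          lintegral_map (.lintegral_prod_right hobs) (hp.prodMk hhist)]
        exact lintegral_congr fun ω => lintegral_gaussianReal_add_left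
          (pow_ne_zero 2 hs.ne') (Φ (query π (fun x ω => Φ x (p ω)) ε n ω) (p ω))
          (hstep.comp (measurable_prodMk_left
            (x := (p ω, history π (fun x ω => Φ x (p ω)) ε ω n))))

/-- The likelihood does not see how the query points were chosen. -/
theorem lintegral_history (hε : IsGaussianNoise P s p ε) (hs : 0 < s)
    (hΦ : Measurable fun q : Pt d × E => Φ q.1 q.2) (hπ : ∀ n, Measurable (π n))
    {g : E × Data d n → ℝ≥0∞} (hg : Measurable g) :
    ∫⁻ ω, g (p ω, history π (fun x ω => Φ x (p ω)) ε ω n) ∂P =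
      ∫⁻ D, ∫⁻ ω, g (p ω, D) * lik s (Φ · (p ω)) D ∂P ∂refMeasure π n := by
  have hp := hε.measurable_param
  induction n with
  | zero =>
    rw [refMeasure, lintegral_dirac' _ (measurable_mul_lik hp hΦ s hg).lintegral_prod_left]
    refine lintegral_congr fun ω => ?_
    rw [Subsingleton.elim (history _ _ _ _ _) Fin.elim0]
    simp [lik]
  | succ n ih =>
    let G : E × Data d n → ℝ≥0∞ := fun q =>
      ∫⁻ y, gaussianPDF (Φ (π n q.2) q.1) (s ^ 2) y * g (q.1, π.step q.2 y)
    have hG : Measurable G := (measurable_gaussianPDF_mul_step (hπ n) hΦ s hg).lintegral_prod_right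
    calc ∫⁻ ω, g (p ω, history π (fun x ω => Φ x (p ω)) ε ω (n + 1)) ∂P
        = ∫⁻ ω, G (p ω, history π (fun x ω => Φ x (p ω)) ε ω n) ∂P :=
          lintegral_history_succ hε hs hΦ hπ hg
      _ = ∫⁻ D, ∫⁻ ω, G (p ω, D) * lik s (Φ · (p ω)) D ∂P ∂refMeasure π n := ih hG
      _ = ∫⁻ D, (∫⁻ y, ∫⁻ ω, g (p ω, π.step D y) * lik s (Φ · (p ω)) (π.step D y) ∂P)
            ∂refMeasure π n := lintegral_congr fun D =>
          (lintegral_lintegral_step_mul_lik hp hΦ (hπ n) s hg D).symm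
      _ = _ := by
          rw [lintegral_refMeasure_succ (hπ n)
            (measurable_mul_lik hp hΦ s hg).lintegral_prod_left]

end Likelihood

/-! ### Linear prediction and the GP posterior -/

section LinearPrediction

variable {Ω ι : Type*} [Fintype ι] [MeasurableSpace Ω] {P : Measure Ω} {Z : Ω → ℝ}
  {Y : ι → Ω → ℝ} {w : ι → ℝ}

/-- The error of the linear predictor `∑ i, w i * Y i` of `Z`. -/
def predictionError (Z : Ω → ℝ) (Y : ι → Ω → ℝ) (w : ι → ℝ) (ω : Ω) : ℝ :=
  Z ω - ∑ i, w i * Y i ω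

lemma measurable_predictionError (hZ : Measurable Z) (hY : ∀ i, Measurable (Y i)) :
    Measurable (predictionError Z Y w) :=
  hZ.sub (Finset.measurable_fun_sum _ fun i _ => (hY i).const_mul _)

lemma memLp_predictionError (hZ : MemLp Z 2 P) (hY : ∀ i, MemLp (Y i) 2 P) :
    MemLp (predictionError Z Y w) 2 P :=
  hZ.sub (memLp_finsetSum _ fun i _ => (hY i).const_mul _)

lemma integral_predictionError (hZ : Integrable Z P) (hY : ∀ i, Integrable (Y i) P)
    (hZ0 : ∫ ω, Z ω ∂P = 0) (hY0 : ∀ i, ∫ ω, Y i ω ∂P = 0) :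
    ∫ ω, predictionError Z Y w ω ∂P = 0 := by
  have hint (i : ι) : Integrable (fun ω => w i * Y i ω) P := (hY i).const_mul _
  simp only [predictionError, integral_sub hZ (integrable_finsetSum _ fun i _ => hint i),
    integral_finsetSum _ fun i _ => hint i, integral_const_mul, hZ0, hY0, mul_zero,
    Finset.sum_const_zero, sub_zero]

section FiniteMeasure

variable [IsFiniteMeasure P]

lemma covariance_predictionError_left {U : Ω → ℝ} (hZ : MemLp Z 2 P)
    (hY : ∀ i, MemLp (Y i) 2 P) (hU : MemLp U 2 P) :
    cov[predictionError Z Y w, U; P] = cov[Z, U; P] - ∑ i, w i * cov[Y i, U; P] := by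
  have hwY (i : ι) : MemLp (fun ω => w i * Y i ω) 2 P := (hY i).const_mul _
  unfold predictionError
  rw [covariance_fun_sub_left hZ (memLp_finsetSum _ fun i _ => hwY i) hU,
    covariance_fun_sum_left hwY hU]
  simp only [covariance_const_mul_left]

lemma covariance_predictionError_eq_zero (hZ : MemLp Z 2 P) (hY : ∀ i, MemLp (Y i) 2 P)
    (hw : ∀ j, ∑ i, w i * cov[Y i, Y j; P] = cov[Z, Y j; P]) (j : ι) :
    cov[predictionError Z Y w, Y j; P] = 0 := by
  rw [covariance_predictionError_left hZ hY (hY j), hw, sub_self]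

lemma variance_predictionError (hZ : MemLp Z 2 P) (hY : ∀ i, MemLp (Y i) 2 P)
    (hw : ∀ j, ∑ i, w i * cov[Y i, Y j; P] = cov[Z, Y j; P]) :
    Var[predictionError Z Y w; P] = Var[Z; P] - ∑ i, w i * cov[Z, Y i; P] := by
  have hE : MemLp (predictionError Z Y w) 2 P := memLp_predictionError hZ hY
  have herror : cov[Z, predictionError Z Y w; P] = Var[predictionError Z Y w; P] := by
    rw [← covariance_self hE.aemeasurable, covariance_predictionError_left hZ hY hE]
    simp only [covariance_comm (Y _), covariance_predictionError_eq_zero hZ hY hw, mul_zero,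
      Finset.sum_const_zero, sub_zero]
  rw [← herror, covariance_comm, covariance_predictionError_left hZ hY hZ,
    covariance_self hZ.aemeasurable]
  simp only [covariance_comm (Y _)]

lemma posSemidef_covariance {ι : Type*} [Finite ι] {Y : ι → Ω → ℝ}
    (hY : ∀ i, MemLp (Y i) 2 P) :
    (Matrix.of fun i j => cov[Y i, Y j; P]).PosSemidef := by
  have := Fintype.ofFinite ι
  refine .of_dotProduct_mulVec_nonneg (by ext i j; exact covariance_comm _ _) fun v => ?_
  have hvY (i : ι) : MemLp (fun ω => v i * Y i ω) 2 P := (hY i).const_mul _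
  have hvar : Var[fun ω => ∑ i, v i * Y i ω; P] =
      star v ⬝ᵥ (Matrix.of fun i j => cov[Y i, Y j; P]).mulVec v := by
    rw [← covariance_self (memLp_finsetSum _ fun i _ => hvY i).aemeasurable,
      covariance_fun_sum_fun_sum hvY hvY]
    simp only [dotProduct, Matrix.mulVec, Matrix.of_apply, Finset.mul_sum, Pi.star_apply,
      star_trivial, covariance_const_mul_left, covariance_const_mul_right]
    exact Finset.sum_congr rfl fun i _ => Finset.sum_congr rfl fun j _ => by ring
  exact hvar ▸ variance_nonneg _ _

end FiniteMeasure

lemma hasGaussianLaw_predictionError (h : HasGaussianLaw (fun ω => (Z ω, fun i => Y i ω)) P) :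
    HasGaussianLaw (fun ω => (predictionError Z Y w ω, fun i => Y i ω)) P := by
  let L : ℝ × (ι → ℝ) →L[ℝ] ℝ × (ι → ℝ) :=
    (ContinuousLinearMap.fst ℝ ℝ (ι → ℝ) - (∑ i, w i • ContinuousLinearMap.proj i).comp
      (ContinuousLinearMap.snd ℝ ℝ (ι → ℝ))).prod (ContinuousLinearMap.snd ℝ ℝ (ι → ℝ))
  have hL (ω : Ω) : L (Z ω, fun i => Y i ω) = (predictionError Z Y w ω, fun i => Y i ω) := by
    simp [L, predictionError]
  simpa only [hL] using h.map_fun L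

lemma indepFun_predictionError (h : HasGaussianLaw (fun ω => (Z ω, fun i => Y i ω)) P)
    (hw : ∀ j, ∑ i, w i * cov[Y i, Y j; P] = cov[Z, Y j; P]) :
    IndepFun (predictionError Z Y w) (fun ω i => Y i ω) P := by
  have := h.isProbabilityMeasure
  have hunit : HasGaussianLaw
      (fun ω => ((fun _ : Unit => predictionError Z Y w ω), fun i => Y i ω)) P :=
    (hasGaussianLaw_predictionError (w := w) h).map_fun
      ((ContinuousLinearMap.pi fun _ : Unit => ContinuousLinearMap.fst ℝ ℝ (ι → ℝ)).prod
        (ContinuousLinearMap.snd ℝ ℝ (ι → ℝ)))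
  exact (hunit.indepFun_of_covariance_eval fun _ j => covariance_predictionError_eq_zero
    h.fst.memLp_two (fun i => (h.snd.eval i).memLp_two) hw j).comp
    (φ := fun u : Unit → ℝ => u ()) (by fun_prop) measurable_id

end LinearPrediction

section Regression

variable {d n : ℕ} {Ω : Type*} {k : Pt d → Pt d → ℝ} {s : ℝ≥0} {D : Data d n} {x y : Pt d}

/-- The weights of the observations in the posterior mean at `x`. -/
noncomputable def weights (k : Pt d → Pt d → ℝ) (s : ℝ≥0) (D : Data d n) (x : Pt d) : Fin n → ℝ :=
  ((regKernelMatrix k s D)⁻¹).mulVec (kernelVec k D x)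

/-- The error of the posterior mean when predicting `f x` from noisy observations at the query
points of `D`. -/
noncomputable def residual (k : Pt d → Pt d → ℝ) (s : ℝ≥0) (f : Pt d → Ω → ℝ) (ε : ℕ → Ω → ℝ)
    (D : Data d n) (x : Pt d) : Ω → ℝ :=
  predictionError (f x) (fun i ω => f (D i).1 ω + ε i ω) (weights k s D x)

lemma regKernelMatrix_apply (D : Data d n) (i j : Fin n) :
    regKernelMatrix k s D i j = k (D i).1 (D j).1 + if i = j then (s : ℝ) ^ 2 else 0 := by
  simp [regKernelMatrix, Matrix.one_apply]

lemma postVar_eq (D : Data d n) (x : Pt d) :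
    postVar k s D x = k x x - ∑ i, weights k s D x i * k x (D i).1 := by
  rw [postVar, dotProduct_comm]
  rfl

namespace IsGPModel

variable [MeasurableSpace Ω] {P : Measure Ω} {X : Set (Pt d)} {f : Pt d → Ω → ℝ} {ε : ℕ → Ω → ℝ}

lemma isGaussianNoise (hm : IsGPModel P X k s f ε) :
    IsGaussianNoise P s (fun ω (x : X) => f x ω) ε where
  measurable_param := measurable_pi_lambda _ fun x => hm.measurable_f x x.2
  measurable_noise := hm.measurable_noise
  noise_law := hm.noise_law
  noise_indep := hm.noise_indep
  indep := hm.indep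

lemma memLp_f (hm : IsGPModel P X k s f ε) (hx : x ∈ X) : MemLp (f x) 2 P :=
  (hm.gaussian.hasGaussianLaw_eval ⟨x, hx⟩).memLp_two

lemma memLp_obs (hm : IsGPModel P X k s f ε) (hx : x ∈ X) (i : ℕ) :
    MemLp (fun ω => f x ω + ε i ω) 2 P := (hm.memLp_f hx).add (hm.isGaussianNoise.memLp i)

lemma kernel_comm (hm : IsGPModel P X k s f ε) (hx : x ∈ X) (hy : y ∈ X) : k x y = k y x := by
  rw [← hm.cov x hx y hy, covariance_comm, hm.cov y hy x hx]

lemma measurable_residual (hm : IsGPModel P X k s f ε) (hD : ∀ i, (D i).1 ∈ X) (hx : x ∈ X) :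
    Measurable (residual k s f ε D x) :=
  measurable_predictionError (hm.measurable_f x hx) fun i =>
    (hm.measurable_f _ (hD i)).add (hm.measurable_noise i)

lemma memLp_residual (hm : IsGPModel P X k s f ε) (hD : ∀ i, (D i).1 ∈ X) (hx : x ∈ X) :
    MemLp (residual k s f ε D x) 2 P :=
  memLp_predictionError (hm.memLp_f hx) fun i => hm.memLp_obs (hD i) i

lemma cov_f_noise (hm : IsGPModel P X k s f ε) (hx : x ∈ X) (i : ℕ) : cov[f x, ε i; P] = 0 := by
  have hind : IndepFun (f x) (ε i) P :=
    hm.indep.comp (φ := fun u : X → ℝ => u ⟨x, hx⟩) (ψ := fun u : ℕ → ℝ => u i)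
      (by fun_prop) (by fun_prop)
  exact hind.covariance_eq_zero (hm.memLp_f hx) (hm.isGaussianNoise.memLp i)

lemma hasGaussianLaw_f_obs (hm : IsGPModel P X k s f ε) (hD : ∀ i, (D i).1 ∈ X) (hx : x ∈ X) :
    HasGaussianLaw (fun ω => (f x ω, fun i : Fin n => f (D i).1 ω + ε i ω)) P := by
  have hnoise : HasGaussianLaw (fun ω (i : Fin n) => ε i ω) P :=
    (hm.noise_indep.precomp Fin.val_injective).hasGaussianLaw
      fun i => hm.isGaussianNoise.hasGaussianLaw i
  have hf : HasGaussianLaw (fun ω => (f x ω, fun i : Fin n => f (D i).1 ω)) P := by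
    let u : Option (Fin n) → X := fun o => o.elim ⟨x, hx⟩ fun i => ⟨(D i).1, hD i⟩
    let L : (↥(Finset.univ : Finset (Option (Fin n))) → ℝ) →L[ℝ] ℝ × (Fin n → ℝ) :=
      (ContinuousLinearMap.proj ⟨none, Finset.mem_univ _⟩).prod
        (ContinuousLinearMap.pi fun i => ContinuousLinearMap.proj ⟨some i, Finset.mem_univ _⟩)
    exact ((hm.gaussian.comp_right u).hasGaussianLaw Finset.univ).map_fun L
  have hind : IndepFun (fun ω => (f x ω, fun i : Fin n => f (D i).1 ω))
      (fun ω (i : Fin n) => ε i ω) P :=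
    hm.indep.comp (φ := fun v : X → ℝ => (v ⟨x, hx⟩, fun i : Fin n => v ⟨(D i).1, hD i⟩))
      (ψ := fun v : ℕ → ℝ => fun i : Fin n => v i) (by fun_prop) (by fun_prop)
  let V := ℝ × (Fin n → ℝ)
  let L : V × (Fin n → ℝ) →L[ℝ] V :=
    ContinuousLinearMap.fst ℝ V _ + (0 : V × (Fin n → ℝ) →L[ℝ] ℝ).prod (.snd ℝ V _)
  have hL (ω : Ω) : L ((f x ω, fun i : Fin n => f (D i).1 ω), fun i : Fin n => ε i ω) =
      (f x ω, fun i : Fin n => f (D i).1 ω + ε i ω) :=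
    Prod.ext (add_zero _) rfl
  simpa only [hL] using (hind.hasGaussianLaw hf hnoise).map_fun L

variable [IsProbabilityMeasure P]

lemma integral_obs (hm : IsGPModel P X k s f ε) (hx : x ∈ X) (i : ℕ) :
    ∫ ω, (f x ω + ε i ω) ∂P = 0 := by
  rw [integral_add ((hm.memLp_f hx).integrable one_le_two)
    ((hm.isGaussianNoise.memLp i).integrable one_le_two), hm.mean x hx,
    hm.isGaussianNoise.integral_eq_zero, add_zero]

lemma cov_f_obs (hm : IsGPModel P X k s f ε) (hx : x ∈ X) (hy : y ∈ X) (i : ℕ) :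
    cov[f x, fun ω => f y ω + ε i ω; P] = k x y :=
  (covariance_add_right (hm.memLp_f hx) (hm.memLp_f hy) (hm.isGaussianNoise.memLp i)).trans <| by
    rw [hm.cov x hx y hy, hm.cov_f_noise hx, add_zero]

lemma cov_obs (hm : IsGPModel P X k s f ε) (hx : x ∈ X) (hy : y ∈ X) (i j : ℕ) :
    cov[fun ω => f x ω + ε i ω, fun ω => f y ω + ε j ω; P] =
      k x y + if i = j then (s : ℝ) ^ 2 else 0 := by
  have hε := hm.isGaussianNoise.memLp
  have hnoise : cov[ε i, fun ω => f y ω + ε j ω; P] = if i = j then (s : ℝ) ^ 2 else 0 :=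
    (covariance_add_right (hε i) (hm.memLp_f hy) (hε j)).trans <| by
      rw [covariance_comm (ε i) (f y), hm.cov_f_noise hy, zero_add,
        hm.isGaussianNoise.covariance_eq]
  exact (covariance_add_left (hm.memLp_f hx) (hε i) (hm.memLp_obs hy j)).trans <| by
    rw [hm.cov_f_obs hx hy, hnoise]

lemma regKernelMatrix_posDef (hm : IsGPModel P X k s f ε) (hs : 0 < s) (hD : ∀ i, (D i).1 ∈ X) :
    (regKernelMatrix k s D).PosDef := by
  have hK : (Matrix.of fun i j => k (D i).1 (D j).1).PosSemidef := by
    simpa only [hm.cov _ (hD _) _ (hD _)] using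
      posSemidef_covariance fun i => hm.memLp_f (hD i)
  exact Matrix.PosDef.posSemidef_add hK (Matrix.PosDef.one.smul (by positivity))

lemma mulVec_weights (hm : IsGPModel P X k s f ε) (hs : 0 < s) (hD : ∀ i, (D i).1 ∈ X)
    (x : Pt d) : (regKernelMatrix k s D).mulVec (weights k s D x) = kernelVec k D x := by
  rw [weights, Matrix.mulVec_mulVec, Matrix.mul_nonsing_inv _
    ((Matrix.isUnit_iff_isUnit_det _).1 (hm.regKernelMatrix_posDef hs hD).isUnit),
    Matrix.one_mulVec]

lemma postMean_eq (hm : IsGPModel P X k s f ε) (hs : 0 < s) (hD : ∀ i, (D i).1 ∈ X) (x : Pt d) :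
    postMean k s D x = ∑ i, weights k s D x i * (D i).2 := by
  have hsymm : ((regKernelMatrix k s D)⁻¹).transpose = (regKernelMatrix k s D)⁻¹ := by
    rw [← Matrix.conjTranspose_eq_transpose_of_trivial]
    exact (hm.regKernelMatrix_posDef hs hD).isHermitian.inv
  rw [postMean, Matrix.dotProduct_mulVec, ← Matrix.mulVec_transpose, hsymm]
  rfl

lemma postVar_le (hm : IsGPModel P X k s f ε) (hs : 0 < s) (hD : ∀ i, (D i).1 ∈ X) (x : Pt d) :
    postVar k s D x ≤ k x x :=
  sub_le_self _ <| by
    simpa only [star_trivial] using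
      (hm.regKernelMatrix_posDef hs hD).inv.posSemidef.dotProduct_mulVec_nonneg (kernelVec k D x)

lemma normal_equations (hm : IsGPModel P X k s f ε) (hs : 0 < s) (hD : ∀ i, (D i).1 ∈ X)
    (hx : x ∈ X) (j : Fin n) :
    ∑ i : Fin n, weights k s D x i *
        cov[fun ω => f (D i).1 ω + ε i ω, fun ω => f (D j).1 ω + ε j ω; P] =
      cov[f x, fun ω => f (D j).1 ω + ε j ω; P] := by
  rw [hm.cov_f_obs hx (hD j)]
  refine Eq.trans (Finset.sum_congr rfl fun i _ => ?_) (congrFun (hm.mulVec_weights hs hD x) j)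
  dsimp only
  rw [hm.cov_obs (hD i) (hD j), regKernelMatrix_apply, hm.kernel_comm (hD i) (hD j), mul_comm]
  simp only [Fin.ext_iff, eq_comm]

lemma integral_residual (hm : IsGPModel P X k s f ε) (hD : ∀ i, (D i).1 ∈ X) (hx : x ∈ X) :
    ∫ ω, residual k s f ε D x ω ∂P = 0 :=
  integral_predictionError ((hm.memLp_f hx).integrable one_le_two)
    (fun i => (hm.memLp_obs (hD i) i).integrable one_le_two) (hm.mean x hx)
    fun i => hm.integral_obs (hD i) i

lemma variance_residual (hm : IsGPModel P X k s f ε) (hs : 0 < s) (hD : ∀ i, (D i).1 ∈ X)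
    (hx : x ∈ X) : Var[residual k s f ε D x; P] = postVar k s D x := by
  rw [residual, variance_predictionError (hm.memLp_f hx) (fun i => hm.memLp_obs (hD i) i)
    (hm.normal_equations hs hD hx), ← covariance_self (hm.memLp_f hx).aemeasurable,
    hm.cov x hx x hx, postVar_eq]
  simp only [hm.cov_f_obs hx (hD _)]

lemma postVar_nonneg (hm : IsGPModel P X k s f ε) (hs : 0 < s) (hD : ∀ i, (D i).1 ∈ X)
    (hx : x ∈ X) : 0 ≤ postVar k s D x :=
  hm.variance_residual hs hD hx ▸ variance_nonneg _ _

lemma indepFun_residual_obs (hm : IsGPModel P X k s f ε) (hs : 0 < s) (hD : ∀ i, (D i).1 ∈ X)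
    (hx : x ∈ X) :
    IndepFun (residual k s f ε D x) (fun ω (i : Fin n) => f (D i).1 ω + ε i ω) P :=
  indepFun_predictionError (hm.hasGaussianLaw_f_obs hD hx) (hm.normal_equations hs hD hx)

lemma map_residual (hm : IsGPModel P X k s f ε) (hs : 0 < s) (hD : ∀ i, (D i).1 ∈ X)
    (hx : x ∈ X) :
    P.map (residual k s f ε D x) = gaussianReal 0 (postVar k s D x).toNNReal := by
  have h : HasGaussianLaw (residual k s f ε D x) P :=
    (hasGaussianLaw_predictionError (hm.hasGaussianLaw_f_obs hD hx)).fst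
  rw [h.map_eq_gaussianReal, hm.variance_residual hs hD hx, hm.integral_residual hD hx]

lemma integral_innovation_sq (hm : IsGPModel P X k s f ε) (hs : 0 < s) (hD : ∀ i, (D i).1 ∈ X)
    (hx : x ∈ X) :
    Integrable (fun ω => (residual k s f ε D x ω + ε n ω) ^ 2) P ∧
      ∫ ω, (residual k s f ε D x ω + ε n ω) ^ 2 ∂P = postVar k s D x + (s : ℝ) ^ 2 := by
  have hR := hm.memLp_residual (s := s) hD hx
  have hN := hm.isGaussianNoise.memLp n
  have hind : IndepFun (residual k s f ε D x) (ε n) P :=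
    (hm.isGaussianNoise.indepFun_past n).comp
      (φ := fun q : (X → ℝ) × (Fin n → ℝ) =>
        q.1 ⟨x, hx⟩ - ∑ i, weights k s D x i * (q.1 ⟨(D i).1, hD i⟩ + q.2 i))
      (ψ := id) (by fun_prop) measurable_id
  have hmean : ∫ ω, (residual k s f ε D x + ε n) ω ∂P = 0 := by
    rw [integral_add' (hR.integrable one_le_two) (hN.integrable one_le_two),
      hm.integral_residual hD hx, hm.isGaussianNoise.integral_eq_zero, add_zero]
  refine ⟨(hR.add hN).integrable_sq, ?_⟩
  rw [← hm.variance_residual hs hD hx, ← hm.isGaussianNoise.variance_eq n,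
    ← hind.variance_add hR hN, variance_of_integral_eq_zero (hR.add hN).aemeasurable hmean]
  rfl

end IsGPModel

end Regression

section GaussianDensity

variable {n : ℕ} {v : ℝ≥0}

lemma pi_gaussianReal_eq_withDensity (m : Fin n → ℝ) (hv : v ≠ 0) :
    Measure.pi (fun i => gaussianReal (m i) v) =
      volume.withDensity fun y : Fin n → ℝ => ∏ i, gaussianPDF (m i) v (y i) := by
  refine Measure.pi_eq fun t ht => ?_
  have hvol : (volume : Measure (Fin n → ℝ)).restrict (Set.univ.pi t) =
      Measure.pi fun i => volume.restrict (t i) := by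
    rw [volume_pi, Measure.restrict_pi_pi]
  have hprod (y : Fin n → ℝ) : ∏ i, gaussianPDF (m i) v (y i) =
      ENNReal.ofReal (∏ i, gaussianPDFReal (m i) v (y i)) :=
    (ENNReal.ofReal_prod_of_nonneg fun i _ => gaussianPDFReal_nonneg _ _ _).symm
  rw [withDensity_apply _ (MeasurableSet.univ_pi ht), hvol]
  simp only [hprod]
  rw [← ofReal_integral_eq_lintegral_ofReal
      (Integrable.fintype_prod fun i => (integrable_gaussianPDFReal _ _).restrict)
      (.of_forall fun y => Finset.prod_nonneg fun i _ => gaussianPDFReal_nonneg _ _ _),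
    integral_fintype_prod_eq_prod, ENNReal.ofReal_prod_of_nonneg fun i _ =>
      integral_nonneg fun z => gaussianPDFReal_nonneg _ _ _]
  exact Finset.prod_congr rfl fun i _ => (gaussianReal_apply_eq_integral _ hv _).symm

lemma lintegral_pi_gaussianReal_add_left (m : Fin n → ℝ) (hv : v ≠ 0)
    {g : (Fin n → ℝ) → ℝ≥0∞} (hg : Measurable g) :
    ∫⁻ e, g (fun i => m i + e i) ∂Measure.pi (fun _ : Fin n => gaussianReal 0 v) =
      ∫⁻ y, g y * ∏ i, gaussianPDF (m i) v (y i) := by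
  have hmp : MeasurePreserving (fun (e : Fin n → ℝ) i => m i + e i)
      (Measure.pi fun _ : Fin n => gaussianReal 0 v)
      (Measure.pi fun i => gaussianReal (m i) v) := by
    refine measurePreserving_pi _ _ fun i => ⟨by fun_prop, ?_⟩
    rw [gaussianReal_map_const_add, zero_add]
  rw [hmp.lintegral_comp hg, pi_gaussianReal_eq_withDensity m hv,
    lintegral_withDensity_eq_lintegral_mul _ _ hg]
  · simp only [Pi.mul_apply, mul_comm]
  · exact Finset.measurable_fun_prod _ fun i _ =>
      (measurable_gaussianPDF _ _).comp (measurable_pi_apply i)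

lemma gaussianPDF_le (m : ℝ) (v : ℝ≥0) (y : ℝ) :
    gaussianPDF m v y ≤ ENNReal.ofReal (√(2 * Real.pi * v))⁻¹ := by
  refine ENNReal.ofReal_le_ofReal (mul_le_of_le_one_right (by positivity) ?_)
  rw [Real.exp_le_one_iff, neg_div]
  exact neg_nonpos.2 (by positivity)

lemma lintegral_gaussianReal_eq_lintegral_add (m : ℝ) (v : ℝ≥0) {g : ℝ → ℝ≥0∞}
    (hg : Measurable g) : ∫⁻ z, g z ∂gaussianReal m v = ∫⁻ z, g (m + z) ∂gaussianReal 0 v := by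
  rw [← lintegral_map (g := (m + ·)) hg (by fun_prop), gaussianReal_map_const_add, zero_add]

lemma continuous_lintegral_gaussianReal (ψ : BoundedContinuousFunction ℝ ℝ≥0) (v : ℝ≥0) :
    Continuous fun m => ∫⁻ z, ψ z ∂gaussianReal m v := by
  have hψ : Measurable fun z => (ψ z : ℝ≥0∞) := ψ.continuous.measurable.coe_nnreal_ennreal
  simp only [fun m => lintegral_gaussianReal_eq_lintegral_add m v hψ]
  refine continuous_iff_continuousAt.2 fun m => tendsto_lintegral_filter_of_dominated_convergence
    (fun _ => (nndist 0 ψ : ℝ≥0∞)) (.of_forall fun m => hψ.comp (by fun_prop))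
    (.of_forall fun m => .of_forall fun z => ?_) (by simp) (.of_forall fun z => ?_)
  · exact ENNReal.coe_le_coe.2 (ψ.apply_le_nndist_zero _)
  · exact (ENNReal.continuous_coe.comp
      (ψ.continuous.comp (continuous_id.add continuous_const))).tendsto m

end GaussianDensity

/-! ### The Bayes formula -/

section FixedDesign

variable {d n : ℕ} {s : ℝ≥0}

/-- The data set which records the observations `y` at the query points `a`. -/
abbrev Data.of (a : Fin n → Pt d) (y : Fin n → ℝ) : Data d n := fun i => (a i, y i)

lemma lik_le (s : ℝ≥0) (h : Pt d → ℝ) (D : Data d n) :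
    lik s h D ≤ ENNReal.ofReal (√(2 * Real.pi * (s ^ 2 : ℝ≥0)))⁻¹ ^ n :=
  (Finset.prod_le_prod' fun i _ => gaussianPDF_le _ _ _).trans_eq (by simp)

lemma continuous_lik (s : ℝ≥0) (h : Pt d → ℝ) (a : Fin n → Pt d) :
    Continuous fun y : Fin n → ℝ => lik s h (.of a y) := by
  have hreal (y : Fin n → ℝ) : lik s h (.of a y) =
      ENNReal.ofReal (∏ i, gaussianPDFReal (h (a i)) (s ^ 2) (y i)) :=
    (ENNReal.ofReal_prod_of_nonneg fun i _ => gaussianPDFReal_nonneg _ _ _).symm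
  simp only [hreal, gaussianPDFReal]
  exact ENNReal.continuous_ofReal.comp (by fun_prop)

lemma continuous_postMean (k : Pt d → Pt d → ℝ) (s : ℝ≥0) (a : Fin n → Pt d) (x : Pt d) :
    Continuous fun y : Fin n → ℝ => postMean k s (.of a y) x :=
  (continuous_const (y := kernelVec k (.of a 0) x)).dotProduct
    ((continuous_const (y := (regKernelMatrix k s (.of a 0))⁻¹)).matrix_mulVec continuous_id)

variable {Ω : Type*} [MeasurableSpace Ω] {P : Measure Ω} {f : Pt d → Ω → ℝ} {a : Fin n → Pt d}

lemma measurable_lik_of (hf : ∀ i, Measurable (f (a i))) (s : ℝ≥0) :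
    Measurable fun q : Ω × (Fin n → ℝ) => lik s (f · q.1) (.of a q.2) :=
  Finset.measurable_fun_prod _ fun i _ => measurable_gaussianPDF_comp
    ((hf i).comp measurable_fst) ((measurable_pi_apply i).comp measurable_snd) _

lemma measurable_lik_apply {D : Data d n} (hf : ∀ i, Measurable (f (D i).1)) (s : ℝ≥0) :
    Measurable fun ω => lik s (f · ω) D :=
  Finset.measurable_fun_prod _ fun i _ => measurable_gaussianPDF_comp (hf i) measurable_const _

lemma lintegral_lik_ne_top [IsFiniteMeasure P] (D : Data d n) :
    ∫⁻ ω, lik s (f · ω) D ∂P ≠ ∞ := by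
  refine ((lintegral_mono fun ω => lik_le s (f · ω) D).trans_lt ?_).ne
  rw [lintegral_const]
  exact ENNReal.mul_lt_top (ENNReal.pow_lt_top ENNReal.ofReal_lt_top) (measure_lt_top _ _)

lemma continuous_lintegral_mul_lik [IsFiniteMeasure P] (hf : ∀ i, Measurable (f (a i)))
    {h : Ω → ℝ≥0} (hh : Measurable h) {C : ℝ≥0} (hC : ∀ ω, h ω ≤ C) :
    Continuous fun y : Fin n → ℝ => ∫⁻ ω, h ω * lik s (f · ω) (.of a y) ∂P := by
  refine continuous_iff_continuousAt.2 fun y => tendsto_lintegral_filter_of_dominated_convergence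
    (fun _ => C * ENNReal.ofReal (√(2 * Real.pi * (s ^ 2 : ℝ≥0)))⁻¹ ^ n)
    (.of_forall fun y => ?_) (.of_forall fun y => .of_forall fun ω => ?_) ?_
    (.of_forall fun ω => ?_)
  · exact hh.coe_nnreal_ennreal.mul (measurable_lik_apply (D := .of a y) hf s)
  · exact mul_le_mul' (ENNReal.coe_le_coe.2 (hC ω)) (lik_le _ _ _)
  · rw [lintegral_const]
    exact (ENNReal.mul_lt_top (ENNReal.mul_lt_top ENNReal.coe_lt_top
      (ENNReal.pow_lt_top ENNReal.ofReal_lt_top)) (measure_lt_top _ _)).ne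
  · exact ENNReal.Tendsto.const_mul ((continuous_lik s (f · ω) a).tendsto y)
      (Or.inr ENNReal.coe_ne_top)

namespace IsGaussianNoise

variable {E : Type*} [MeasurableSpace E] {p : Ω → E} {ε : ℕ → Ω → ℝ} [IsProbabilityMeasure P]

lemma map_pi (h : IsGaussianNoise P s p ε) (n : ℕ) :
    P.map (fun ω (i : Fin n) => ε i ω) = Measure.pi fun _ => gaussianReal 0 (s ^ 2) := by
  rw [(iIndepFun_iff_map_fun_eq_pi_map fun i : Fin n => (h.measurable_noise i).aemeasurable).1
    (h.noise_indep.precomp Fin.val_injective)]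
  simp only [h.noise_law]

lemma lintegral_add_noise (h : IsGaussianNoise P s p ε) (hs : 0 < s) {m : E → Fin n → ℝ}
    (hm : Measurable m) {g : E × (Fin n → ℝ) → ℝ≥0∞} (hg : Measurable g) :
    ∫⁻ ω, g (p ω, fun i => m (p ω) i + ε i ω) ∂P =
      ∫⁻ ω, (∫⁻ y, g (p ω, y) * ∏ i, gaussianPDF (m (p ω) i) (s ^ 2) (y i)) ∂P := by
  have hp := h.measurable_param
  have hε : Measurable fun ω (i : Fin n) => ε i ω :=
    measurable_pi_lambda _ fun i => h.measurable_noise i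
  have hlaw := (indepFun_iff_map_prod_eq_prod_map_map hp.aemeasurable hε.aemeasurable).1
    (h.indep.comp (ψ := fun (u : ℕ → ℝ) (i : Fin n) => u i) measurable_id (by fun_prop))
  have hobs : Measurable fun q : E × (Fin n → ℝ) => g (q.1, fun i => m q.1 i + q.2 i) :=
    hg.comp (by fun_prop)
  calc _ = ∫⁻ q, g (q.1, fun i => m q.1 i + q.2 i)
        ∂(P.map fun ω => (p ω, fun i : Fin n => ε i ω)) :=
        (lintegral_map hobs (hp.prodMk hε)).symm
    _ = ∫⁻ ω, ∫⁻ e, g (p ω, fun i => m (p ω) i + e i)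
          ∂(Measure.pi fun _ : Fin n => gaussianReal 0 (s ^ 2)) ∂P := by
        refine (congrArg (lintegral · _) (hlaw.trans (by rw [h.map_pi]))).trans ?_
        rw [lintegral_prod _ hobs.aemeasurable, lintegral_map hobs.lintegral_prod_right hp]
    _ = _ := lintegral_congr fun ω => lintegral_pi_gaussianReal_add_left _
        (pow_ne_zero _ hs.ne') (hg.comp measurable_prodMk_left)

end IsGaussianNoise

namespace IsGPModel

variable {X : Set (Pt d)} {k : Pt d → Pt d → ℝ} {ε : ℕ → Ω → ℝ} [IsProbabilityMeasure P] {x : Pt d}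

lemma lintegral_design (hm : IsGPModel P X k s f ε) (hs : 0 < s) (ha : ∀ i, a i ∈ X)
    {g : (X → ℝ) × (Fin n → ℝ) → ℝ≥0∞} (hg : Measurable g) :
    ∫⁻ ω, g (fun x => f x ω, fun i => f (a i) ω + ε i ω) ∂P =
      ∫⁻ y : Fin n → ℝ, ∫⁻ ω, g (fun x => f x ω, y) * lik s (f · ω) (.of a y) ∂P := by
  have hp : Measurable fun ω (x : X) => f x ω := hm.isGaussianNoise.measurable_param
  have hjoint : Measurable fun q : Ω × (Fin n → ℝ) =>
      g (fun x => f x q.1, q.2) * lik s (f · q.1) (.of a q.2) :=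
    (hg.comp ((hp.comp measurable_fst).prodMk measurable_snd)).mul
      (measurable_lik_of (fun i => hm.measurable_f _ (ha i)) s)
  refine Eq.trans ?_ (lintegral_lintegral_swap (μ := P) (ν := volume)
    (f := fun ω y => g (fun x => f x ω, y) * lik s (f · ω) (.of a y)) hjoint.aemeasurable)
  have hmean : Measurable fun (u : X → ℝ) (i : Fin n) => u ⟨a i, ha i⟩ := by fun_prop
  exact hm.isGaussianNoise.lintegral_add_noise hs hmean hg

lemma lintegral_obs_f (hm : IsGPModel P X k s f ε) (hs : 0 < s) (ha : ∀ i, a i ∈ X) (hx : x ∈ X)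
    {g : (Fin n → ℝ) × ℝ → ℝ≥0∞} (hg : Measurable g) :
    ∫⁻ ω, g (fun i => f (a i) ω + ε i ω, f x ω) ∂P =
      ∫⁻ ω, ∫⁻ z, g (fun i => f (a i) ω + ε i ω, z)
        ∂gaussianReal (postMean k s (.of a fun i => f (a i) ω + ε i ω) x)
          (postVar k s (.of a fun i => f (a i) ω + ε i ω) x).toNNReal ∂P := by
  let w := weights k s (.of a 0) x
  have hY : Measurable fun ω (i : Fin n) => f (a i) ω + ε i ω :=
    measurable_pi_lambda _ fun i => (hm.measurable_f _ (ha i)).add (hm.measurable_noise i)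
  have hR := hm.measurable_residual (D := .of a 0) (s := s) ha hx
  have hlaw := (indepFun_iff_map_prod_eq_prod_map_map hY.aemeasurable hR.aemeasurable).1
    (hm.indepFun_residual_obs (D := .of a 0) hs ha hx).symm
  rw [hm.map_residual (D := .of a 0) hs ha hx] at hlaw
  have hshift : Measurable fun q : (Fin n → ℝ) × ℝ => g (q.1, ∑ i, w i * q.1 i + q.2) :=
    hg.comp (by fun_prop)
  calc _ = ∫⁻ q, g (q.1, ∑ i, w i * q.1 i + q.2)
        ∂(P.map fun ω => (fun i => f (a i) ω + ε i ω, residual k s f ε (.of a 0) x ω)) := by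
        rw [lintegral_map hshift (hY.prodMk hR)]
        simp only [residual, predictionError, w, add_sub_cancel]
    _ = ∫⁻ ω, ∫⁻ z, g (fun i => f (a i) ω + ε i ω, ∑ i, w i * (f (a i) ω + ε i ω) + z)
          ∂gaussianReal 0 (postVar k s (.of a 0) x).toNNReal ∂P := by
        rw [hlaw, lintegral_prod _ hshift.aemeasurable,
          lintegral_map hshift.lintegral_prod_right hY]
    _ = _ := lintegral_congr fun ω => by
        refine (lintegral_gaussianReal_eq_lintegral_add _ _
          (hg.comp measurable_prodMk_left)).symm.trans ?_
        rw [hm.postMean_eq hs (D := .of a _) ha]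
        rfl

lemma lintegral_mul_lik_ae_eq (hm : IsGPModel P X k s f ε) (hs : 0 < s) (ha : ∀ i, a i ∈ X)
    (hx : x ∈ X) {ψ : ℝ → ℝ≥0∞} (hψ : Measurable ψ)
    (hκ : Measurable fun y : Fin n → ℝ =>
      ∫⁻ z, ψ z ∂gaussianReal (postMean k s (.of a y) x) (postVar k s (.of a y) x).toNNReal) :
    (fun y => ∫⁻ ω, ψ (f x ω) * lik s (f · ω) (.of a y) ∂P) =ᵐ[volume] fun y =>
      (∫⁻ ω, lik s (f · ω) (.of a y) ∂P) *
        ∫⁻ z, ψ z ∂gaussianReal (postMean k s (.of a y) x) (postVar k s (.of a y) x).toNNReal := by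
  set κ : (Fin n → ℝ) → ℝ≥0∞ := fun y =>
    ∫⁻ z, ψ z ∂gaussianReal (postMean k s (.of a y) x) (postVar k s (.of a y) x).toNNReal
  have hf (i : Fin n) : Measurable (f (a i)) := hm.measurable_f _ (ha i)
  have hlik := measurable_lik_of hf s
  refine ae_eq_of_forall_setLIntegral_eq_of_sigmaFinite
    (((hψ.comp (hm.measurable_f x hx)).comp measurable_fst).mul hlik).lintegral_prod_left
    (hlik.lintegral_prod_left.mul hκ) fun B hB _ => ?_
  have hB1 : Measurable (B.indicator (1 : (Fin n → ℝ) → ℝ≥0∞)) := measurable_one.indicator hB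
  have hcond : ∫⁻ ω, B.indicator 1 (fun i => f (a i) ω + ε i ω) * ψ (f x ω) ∂P =
      ∫⁻ ω, B.indicator 1 (fun i => f (a i) ω + ε i ω) * κ (fun i => f (a i) ω + ε i ω) ∂P :=
    (hm.lintegral_obs_f hs ha hx (g := fun q => B.indicator 1 q.1 * ψ q.2)
      ((hB1.comp measurable_fst).mul (hψ.comp measurable_snd))).trans
      (lintegral_congr fun _ => lintegral_const_mul (B.indicator 1 _) hψ)
  rw [← lintegral_indicator hB, ← lintegral_indicator hB]
  calc _ = ∫⁻ y, ∫⁻ ω, B.indicator 1 y * ψ (f x ω) * lik s (f · ω) (.of a y) ∂P := by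
        refine lintegral_congr fun y => ?_
        by_cases hy : y ∈ B <;> simp [hy]
    _ = ∫⁻ y, ∫⁻ ω, B.indicator 1 y * κ y * lik s (f · ω) (.of a y) ∂P :=
        (hm.lintegral_design hs ha (g := fun q => B.indicator 1 q.2 * ψ (q.1 ⟨x, hx⟩))
          ((hB1.comp measurable_snd).mul (hψ.comp (by fun_prop)))).symm.trans <|
          hcond.trans <| hm.lintegral_design hs ha (g := fun q => B.indicator 1 q.2 * κ q.2)
            ((hB1.mul hκ).comp measurable_snd)
    _ = _ := by
        refine lintegral_congr fun y => ?_
        rw [lintegral_const_mul _ (measurable_lik_apply (D := .of a y) hf s)]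
        by_cases hy : y ∈ B <;> simp [hy, mul_comm, κ]

/- Adaptive designs depend on the observations, so an identity which holds only for almost every
observation vector is of no use; continuity in the observations removes the exceptional set. -/

lemma lintegral_boundedContinuous_mul_lik (hm : IsGPModel P X k s f ε) (hs : 0 < s)
    (ha : ∀ i, a i ∈ X) (hx : x ∈ X) (ψ : BoundedContinuousFunction ℝ ℝ≥0) (y : Fin n → ℝ) :
    ∫⁻ ω, ψ (f x ω) * lik s (f · ω) (.of a y) ∂P =
      (∫⁻ ω, lik s (f · ω) (.of a y) ∂P) *
        ∫⁻ z, ψ z ∂gaussianReal (postMean k s (.of a y) x) (postVar k s (.of a y) x).toNNReal := by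
  have hf (i : Fin n) : Measurable (f (a i)) := hm.measurable_f _ (ha i)
  have hleft : Continuous fun y : Fin n → ℝ =>
      ∫⁻ ω, ψ (f x ω) * lik s (f · ω) (.of a y) ∂P :=
    continuous_lintegral_mul_lik hf (h := fun ω => ψ (f x ω))
      (ψ.continuous.measurable.comp (hm.measurable_f x hx)) (C := nndist 0 ψ)
      fun ω => ψ.apply_le_nndist_zero _
  have hevidence : Continuous fun y : Fin n → ℝ => ∫⁻ ω, lik s (f · ω) (.of a y) ∂P := by
    simpa only [ENNReal.coe_one, one_mul] using continuous_lintegral_mul_lik (s := s) hf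
      (h := fun _ => 1) measurable_const fun _ => le_rfl
  have hκ : Continuous fun y : Fin n → ℝ =>
      ∫⁻ z, ψ z ∂gaussianReal (postMean k s (.of a y) x) (postVar k s (.of a y) x).toNNReal :=
    (continuous_lintegral_gaussianReal ψ (postVar k s (.of a 0) x).toNNReal).comp
      (continuous_postMean k s a x)
  have hκ_top (m : ℝ) (v : ℝ≥0) : ∫⁻ z, ψ z ∂gaussianReal m v ≠ ∞ :=
    (ψ.lintegral_lt_top_of_nnreal _).ne
  have hright := continuous_iff_continuousAt.2 fun y => ENNReal.Tendsto.mul (hevidence.tendsto y)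
    (Or.inr (hκ_top _ _)) (hκ.tendsto y) (Or.inr (lintegral_lik_ne_top _))
  exact congrFun ((hleft.ae_eq_iff_eq volume hright).1 (hm.lintegral_mul_lik_ae_eq hs ha hx
    ψ.continuous.measurable.coe_nnreal_ennreal hκ.measurable)) y

/-- The Bayes formula, multiplied through by the evidence. -/
theorem lintegral_mul_lik (hm : IsGPModel P X k s f ε) (hs : 0 < s) {D : Data d n}
    (hD : ∀ i, (D i).1 ∈ X) (hx : x ∈ X) {ψ : ℝ → ℝ≥0∞} (hψ : Measurable ψ) :
    ∫⁻ ω, ψ (f x ω) * lik s (f · ω) D ∂P =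
      (∫⁻ ω, lik s (f · ω) D ∂P) *
        ∫⁻ z, ψ z ∂gaussianReal (postMean k s D x) (postVar k s D x).toNNReal := by
  have hfx := hm.measurable_f x hx
  have hfin : IsFiniteMeasure (P.withDensity fun ω => lik s (f · ω) D) :=
    isFiniteMeasure_withDensity (lintegral_lik_ne_top D)
  have hmap (φ : ℝ → ℝ≥0∞) (hφ : Measurable φ) :
      ∫⁻ z, φ z ∂((P.withDensity fun ω => lik s (f · ω) D).map (f x)) =
        ∫⁻ ω, φ (f x ω) * lik s (f · ω) D ∂P := by
    rw [lintegral_map hφ hfx]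
    refine (lintegral_withDensity_eq_lintegral_mul _
      (measurable_lik_apply (fun i => hm.measurable_f _ (hD i)) s) (hφ.comp hfx)).trans ?_
    simp only [Pi.mul_apply, Function.comp_apply, mul_comm]
  have hposterior : (P.withDensity fun ω => lik s (f · ω) D).map (f x) =
      (∫⁻ ω, lik s (f · ω) D ∂P) •
        gaussianReal (postMean k s D x) (postVar k s D x).toNNReal := by
    refine ext_of_forall_lintegral_eq_of_IsFiniteMeasure fun φ => ?_
    rw [hmap _ φ.continuous.measurable.coe_nnreal_ennreal, lintegral_smul_measure]
    exact hm.lintegral_boundedContinuous_mul_lik hs hD hx φ fun i => (D i).2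
  rw [← hmap ψ hψ, hposterior, lintegral_smul_measure, smul_eq_mul]

end IsGPModel

end FixedDesign

section GaussianDensity

variable {u v : ℝ≥0}

lemma gaussianPDFReal_mul_gaussianPDFReal (m y z : ℝ) (hu : u ≠ 0) (hv : v ≠ 0) :
    gaussianPDFReal m v z * gaussianPDFReal z u y =
      gaussianPDFReal m (v + u) y *
        gaussianPDFReal ((u * m + v * y) / (v + u)) (v * u / (v + u)) z := by
  have hsqrt : √(2 * Real.pi * v) * √(2 * Real.pi * u) =
      √(2 * Real.pi * (v + u)) * √(2 * Real.pi * (v * u / (v + u))) := by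
    rw [← Real.sqrt_mul (by positivity), ← Real.sqrt_mul (by positivity)]
    congr 1
    field_simp
  have hexp : -(z - m) ^ 2 / (2 * v) + -(y - z) ^ 2 / (2 * u) =
      -(y - m) ^ 2 / (2 * (v + u)) +
        -(z - (u * m + v * y) / (v + u)) ^ 2 / (2 * (v * u / (v + u))) := by
    field_simp
    ring
  simp only [gaussianPDFReal, NNReal.coe_add, NNReal.coe_mul, NNReal.coe_div]
  rw [mul_mul_mul_comm, mul_mul_mul_comm (√(2 * Real.pi * (v + u)))⁻¹, ← mul_inv, ← mul_inv,
    hsqrt, ← Real.exp_add, ← Real.exp_add, hexp]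

lemma lintegral_gaussianPDF_gaussianReal (m y : ℝ) (hu : u ≠ 0) (v : ℝ≥0) :
    ∫⁻ z, gaussianPDF z u y ∂gaussianReal m v = gaussianPDF m (v + u) y := by
  have hmeas : Measurable fun z => gaussianPDF z u y :=
    measurable_gaussianPDF_comp measurable_id measurable_const u
  obtain rfl | hv := eq_or_ne v 0
  · rw [gaussianReal_zero_var, lintegral_dirac' _ hmeas, zero_add]
  have hprod (z : ℝ) : gaussianPDF m v z * gaussianPDF z u y = gaussianPDF m (v + u) y *
      gaussianPDF ((u * m + v * y) / (v + u)) (v * u / (v + u)) z := by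
    simp only [gaussianPDF, ← ENNReal.ofReal_mul (gaussianPDFReal_nonneg _ _ _),
      gaussianPDFReal_mul_gaussianPDFReal m y z hu hv]
  rw [gaussianReal_of_var_ne_zero _ hv, lintegral_withDensity_eq_lintegral_mul _
    (measurable_gaussianPDF _ _) hmeas]
  simp only [Pi.mul_apply, hprod]
  rw [lintegral_const_mul _ (measurable_gaussianPDF _ _), lintegral_gaussianPDF_eq_one, mul_one]
  exact div_ne_zero (mul_ne_zero hv hu) (by positivity)

lemma log_gaussianPDFReal (m y : ℝ) (hv : v ≠ 0) :
    Real.log (gaussianPDFReal m v y) =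
      -(Real.log (2 * Real.pi * v) / 2) - (y - m) ^ 2 / (2 * v) := by
  rw [gaussianPDFReal, Real.log_mul (by positivity) (Real.exp_pos _).ne', Real.log_exp,
    Real.log_inv, Real.log_sqrt (by positivity)]
  ring

lemma log_gaussianPDFReal_div (m m' y : ℝ) (hu : u ≠ 0) (v : ℝ≥0) :
    Real.log (gaussianPDFReal m u y / gaussianPDFReal m' (v + u) y) =
      Real.log (1 + v / u) / 2 - (y - m) ^ 2 / (2 * u) + (y - m') ^ 2 / (2 * (v + u)) := by
  have hu' : (0 : ℝ) < u := by positivity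
  have hvu : v + u ≠ 0 := by positivity
  have hratio : (1 : ℝ) + v / u = (v + u) / u := by field_simp; ring
  rw [Real.log_div (gaussianPDFReal_pos _ _ _ hu).ne' (gaussianPDFReal_pos _ _ _ hvu).ne',
    log_gaussianPDFReal _ _ hu, log_gaussianPDFReal _ _ hvu, NNReal.coe_add, hratio,
    Real.log_mul (y := u) (by positivity) hu'.ne',
    Real.log_mul (y := v + u) (by positivity) (by positivity),
    Real.log_div (by positivity) hu'.ne']
  ring

end GaussianDensity

/-! ### Information gain -/

section MutualInfo

variable {Ω α β : Type*} [MeasurableSpace Ω] [MeasurableSpace α] [MeasurableSpace β]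
  {P : Measure Ω} [IsProbabilityMeasure P] {U : Ω → α} {V : Ω → β}

lemma mutualInfo_eq_integral_log (hU : Measurable U) (hV : Measurable V) {ρ : α × β → ℝ≥0∞}
    (hρ : Measurable ρ)
    (hdens : P.map (fun ω => (U ω, V ω)) = ((P.map U).prod (P.map V)).withDensity ρ)
    (hint : Integrable (fun ω => Real.log (ρ (U ω, V ω)).toReal) P) :
    mutualInfo P U V = ENNReal.ofReal (∫ ω, Real.log (ρ (U ω, V ω)).toReal ∂P) := by
  have hUV := hU.prodMk hV
  have := Measure.isProbabilityMeasure_map hU.aemeasurable (μ := P)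
  have := Measure.isProbabilityMeasure_map hV.aemeasurable (μ := P)
  have := Measure.isProbabilityMeasure_map hUV.aemeasurable (μ := P)
  have hac : P.map (fun ω => (U ω, V ω)) ≪ (P.map U).prod (P.map V) :=
    hdens ▸ withDensity_absolutelyContinuous _ _
  have hlog : AEStronglyMeasurable (fun q => Real.log (ρ q).toReal)
      (P.map fun ω => (U ω, V ω)) := hρ.ennreal_toReal.log.aestronglyMeasurable
  have hllr : llr (P.map fun ω => (U ω, V ω)) ((P.map U).prod (P.map V))
      =ᵐ[P.map fun ω => (U ω, V ω)] fun q => Real.log (ρ q).toReal := by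
    have hrn := Measure.rnDeriv_withDensity ((P.map U).prod (P.map V)) hρ
    rw [← hdens] at hrn
    filter_upwards [hac.ae_le hrn] with q hq
    rw [llr, hq]
  have hllr_int : Integrable (llr (P.map fun ω => (U ω, V ω)) ((P.map U).prod (P.map V)))
      (P.map fun ω => (U ω, V ω)) :=
    (integrable_congr hllr).2 ((integrable_map_measure hlog hUV.aemeasurable).2 hint)
  rw [mutualInfo, klDiv_of_ac_of_integrable hac hllr_int, integral_congr_ae hllr,
    integral_map hUV.aemeasurable hlog]
  simp only [probReal_univ, add_sub_cancel_right]

end MutualInfo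

section InformationGain

variable {d n : ℕ} {s : ℝ≥0}

/-- The data set formed by the first `n` entries of a stream of data. -/
def prefixData (D : ℕ → Pt d × ℝ) (n : ℕ) : Data d n := fun i => D i

lemma lik_prefixData (s : ℝ≥0) (h : Pt d → ℝ) (D : ℕ → Pt d × ℝ) (n : ℕ) :
    lik s h (prefixData D n) =
      ∏ t ∈ Finset.range n, gaussianPDF (h (D t).1) (s ^ 2) (D t).2 :=
  (Finset.prod_range fun t => gaussianPDF (h (D t).1) (s ^ 2) (D t).2).symm

lemma lik_ne_zero (hs : 0 < s) (h : Pt d → ℝ) (D : Data d n) : lik s h D ≠ 0 :=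
  Finset.prod_ne_zero_iff.2 fun _ _ => (gaussianPDF_pos _ (pow_ne_zero _ hs.ne') _).ne'

lemma le_constC1_mul_log (hs : 0 < s) {v : ℝ} (hv : 0 ≤ v) (hv1 : v ≤ 1) :
    v ≤ constC1 s * (Real.log (1 + v / (s : ℝ) ^ 2) / 2) := by
  have hs' : (0 : ℝ) < ((s : ℝ) ^ 2)⁻¹ := by positivity
  have hlog : v * Real.log (1 + ((s : ℝ) ^ 2)⁻¹) ≤ Real.log (1 + v * ((s : ℝ) ^ 2)⁻¹) := by
    rw [← Real.log_rpow (by positivity)]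
    exact Real.log_le_log (by positivity)
      (rpow_one_add_le_one_add_mul_self (by linarith) hv hv1)
  calc v ≤ Real.log (1 + v * ((s : ℝ) ^ 2)⁻¹) / Real.log (1 + ((s : ℝ) ^ 2)⁻¹) :=
        (le_div_iff₀ (Real.log_pos (by linarith))).2 hlog
    _ = constC1 s * (Real.log (1 + v / (s : ℝ) ^ 2) / 2) := by
        rw [constC1, div_eq_mul_inv v]
        ring

lemma constC1_nonneg (s : ℝ≥0) : 0 ≤ constC1 s :=
  div_nonneg zero_le_two (Real.log_nonneg (le_add_of_nonneg_right (by positivity)))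

variable {Ω : Type*} [MeasurableSpace Ω] {P : Measure Ω} {X : Set (Pt d)} {k : Pt d → Pt d → ℝ}
  {f : Pt d → Ω → ℝ} {ε : ℕ → Ω → ℝ} [IsProbabilityMeasure P]

lemma lintegral_lik_ne_zero {D : Data d n} (hf : ∀ i, Measurable (f (D i).1)) (hs : 0 < s) :
    ∫⁻ ω, lik s (f · ω) D ∂P ≠ 0 := by
  rw [← pos_iff_ne_zero, lintegral_pos_iff_support (measurable_lik_apply hf s)]
  simp [Function.support, lik_ne_zero hs]

namespace IsGPModel

lemma lintegral_obs (hm : IsGPModel P X k s f ε) (hs : 0 < s) {a : Fin n → Pt d}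
    (ha : ∀ i, a i ∈ X) {g : (Fin n → ℝ) → ℝ≥0∞} (hg : Measurable g) :
    ∫⁻ ω, g (fun i => f (a i) ω + ε i ω) ∂P =
      ∫⁻ y, g y * ∫⁻ ω, lik s (f · ω) (.of a y) ∂P := by
  refine (hm.lintegral_design hs ha (g := fun q => g q.2) (hg.comp measurable_snd)).trans
    (lintegral_congr fun y => ?_)
  exact lintegral_const_mul (g y)
    (measurable_lik_apply (D := .of a y) (fun i => hm.measurable_f _ (ha i)) s)

lemma map_obs_f_eq_withDensity (hm : IsGPModel P X k s f ε) (hs : 0 < s) {a : Fin n → Pt d}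
    (ha : ∀ i, a i ∈ X) :
    P.map (fun ω => ((fun i : Fin n => f (a i) ω + ε i ω), fun i => f (a i) ω)) =
      ((P.map fun ω (i : Fin n) => f (a i) ω + ε i ω).prod
        (P.map fun ω i => f (a i) ω)).withDensity fun q =>
          (∏ i, gaussianPDF (q.2 i) (s ^ 2) (q.1 i)) / ∫⁻ ω, lik s (f · ω) (.of a q.1) ∂P := by
  have hf (i : Fin n) : Measurable (f (a i)) := hm.measurable_f _ (ha i)
  have hF : Measurable fun ω i => f (a i) ω := measurable_pi_lambda _ hf
  have hY : Measurable fun ω (i : Fin n) => f (a i) ω + ε i ω :=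
    measurable_pi_lambda _ fun i => (hf i).add (hm.measurable_noise i)
  set L : (Fin n → ℝ) × (Fin n → ℝ) → ℝ≥0∞ := fun q => ∏ i, gaussianPDF (q.2 i) (s ^ 2) (q.1 i)
  set c : (Fin n → ℝ) → ℝ≥0∞ := fun y => ∫⁻ ω, lik s (f · ω) (.of a y) ∂P
  have hL : Measurable L := Finset.measurable_fun_prod _ fun i _ =>
    measurable_gaussianPDF_comp (by fun_prop) (by fun_prop) _
  have hc : Measurable c := (measurable_lik_of hf s).lintegral_prod_left
  have hρ : Measurable fun q => L q / c q.1 :=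
    hL.div (hc.comp measurable_fst)
  refine Measure.ext_of_lintegral _ fun g hg => ?_
  have hρg : Measurable fun q => L q / c q.1 * g q := hρ.mul hg
  calc _ = ∫⁻ ω, g (fun i => f (a i) ω + ε i ω, fun i => f (a i) ω) ∂P :=
        lintegral_map hg (hY.prodMk hF)
    _ = ∫⁻ y, ∫⁻ ω, g (y, fun i => f (a i) ω) * L (y, fun i => f (a i) ω) ∂P :=
        hm.lintegral_design hs ha (g := fun q => g (q.2, fun i => q.1 ⟨a i, ha i⟩))
          (hg.comp (by fun_prop))
    _ = ∫⁻ y, (∫⁻ h, L (y, h) / c y * g (y, h) ∂P.map fun ω i => f (a i) ω) * c y := by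
        refine lintegral_congr fun y => ?_
        have hsec : Measurable fun h => L (y, h) / c y * g (y, h) := hρg.comp measurable_prodMk_left
        rw [lintegral_map hsec hF]
        refine Eq.trans (lintegral_congr fun ω => ?_) (lintegral_mul_const _ (hsec.comp hF))
        rw [mul_right_comm, ENNReal.div_mul_cancel (lintegral_lik_ne_zero (D := .of a y) hf hs)
          (lintegral_lik_ne_top _), mul_comm]
    _ = ∫⁻ y, ∫⁻ h, L (y, h) / c y * g (y, h) ∂(P.map fun ω i => f (a i) ω)
          ∂P.map fun ω (i : Fin n) => f (a i) ω + ε i ω := by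
        rw [lintegral_map hρg.lintegral_prod_right hY]
        exact (hm.lintegral_obs hs ha hρg.lintegral_prod_right).symm
    _ = _ := (lintegral_prod _ hρg.aemeasurable).symm.trans
        (lintegral_withDensity_eq_lintegral_mul _ hρ hg).symm

variable {D : ℕ → Pt d × ℝ}

lemma lintegral_lik_prefixData (hm : IsGPModel P X k s f ε) (hs : 0 < s) (hD : ∀ t, (D t).1 ∈ X)
    (n : ℕ) :
    ∫⁻ ω, lik s (f · ω) (prefixData D n) ∂P =
      ∏ t ∈ Finset.range n, gaussianPDF (postMean k s (prefixData D t) (D t).1)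
        ((postVar k s (prefixData D t) (D t).1).toNNReal + s ^ 2) (D t).2 := by
  induction n with
  | zero => simp [lik]
  | succ n ih =>
    have hpredictive := hm.lintegral_mul_lik hs (D := prefixData D n) (fun i => hD i) (hD n)
      (ψ := fun z => gaussianPDF z (s ^ 2) (D n).2)
      (measurable_gaussianPDF_comp measurable_id measurable_const _)
    rw [lintegral_gaussianPDF_gaussianReal _ _ (pow_ne_zero _ hs.ne')] at hpredictive
    rw [Finset.prod_range_succ, ← ih, ← hpredictive]
    simp only [lik_prefixData, Finset.prod_range_succ, mul_comm]

lemma log_lik_div_lintegral_lik (hm : IsGPModel P X k s f ε) (hs : 0 < s)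
    (hD : ∀ t, (D t).1 ∈ X) (T : ℕ) (ω : Ω) :
    Real.log (lik s (f · ω) (prefixData (fun t => ((D t).1, f (D t).1 ω + ε t ω)) T) /
      ∫⁻ ω', lik s (f · ω') (prefixData (fun t => ((D t).1, f (D t).1 ω + ε t ω)) T) ∂P).toReal =
    ∑ t ∈ Finset.range T,
      (Real.log (1 + postVar k s (prefixData D t) (D t).1 / (s : ℝ) ^ 2) / 2 -
        (ε t ω) ^ 2 / (2 * (s : ℝ) ^ 2) +
        (residual k s f ε (prefixData D t) (D t).1 ω + ε t ω) ^ 2 /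
          (2 * (postVar k s (prefixData D t) (D t).1 + (s : ℝ) ^ 2))) := by
  have hs2 : s ^ 2 ≠ 0 := pow_ne_zero _ hs.ne'
  have hpdf (m y : ℝ) {v : ℝ≥0} (hv : v ≠ 0) : gaussianPDFReal m v y ≠ 0 :=
    (gaussianPDFReal_pos _ _ _ hv).ne'
  rw [hm.lintegral_lik_prefixData hs (D := fun t => ((D t).1, f (D t).1 ω + ε t ω)) hD,
    lik_prefixData, ENNReal.toReal_div, ENNReal.toReal_prod, ENNReal.toReal_prod,
    ← Finset.prod_div_distrib, Real.log_prod]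
  · refine Finset.sum_congr rfl fun t _ => ?_
    have hmean : postMean k s (prefixData (fun t => ((D t).1, f (D t).1 ω + ε t ω)) t) (D t).1 =
        f (D t).1 ω - residual k s f ε (prefixData D t) (D t).1 ω := by
      rw [hm.postMean_eq hs (D := prefixData (fun t => ((D t).1, f (D t).1 ω + ε t ω)) t)
        fun i => hD i]
      exact (sub_sub_cancel _ _).symm
    have hvar : postVar k s (prefixData (fun t => ((D t).1, f (D t).1 ω + ε t ω)) t) (D t).1 =
        postVar k s (prefixData D t) (D t).1 := rfl
    have hnonneg := hm.postVar_nonneg hs (D := prefixData D t) (fun i => hD i) (hD t)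
    simp only [toReal_gaussianPDF]
    rw [hmean, hvar, log_gaussianPDFReal_div _ _ _ hs2, NNReal.coe_pow,
      Real.coe_toNNReal _ hnonneg]
    ring
  · intro t _
    simp only [toReal_gaussianPDF]
    exact div_ne_zero (hpdf _ _ hs2) (hpdf _ _ (by positivity))

lemma integral_log_density_term (hm : IsGPModel P X k s f ε) (hs : 0 < s) {D : Data d n}
    (hD : ∀ i, (D i).1 ∈ X) {x : Pt d} (hx : x ∈ X) (c : ℝ) :
    Integrable (fun ω => c - (ε n ω) ^ 2 / (2 * (s : ℝ) ^ 2) +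
        (residual k s f ε D x ω + ε n ω) ^ 2 / (2 * (postVar k s D x + (s : ℝ) ^ 2))) P ∧
      ∫ ω, (c - (ε n ω) ^ 2 / (2 * (s : ℝ) ^ 2) +
        (residual k s f ε D x ω + ε n ω) ^ 2 / (2 * (postVar k s D x + (s : ℝ) ^ 2))) ∂P = c := by
  have hnoise := hm.isGaussianNoise
  obtain ⟨hinn, hinn_eq⟩ := hm.integral_innovation_sq hs hD hx
  have hε := (hnoise.memLp n).integrable_sq
  have hε_eq : ∫ ω, (ε n ω) ^ 2 ∂P = (s : ℝ) ^ 2 := by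
    rw [← hnoise.variance_eq n, variance_of_integral_eq_zero
      (hm.measurable_noise n).aemeasurable (hnoise.integral_eq_zero n)]
  have hdiff : Integrable (fun ω => c - (ε n ω) ^ 2 / (2 * (s : ℝ) ^ 2)) P :=
    (integrable_const c).sub (hε.div_const _)
  refine ⟨hdiff.add (hinn.div_const _), ?_⟩
  have hv : 0 < postVar k s D x + (s : ℝ) ^ 2 :=
    add_pos_of_nonneg_of_pos (hm.postVar_nonneg hs hD hx) (by positivity)
  rw [integral_add hdiff (hinn.div_const _), integral_sub (integrable_const _) (hε.div_const _),
    integral_div, integral_div, hinn_eq, hε_eq, integral_const, probReal_univ, one_smul]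
  field_simp
  ring

theorem mutualInfo_eq (hm : IsGPModel P X k s f ε) (hs : 0 < s) (hD : ∀ t, (D t).1 ∈ X) (T : ℕ) :
    mutualInfo P (fun ω (i : Fin T) => f (D i).1 ω + ε i ω) (fun ω (i : Fin T) => f (D i).1 ω) =
      ENNReal.ofReal (∑ t ∈ Finset.range T,
        Real.log (1 + postVar k s (prefixData D t) (D t).1 / (s : ℝ) ^ 2) / 2) := by
  have hf (i : Fin T) : Measurable (f (D i).1) := hm.measurable_f _ (hD i)
  have hc : Measurable fun y : Fin T → ℝ =>
      ∫⁻ ω, lik s (f · ω) (.of (fun i => (D i).1) y) ∂P :=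
    (measurable_lik_of hf s).lintegral_prod_left
  have hρ : Measurable fun q : (Fin T → ℝ) × (Fin T → ℝ) =>
      (∏ i, gaussianPDF (q.2 i) (s ^ 2) (q.1 i)) /
        ∫⁻ ω, lik s (f · ω) (.of (fun i => (D i).1) q.1) ∂P :=
    (Finset.measurable_fun_prod _ fun i _ =>
      measurable_gaussianPDF_comp (by fun_prop) (by fun_prop) _).div (hc.comp measurable_fst)
  have hlog := hm.log_lik_div_lintegral_lik hs hD T
  have hterm (t : ℕ) := hm.integral_log_density_term hs (D := prefixData D t) (fun i => hD i)
    (hD t) (Real.log (1 + postVar k s (prefixData D t) (D t).1 / (s : ℝ) ^ 2) / 2)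
  have hint := (integrable_finsetSum (Finset.range T) fun t _ => (hterm t).1).congr
    (.of_forall fun ω => (hlog ω).symm)
  have hY : Measurable fun ω (i : Fin T) => f (D i).1 ω + ε i ω :=
    measurable_pi_lambda _ fun i => (hf i).add (hm.measurable_noise i)
  refine (mutualInfo_eq_integral_log hY (measurable_pi_lambda _ hf) hρ
    (hm.map_obs_f_eq_withDensity hs fun i => hD i) hint).trans
    (congrArg ENNReal.ofReal ((integral_congr_ae (.of_forall hlog)).trans ?_))
  rw [integral_finsetSum _ fun t _ => (hterm t).1]
  exact Finset.sum_congr rfl fun t _ => (hterm t).2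

lemma maxInfoGain_ne_top (hm : IsGPModel P X k s f ε) (hs : 0 < s) (hX : X.Nonempty)
    (hk : ∀ x ∈ X, k x x ≤ 1) (T : ℕ) : maxInfoGain P X f ε T ≠ ∞ := by
  obtain ⟨x₀, hx₀⟩ := hX
  refine ne_top_of_le_ne_top (b := ENNReal.ofReal (∑ t ∈ Finset.range T,
    Real.log (1 + 1 / (s : ℝ) ^ 2) / 2)) ENNReal.ofReal_ne_top (iSup_le fun A => ?_)
  let D (t : ℕ) : Pt d × ℝ := (if h : t < T then A ⟨t, h⟩ else x₀, 0)
  have hD (t : ℕ) : (D t).1 ∈ X := by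
    dsimp only [D]
    split_ifs
    exacts [Subtype.coe_prop _, hx₀]
  have hA (i : Fin T) : (D i).1 = A i := by simp [D]
  have hinfo := hm.mutualInfo_eq hs hD T
  simp only [hA] at hinfo
  rw [hinfo]
  refine ENNReal.ofReal_le_ofReal (Finset.sum_le_sum fun t _ => ?_)
  have hnonneg := hm.postVar_nonneg hs (D := prefixData D t) (fun i => hD i) (hD t)
  have hle := (hm.postVar_le hs (D := prefixData D t) (fun i => hD i) (D t).1).trans
    (hk _ (hD t))
  gcongr

theorem sum_postVar_le (hm : IsGPModel P X k s f ε) (hs : 0 < s) (hk : ∀ x ∈ X, k x x ≤ 1)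
    (hD : ∀ t, (D t).1 ∈ X) (T : ℕ) :
    ∑ t ∈ Finset.range T, postVar k s (prefixData D t) (D t).1 ≤
      constC1 s * (maxInfoGain P X f ε T).toReal := by
  have hle : ENNReal.ofReal (∑ t ∈ Finset.range T,
      Real.log (1 + postVar k s (prefixData D t) (D t).1 / (s : ℝ) ^ 2) / 2) ≤
      maxInfoGain P X f ε T := by
    rw [← hm.mutualInfo_eq hs hD T]
    exact le_iSup (fun A : Fin T → X => mutualInfo P (fun ω (i : Fin T) => f (A i) ω + ε i ω)
      (fun ω (i : Fin T) => f (A i) ω)) fun i => ⟨(D i).1, hD i⟩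
  calc ∑ t ∈ Finset.range T, postVar k s (prefixData D t) (D t).1
      ≤ ∑ t ∈ Finset.range T, constC1 s *
          (Real.log (1 + postVar k s (prefixData D t) (D t).1 / (s : ℝ) ^ 2) / 2) :=
        Finset.sum_le_sum fun t _ => le_constC1_mul_log hs
          (hm.postVar_nonneg hs (D := prefixData D t) (fun i => hD i) (hD t))
          ((hm.postVar_le hs (D := prefixData D t) (fun i => hD i) _).trans (hk _ (hD t)))
    _ = constC1 s * ∑ t ∈ Finset.range T,
          Real.log (1 + postVar k s (prefixData D t) (D t).1 / (s : ℝ) ^ 2) / 2 :=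
        (Finset.mul_sum _ _ _).symm
    _ ≤ _ := mul_le_mul_of_nonneg_left ((ENNReal.ofReal_le_iff_le_toReal
        (hm.maxInfoGain_ne_top hs ⟨_, hD 0⟩ hk T)).1 hle) (constC1_nonneg s)

end IsGPModel

end InformationGain

lemma lintegral_gaussianPDF_mul_ofReal_le :
    ∫⁻ u : ℝ, gaussianPDF 0 1 u * ENNReal.ofReal u ≤ ENNReal.ofReal (√(2 * Real.pi))⁻¹ := by
  have hderiv : ∀ x ∈ Set.Ici (0 : ℝ), HasDerivAt (fun u : ℝ => -Real.exp (-u ^ 2 / 2))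
      (x * Real.exp (-x ^ 2 / 2)) x := fun x _ => by
    refine ((((hasDerivAt_pow 2 x).neg).div_const 2).exp.neg).congr_deriv ?_
    norm_num
    ring
  have hlim : Filter.Tendsto (fun u : ℝ => -Real.exp (-u ^ 2 / 2)) Filter.atTop (nhds (-0)) := by
    simp only [neg_div]
    exact (Real.tendsto_exp_neg_atTop_nhds_zero.comp
      ((Filter.tendsto_pow_atTop two_ne_zero).atTop_div_const two_pos)).neg
  have hnonneg : ∀ x ∈ Set.Ioi (0 : ℝ), 0 ≤ x * Real.exp (-x ^ 2 / 2) := fun x hx =>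
    mul_nonneg (le_of_lt hx) (Real.exp_pos _).le
  have hint := integrableOn_Ioi_deriv_of_nonneg' hderiv hnonneg hlim
  have hval := integral_Ioi_of_hasDerivAt_of_nonneg' hderiv hnonneg hlim
  have hindicator (u : ℝ) : gaussianPDF 0 1 u * ENNReal.ofReal u =
      (Set.Ioi 0).indicator (fun u => ENNReal.ofReal ((√(2 * Real.pi))⁻¹ *
        (u * Real.exp (-u ^ 2 / 2)))) u := by
    by_cases hu : u ∈ Set.Ioi (0 : ℝ)
    · rw [Set.indicator_of_mem hu, gaussianPDF,
        ← ENNReal.ofReal_mul (gaussianPDFReal_nonneg _ _ _), gaussianPDFReal]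
      simp only [NNReal.coe_one, mul_one, sub_zero]
      ring_nf
    · rw [Set.indicator_of_notMem hu, ENNReal.ofReal_of_nonpos (not_lt.1 hu), mul_zero]
  simp only [hindicator]
  rw [lintegral_indicator measurableSet_Ioi, ← ofReal_integral_eq_lintegral_ofReal
    (hint.const_mul _) ((ae_restrict_iff' measurableSet_Ioi).2 (.of_forall fun u hu =>
      mul_nonneg (by positivity) (hnonneg u hu))), integral_const_mul, hval]
  simp

lemma gaussianPDF_add_mul_ofReal_le {c : ℝ} (hc : 0 ≤ c) (u : ℝ) :
    gaussianPDF 0 1 (u + c) * ENNReal.ofReal u ≤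
      ENNReal.ofReal (Real.exp (-c ^ 2 / 2)) * (gaussianPDF 0 1 u * ENNReal.ofReal u) := by
  rcases le_or_gt u 0 with hu | hu
  · simp [ENNReal.ofReal_of_nonpos hu]
  · rw [← mul_assoc]
    gcongr
    rw [gaussianPDF, gaussianPDF, ← ENNReal.ofReal_mul (Real.exp_pos _).le]
    refine ENNReal.ofReal_le_ofReal ?_
    simp only [gaussianPDFReal, sub_zero, NNReal.coe_one, mul_one]
    rw [mul_left_comm, ← Real.exp_add]
    gcongr
    nlinarith [mul_nonneg hu.le hc]

lemma lintegral_gaussianReal_zero_one_excess_le {c : ℝ} (hc : 0 ≤ c) :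
    ∫⁻ z, ENNReal.ofReal (z - c) ∂gaussianReal 0 1 ≤
      ENNReal.ofReal (Real.exp (-c ^ 2 / 2) / √(2 * Real.pi)) := by
  rw [gaussianReal_of_var_ne_zero _ one_ne_zero,
    lintegral_withDensity_eq_lintegral_mul _ (measurable_gaussianPDF _ _) (by fun_prop)]
  calc ∫⁻ z : ℝ, gaussianPDF 0 1 z * ENNReal.ofReal (z - c)
      = ∫⁻ u : ℝ, gaussianPDF 0 1 (u + c) * ENNReal.ofReal u := by
        rw [← lintegral_add_right_eq_self _ c]
        simp only [add_sub_cancel_right]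
    _ ≤ ∫⁻ u : ℝ, ENNReal.ofReal (Real.exp (-c ^ 2 / 2)) *
          (gaussianPDF 0 1 u * ENNReal.ofReal u) :=
        lintegral_mono fun u => gaussianPDF_add_mul_ofReal_le hc u
    _ = ENNReal.ofReal (Real.exp (-c ^ 2 / 2)) *
          ∫⁻ u : ℝ, gaussianPDF 0 1 u * ENNReal.ofReal u :=
        lintegral_const_mul _ (by fun_prop)
    _ ≤ ENNReal.ofReal (Real.exp (-c ^ 2 / 2)) * ENNReal.ofReal (√(2 * Real.pi))⁻¹ := by
        gcongr
        exact lintegral_gaussianPDF_mul_ofReal_le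
    _ = ENNReal.ofReal (Real.exp (-c ^ 2 / 2) / √(2 * Real.pi)) := by
        rw [← ENNReal.ofReal_mul (Real.exp_pos _).le, div_eq_mul_inv (Real.exp _)]

lemma gaussianReal_eq_map_zero_one (m : ℝ) {v : ℝ} (hv : 0 ≤ v) :
    gaussianReal m v.toNNReal = (gaussianReal 0 1).map fun z => m + √v * z := by
  have hscale : (gaussianReal 0 1).map (√v * ·) = gaussianReal 0 v.toNNReal := by
    rw [gaussianReal_map_const_mul, mul_zero, mul_one]
    congr 1
    ext
    simp [Real.sq_sqrt hv, hv]
  rw [← zero_add m, ← gaussianReal_map_const_add, ← hscale,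
    Measure.map_map (by fun_prop) (by fun_prop), zero_add]
  rfl

lemma lintegral_gaussianReal_excess_le (m : ℝ) {v : ℝ} (hv : 0 ≤ v) (hv_one : v ≤ 1) {c : ℝ}
    (hc : 0 ≤ c) :
    ∫⁻ z, ENNReal.ofReal (z - (m + c * √v)) ∂gaussianReal m v.toNNReal ≤
      ENNReal.ofReal (Real.exp (-c ^ 2 / 2) / √(2 * Real.pi)) := by
  rw [gaussianReal_eq_map_zero_one m hv, lintegral_map (by fun_prop) (by fun_prop)]
  refine le_trans (lintegral_mono fun z => ?_) (lintegral_gaussianReal_zero_one_excess_le hc)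
  have hsqrt : √v ≤ 1 := Real.sqrt_le_one.2 hv_one
  rcases le_or_gt z c with hz | hz
  · rw [ENNReal.ofReal_of_nonpos]
    · exact zero_le
    · nlinarith [Real.sqrt_nonneg v]
  · refine ENNReal.ofReal_le_ofReal ?_
    nlinarith [Real.sqrt_nonneg v]

lemma lintegral_ofReal_neg_sub_gaussianReal (m : ℝ) (v : ℝ≥0) :
    ∫⁻ z, ENNReal.ofReal (-(z - m)) ∂gaussianReal m v =
      ∫⁻ z, ENNReal.ofReal (z - m) ∂gaussianReal m v := by
  have hreflect : (gaussianReal m v).map (fun z => 2 * m - z) = gaussianReal m v := by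
    rw [gaussianReal_map_const_sub, two_mul, add_sub_cancel_right]
  conv_rhs => rw [← hreflect, lintegral_map (by fun_prop) (by fun_prop)]
  refine lintegral_congr fun z => ?_
  ring_nf

lemma exists_seq_mem_subset_closure {E : Type*} [TopologicalSpace E] {X : Set E}
    [TopologicalSpace.SeparableSpace X] (hX : X.Nonempty) :
    ∃ e : ℕ → E, (∀ i, e i ∈ X) ∧ X ⊆ closure (Set.range e) := by
  have := hX.to_subtype
  refine ⟨fun i => TopologicalSpace.denseSeq X i, fun i => (TopologicalSpace.denseSeq X i).2,
    fun x hx => ?_⟩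
  have himage := image_closure_subset_closure_image (continuous_subtype_val (p := (· ∈ X)))
    (Set.mem_image_of_mem Subtype.val (TopologicalSpace.denseRange_denseSeq X ⟨x, hx⟩))
  rwa [← Set.range_comp] at himage

-- The value at `x` is the limit of the values at the point of `e 0, …, e N` nearest to `x`; taking
-- the limit superior makes it a measurable function of `x` and of the sequence of values.
lemma exists_measurable_version {E Ω : Type*} [PseudoEMetricSpace E] [MeasurableSpace E]
    [OpensMeasurableSpace E] {X : Set E} {e : ℕ → E} (he : ∀ i, e i ∈ X)
    (hdense : X ⊆ closure (Set.range e)) (f : E → Ω → ℝ) :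
    ∃ Φ : E → (ℕ → ℝ) → ℝ, (Measurable fun q : E × (ℕ → ℝ) => Φ q.1 q.2) ∧
      ∀ ω, ContinuousOn (f · ω) X → ∀ x ∈ X, Φ x (fun i => f (e i) ω) = f x ω := by
  refine ⟨fun x u => Filter.limsup (fun N => u (SimpleFunc.nearestPtInd e N x)) Filter.atTop,
    Measurable.limsup fun N => ?_, fun ω hω x hx => Filter.Tendsto.limsup_eq ?_⟩
  · have heval : Measurable fun q : ℕ × (ℕ → ℝ) => q.2 q.1 :=
      measurable_from_prod_countable_right fun i => measurable_pi_apply i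
    exact heval.comp (((SimpleFunc.nearestPtInd e N).measurable.comp measurable_fst).prodMk
      measurable_snd)
  · exact (hω x hx).tendsto.comp (tendsto_nhdsWithin_iff.2
      ⟨SimpleFunc.tendsto_nearestPt (hdense hx), .of_forall fun N => he _⟩)

section Measurability

variable {d n : ℕ} {k : Pt d → Pt d → ℝ}

lemma measurable_regKernelMatrix_inv (hk : Measurable fun q : Pt d × Pt d => k q.1 q.2) (s : ℝ≥0)
    (i j : Fin n) : Measurable fun D : Data d n => (regKernelMatrix k s D)⁻¹ i j := by
  have hmatrix : Measurable fun D : Data d n => fun i j => regKernelMatrix k s D i j := by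
    refine measurable_pi_lambda _ fun i => measurable_pi_lambda _ fun j => ?_
    simp only [regKernelMatrix, Matrix.add_apply, Matrix.of_apply, Matrix.smul_apply]
    exact (hk.comp ((measurable_pi_apply i).fst.prodMk (measurable_pi_apply j).fst)).add_const _
  have hdet : Continuous fun M : Fin n → Fin n → ℝ => (Matrix.of M).det :=
    Continuous.matrix_det (A := fun M => Matrix.of M) continuous_id
  have hadj : Continuous fun M : Fin n → Fin n → ℝ => (Matrix.of M).adjugate i j :=
    (Continuous.matrix_adjugate (A := fun M => Matrix.of M) continuous_id).matrix_elem i j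
  simp only [Matrix.inv_def, Ring.inverse_eq_inv', Matrix.smul_apply, smul_eq_mul]
  exact (hdet.measurable.inv.mul hadj.measurable).comp hmatrix

variable (hk : Measurable fun q : Pt d × Pt d => k q.1 q.2) {ξ : Data d n → Pt d}
  (hξ : Measurable ξ) (s : ℝ≥0)

include hk hξ

lemma measurable_kernelVec (i : Fin n) : Measurable fun D : Data d n => kernelVec k D (ξ D) i :=
  hk.comp (hξ.prodMk (measurable_pi_apply i).fst)

lemma measurable_postMean : Measurable fun D : Data d n => postMean k s D (ξ D) := by
  simp only [postMean, dotProduct, Matrix.mulVec]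
  exact Finset.measurable_fun_sum _ fun i _ => (measurable_kernelVec hk hξ i).mul
    (Finset.measurable_fun_sum _ fun j _ => (measurable_regKernelMatrix_inv hk s i j).mul
      (measurable_pi_apply j).snd)

lemma measurable_postVar : Measurable fun D : Data d n => postVar k s D (ξ D) := by
  simp only [postVar, dotProduct, Matrix.mulVec]
  exact (hk.comp (hξ.prodMk hξ)).sub (Finset.measurable_fun_sum _ fun i _ =>
    (measurable_kernelVec hk hξ i).mul
      (Finset.measurable_fun_sum _ fun j _ => (measurable_regKernelMatrix_inv hk s i j).mul
        (measurable_kernelVec hk hξ j)))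

end Measurability

/-! ### Regret of measurable models -/

/-- A Gaussian process model in which the kernel is measurable and the objective is a jointly
measurable function of the query point and of a random sequence independent of the noise; its value
at a random point is then again a random variable. -/
structure IsMeasurableGPModel {d : ℕ} {Ω : Type*} [MeasurableSpace Ω] (P : Measure Ω)
    (X : Set (Pt d)) (k : Pt d → Pt d → ℝ) (s : ℝ≥0) (f : Pt d → Ω → ℝ) (ε : ℕ → Ω → ℝ) :
    Prop extends IsGPModel P X k s f ε where
  measurable_kernel : Measurable fun q : Pt d × Pt d => k q.1 q.2
  exists_param : ∃ (Φ : Pt d → (ℕ → ℝ) → ℝ) (p : Ω → ℕ → ℝ),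
    (Measurable fun q : Pt d × (ℕ → ℝ) => Φ q.1 q.2) ∧ Measurable p ∧
      IndepFun p (fun ω n => ε n ω) P ∧ f = fun x ω => Φ x (p ω)

/-- A bound for the expected excess of a Gaussian variable with mean `m` and variance `v ≤ 1` over
the level `m + √β √v`. -/
noncomputable def excessBound (β : ℝ) : ℝ := Real.exp (-√β ^ 2 / 2) / √(2 * Real.pi)

lemma excessBound_nonneg (β : ℝ) : 0 ≤ excessBound β := by unfold excessBound; positivity

lemma integrable_and_integral_eq_zero_of_lintegral_neg {Ω : Type*} [MeasurableSpace Ω]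
    {μ : Measure Ω} {Z : Ω → ℝ} (hZ : AEMeasurable Z μ)
    (hfin : ∫⁻ ω, ENNReal.ofReal (Z ω) ∂μ ≠ ∞)
    (hsymm : ∫⁻ ω, ENNReal.ofReal (-Z ω) ∂μ = ∫⁻ ω, ENNReal.ofReal (Z ω) ∂μ) :
    Integrable Z μ ∧ ∫ ω, Z ω ∂μ = 0 := by
  have henorm (ω : Ω) : ‖Z ω‖ₑ ≤ ENNReal.ofReal (Z ω) + ENNReal.ofReal (-Z ω) := by
    rw [Real.enorm_eq_ofReal_abs]
    rcases le_total 0 (Z ω) with hz | hz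
    · rw [abs_of_nonneg hz]; exact le_self_add
    · rw [abs_of_nonpos hz]; exact le_add_self
  have hint : Integrable Z μ := by
    refine ⟨hZ.aestronglyMeasurable, (lintegral_mono henorm).trans_lt ?_⟩
    rw [lintegral_add_left' hZ.ennreal_ofReal, hsymm]
    exact ENNReal.add_lt_top.2 ⟨hfin.lt_top, hfin.lt_top⟩
  exact ⟨hint, by rw [integral_eq_lintegral_pos_part_sub_lintegral_neg_part hint, hsymm, sub_self]⟩

namespace IsMeasurableGPModel

variable {d : ℕ} {Ω : Type*} [MeasurableSpace Ω] {P : Measure Ω} {X : Set (Pt d)}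
  {k : Pt d → Pt d → ℝ} {s : ℝ≥0} {f : Pt d → Ω → ℝ} {ε : ℕ → Ω → ℝ} {π : Rule d} {n : ℕ}
  {ξ : Data d n → Pt d}

lemma measurable_eval (h : IsMeasurableGPModel P X k s f ε) :
    Measurable fun q : Pt d × Ω => f q.1 q.2 := by
  obtain ⟨Φ, p, hΦ, hp, -, rfl⟩ := h.exists_param
  exact hΦ.comp (measurable_fst.prodMk (hp.comp measurable_snd))

lemma measurable_history (h : IsMeasurableGPModel P X k s f ε) (hπm : ∀ n, Measurable (π n))
    (n : ℕ) : Measurable fun ω => history π f ε ω n :=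
  GPUCB.measurable_history hπm h.measurable_eval h.measurable_noise n

lemma measurable_posterior (h : IsMeasurableGPModel P X k s f ε) (hξm : Measurable ξ)
    {g : Data d n × ℝ → ℝ≥0∞} (hg : Measurable g) :
    Measurable fun D => ∫⁻ z, g (D, z) ∂gaussianReal (postMean k s D (ξ D))
      (postVar k s D (ξ D)).toNNReal := by
  let κ : Kernel (Data d n) ℝ := ⟨_, measurable_gaussianReal.comp
    ((measurable_postMean h.measurable_kernel hξm s).prodMk
      (measurable_postVar h.measurable_kernel hξm s).real_toNNReal)⟩
  have : IsMarkovKernel κ := ⟨fun D => by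
    change IsProbabilityMeasure (gaussianReal _ _)
    infer_instance⟩
  exact Measurable.lintegral_kernel_prod_right (κ := κ) hg

variable [IsProbabilityMeasure P]

theorem lintegral_posterior (h : IsMeasurableGPModel P X k s f ε) (hs : 0 < s)
    (hX : MeasurableSet X) (hπm : ∀ n, Measurable (π n)) (hπ : π.StaysIn X)
    (hξm : Measurable ξ) (hξ : ∀ D, (∀ i, (D i).1 ∈ X) → ξ D ∈ X)
    {g : Data d n × ℝ → ℝ≥0∞} (hg : Measurable g) :
    ∫⁻ ω, g (history π f ε ω n, f (ξ (history π f ε ω n)) ω) ∂P =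
      ∫⁻ ω, (fun D => ∫⁻ z, g (D, z) ∂gaussianReal (postMean k s D (ξ D))
        (postVar k s D (ξ D)).toNNReal) (history π f ε ω n) ∂P := by
  have hm := h.toIsGPModel
  have hG := h.measurable_posterior hξm hg
  obtain ⟨Φ, p, hΦ, hp, hind, rfl⟩ := h.exists_param
  have hnoise : IsGaussianNoise P s p ε :=
    ⟨hp, hm.measurable_noise, hm.noise_law, hm.noise_indep, hind⟩
  rw [lintegral_history hnoise hs hΦ hπm (g := fun q => g (q.2, Φ (ξ q.2) q.1)) (hg.comp
      (measurable_snd.prodMk (hΦ.comp ((hξm.comp measurable_snd).prodMk measurable_fst)))),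
    lintegral_history hnoise hs hΦ hπm (g := fun q => (fun D => ∫⁻ z, g (D, z) ∂gaussianReal
      (postMean k s D (ξ D)) (postVar k s D (ξ D)).toNNReal) q.2) (hG.comp measurable_snd)]
  refine lintegral_congr_ae ?_
  filter_upwards [ae_refMeasure_mem hX hπm hπ n] with D hD
  rw [lintegral_const_mul _ (measurable_lik_apply (fun i => hm.measurable_f _ (hD i)) s), mul_comm]
  exact hm.lintegral_mul_lik hs hD (hξ D hD) (ψ := fun z => g (D, z))
    (hg.comp (measurable_const.prodMk measurable_id))

lemma lintegral_sub_ucb_le (h : IsMeasurableGPModel P X k s f ε) (hs : 0 < s)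
    (hX : MeasurableSet X) (hk : ∀ x ∈ X, k x x ≤ 1) (hπm : ∀ n, Measurable (π n))
    (hπ : π.StaysIn X) (hξm : Measurable ξ) (hξ : ∀ D, (∀ i, (D i).1 ∈ X) → ξ D ∈ X) (β : ℝ) :
    ∫⁻ ω, (fun D => ENNReal.ofReal (f (ξ D) ω - ucb k s β D (ξ D))) (history π f ε ω n) ∂P ≤
      ENNReal.ofReal (excessBound β) := by
  have hg : Measurable fun q : Data d n × ℝ => ENNReal.ofReal (q.2 - ucb k s β q.1 (ξ q.1)) :=
    (measurable_snd.sub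
      (((measurable_postMean h.measurable_kernel hξm s).comp measurable_fst).add
        (((measurable_postVar h.measurable_kernel hξm s).comp
          measurable_fst).sqrt.const_mul _))).ennreal_ofReal
  refine (h.lintegral_posterior hs hX hπm hπ hξm hξ hg).trans_le ?_
  refine (lintegral_mono (g := fun _ => ENNReal.ofReal (excessBound β))
    fun ω => ?_).trans_eq (by rw [lintegral_const, measure_univ, mul_one])
  have hD := history_mem hπ f ε ω n
  exact lintegral_gaussianReal_excess_le _ (h.postVar_nonneg hs hD (hξ _ hD))
    ((h.postVar_le hs hD _).trans (hk _ (hξ _ hD))) (Real.sqrt_nonneg β)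

lemma integral_sub_postMean (h : IsMeasurableGPModel P X k s f ε) (hs : 0 < s)
    (hX : MeasurableSet X) (hk : ∀ x ∈ X, k x x ≤ 1) (hπm : ∀ n, Measurable (π n))
    (hπ : π.StaysIn X) (hξm : Measurable ξ) (hξ : ∀ D, (∀ i, (D i).1 ∈ X) → ξ D ∈ X) :
    Integrable (fun ω => (fun D => f (ξ D) ω - postMean k s D (ξ D)) (history π f ε ω n)) P ∧
      ∫ ω, (fun D => f (ξ D) ω - postMean k s D (ξ D)) (history π f ε ω n) ∂P = 0 := by
  have hmean := measurable_postMean h.measurable_kernel hξm s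
  have hhist := h.measurable_history hπm n
  have hmeas : Measurable
      fun ω => (fun D => f (ξ D) ω - postMean k s D (ξ D)) (history π f ε ω n) :=
    (h.measurable_eval.comp ((hξm.comp hhist).prodMk measurable_id)).sub (hmean.comp hhist)
  have hpost (φ : ℝ → ℝ≥0∞) (hφ : Measurable φ) :=
    h.lintegral_posterior hs hX hπm hπ hξm hξ (g := fun q => φ (q.2 - postMean k s q.1 (ξ q.1)))
      (hφ.comp (measurable_snd.sub (hmean.comp measurable_fst)))
  refine integrable_and_integral_eq_zero_of_lintegral_neg hmeas.aemeasurable ?_ ?_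
  · have hle := h.lintegral_sub_ucb_le hs hX hk hπm hπ hξm hξ 0
    simp only [ucb, Real.sqrt_zero, zero_mul, add_zero] at hle
    exact (hle.trans_lt ENNReal.ofReal_lt_top).ne
  · refine (hpost (fun z => ENNReal.ofReal (-z)) (by fun_prop)).trans
      (Eq.trans ?_ (hpost (fun z => ENNReal.ofReal z) (by fun_prop)).symm)
    exact lintegral_congr fun ω => lintegral_ofReal_neg_sub_gaussianReal _ _

lemma integral_max_sub_ucb_le (h : IsMeasurableGPModel P X k s f ε) (hs : 0 < s)
    (hX : MeasurableSet X) (hk : ∀ x ∈ X, k x x ≤ 1) (hπm : ∀ n, Measurable (π n))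
    (hπ : π.StaysIn X) {x : Pt d} (hx : x ∈ X) (n : ℕ) (β : ℝ) :
    Integrable (fun ω => max (f x ω - ucb k s β (history π f ε ω n) x) 0) P ∧
      ∫ ω, max (f x ω - ucb k s β (history π f ε ω n) x) 0 ∂P ≤ excessBound β := by
  have hhist := h.measurable_history hπm n
  have hmeas : Measurable fun ω => max (f x ω - ucb k s β (history π f ε ω n) x) 0 :=
    ((h.measurable_f x hx).sub (((measurable_postMean h.measurable_kernel measurable_const
      s).comp hhist).add (((measurable_postVar h.measurable_kernel measurable_const s).comp
        hhist).sqrt.const_mul _))).max measurable_const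
  have hnonneg : 0 ≤ᵐ[P] fun ω => max (f x ω - ucb k s β (history π f ε ω n) x) 0 :=
    .of_forall fun ω => le_max_right _ _
  have hle : ∫⁻ ω, ENNReal.ofReal (max (f x ω - ucb k s β (history π f ε ω n) x) 0) ∂P ≤
      ENNReal.ofReal (excessBound β) := by
    simp only [ENNReal.ofReal_max, ENNReal.ofReal_zero, max_eq_left zero_le]
    exact h.lintegral_sub_ucb_le hs hX hk hπm hπ measurable_const (fun _ _ => hx) β
  refine ⟨(lintegral_ofReal_ne_top_iff_integrable hmeas.aestronglyMeasurable hnonneg).1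
    (hle.trans_lt ENNReal.ofReal_lt_top).ne, ?_⟩
  rw [integral_eq_lintegral_of_nonneg_ae hnonneg hmeas.aestronglyMeasurable]
  exact ENNReal.toReal_le_of_le_ofReal (excessBound_nonneg β) hle

lemma integrable_width (h : IsMeasurableGPModel P X k s f ε) (hs : 0 < s)
    (hk : ∀ x ∈ X, k x x ≤ 1) (hπm : ∀ n, Measurable (π n)) (hπ : π.StaysIn X) (n : ℕ) (β : ℝ) :
    Integrable (fun ω => √β * √(postVar k s (history π f ε ω n) (query π f ε n ω))) P := by
  refine Integrable.const_mul (Integrable.of_bound (((measurable_postVar h.measurable_kernel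
    (hπm n) s).comp (h.measurable_history hπm n)).sqrt.aestronglyMeasurable) 1
      (.of_forall fun ω => ?_)) _
  rw [Real.norm_eq_abs, abs_of_nonneg (Real.sqrt_nonneg _), Real.sqrt_le_one]
  exact (h.postVar_le hs (history_mem hπ f ε ω n) _).trans (hk _ (query_mem hπ f ε n ω))

end IsMeasurableGPModel

section Regret

variable {d : ℕ} {Ω : Type*} {X : Set (Pt d)} {k : Pt d → Pt d → ℝ} {s : ℝ≥0} {f : Pt d → Ω → ℝ}
  {ε : ℕ → Ω → ℝ} {π : Rule d} {β : ℕ → ℝ}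

lemma IsGPUCB.sub_query_le (hπ : IsGPUCB X k s β π) {n : ℕ} {ω : Ω} {N : Finset (Pt d)}
    (hN : ∀ y ∈ N, y ∈ X) {x : Pt d} {δ : ℝ} (hδ : ∃ y ∈ N, f x ω ≤ f y ω + δ) :
    f x ω - f (query π f ε n ω) ω ≤
      ∑ y ∈ N, max (f y ω - ucb k s (β (n + 1)) (history π f ε ω n) y) 0 + δ +
        √(β (n + 1)) * √(postVar k s (history π f ε ω n) (query π f ε n ω)) -
        (f (query π f ε n ω) ω - postMean k s (history π f ε ω n) (query π f ε n ω)) := by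
  obtain ⟨y, hy, hle⟩ := hδ
  have hsum : f y ω - ucb k s (β (n + 1)) (history π f ε ω n) y ≤
      ∑ y ∈ N, max (f y ω - ucb k s (β (n + 1)) (history π f ε ω n) y) 0 :=
    (le_max_left _ 0).trans (Finset.single_le_sum
      (f := fun y => max (f y ω - ucb k s (β (n + 1)) (history π f ε ω n) y) 0)
      (fun _ _ => le_max_right _ _) hy)
  have hmax : ucb k s (β (n + 1)) (history π f ε ω n) y ≤
      postMean k s (history π f ε ω n) (query π f ε n ω) +
        √(β (n + 1)) * √(postVar k s (history π f ε ω n) (query π f ε n ω)) :=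
    hπ.isMaxOn n _ (history_mem hπ.mem f ε ω n) (hN y hy)
  linarith

variable [MeasurableSpace Ω] {P : Measure Ω}

lemma IsMeasurableGPModel.integral_sub_query_le [IsProbabilityMeasure P]
    (h : IsMeasurableGPModel P X k s f ε) (hs : 0 < s) (hX : MeasurableSet X)
    (hk : ∀ x ∈ X, k x x ≤ 1) (hπ : IsGPUCB X k s β π) {xstar : Ω → Pt d}
    (hxs : ∀ᵐ ω ∂P, xstar ω ∈ X) (n : ℕ)
    (hint : Integrable (fun ω => f (xstar ω) ω - f (query π f ε n ω) ω) P)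
    {N : Finset (Pt d)} (hN : ∀ y ∈ N, y ∈ X) {δ : Ω → ℝ} (hδi : Integrable δ P)
    (hδ : ∀ᵐ ω ∂P, ∀ x ∈ X, ∃ y ∈ N, f x ω ≤ f y ω + δ ω) :
    ∫ ω, (f (xstar ω) ω - f (query π f ε n ω) ω) ∂P ≤
      N.card * excessBound (β (n + 1)) + ∫ ω, δ ω ∂P +
        ∫ ω, √(β (n + 1)) * √(postVar k s (history π f ε ω n) (query π f ε n ω)) ∂P := by
  have hexcess (y) (hy : y ∈ N) := h.integral_max_sub_ucb_le hs hX hk hπ.measurable hπ.mem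
    (hN y hy) n (β (n + 1))
  obtain ⟨herror, herror_eq⟩ := h.integral_sub_postMean hs hX hk hπ.measurable hπ.mem
    (hπ.measurable n) (hπ.mem n)
  have hwidth := h.integrable_width hs hk hπ.measurable hπ.mem n (β (n + 1))
  have hsum := integrable_finsetSum N fun y hy => (hexcess y hy).1
  have hsum_le : ∫ ω, ∑ y ∈ N, max (f y ω - ucb k s (β (n + 1)) (history π f ε ω n) y) 0 ∂P ≤
      N.card * excessBound (β (n + 1)) := by
    rw [integral_finsetSum _ fun y hy => (hexcess y hy).1, ← nsmul_eq_mul, ← Finset.sum_const]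
    exact Finset.sum_le_sum fun y hy => (hexcess y hy).2
  refine (integral_mono_ae hint (((hsum.add hδi).add hwidth).sub herror) ?_).trans ?_
  · filter_upwards [hxs, hδ] with ω hω hδω using hπ.sub_query_le hN (hδω _ hω)
  · rw [integral_sub' ((hsum.add hδi).add hwidth) herror, integral_add' (hsum.add hδi) hwidth,
      integral_add' hsum hδi, herror_eq, sub_zero]
    gcongr

lemma IsGPModel.sum_width_le [IsProbabilityMeasure P] (hm : IsGPModel P X k s f ε) (hs : 0 < s)
    (hk : ∀ x ∈ X, k x x ≤ 1) (hπ : π.StaysIn X) (hβ : MonotoneOn β (Set.Ici 1)) (T : ℕ) (ω : Ω) :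
    ∑ n ∈ Finset.range T, √(β (n + 1)) * √(postVar k s (history π f ε ω n) (query π f ε n ω)) ≤
      √(constC1 s * T * β T * (maxInfoGain P X f ε T).toReal) := by
  set v : ℕ → ℝ := fun n => postVar k s (history π f ε ω n) (query π f ε n ω) with hv
  have hv_nonneg (n : ℕ) : 0 ≤ v n :=
    hm.postVar_nonneg hs (history_mem hπ f ε ω n) (query_mem hπ f ε n ω)
  have hsum : ∑ n ∈ Finset.range T, v n ≤ constC1 s * (maxInfoGain P X f ε T).toReal := by
    simp only [hv, history_eq]
    exact hm.sum_postVar_le hs hk (D := fun t => (query π f ε t ω, observation π f ε t ω))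
      (fun t => query_mem hπ f ε t ω) T
  have hcauchy : ∑ n ∈ Finset.range T, √(v n) ≤
      √(T * (constC1 s * (maxInfoGain P X f ε T).toReal)) := by
    refine Real.le_sqrt_of_sq_le ((sq_sum_le_card_mul_sum_sq (s := Finset.range T)
      (f := fun n => √(v n))).trans ?_)
    simp only [Real.sq_sqrt (hv_nonneg _), Finset.card_range]
    gcongr
  calc ∑ n ∈ Finset.range T, √(β (n + 1)) * √(v n)
      ≤ ∑ n ∈ Finset.range T, √(β T) * √(v n) := by
        refine Finset.sum_le_sum fun n hn => mul_le_mul_of_nonneg_right ?_ (Real.sqrt_nonneg _)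
        have hn' : n + 1 ≤ T := Finset.mem_range.1 hn
        exact Real.sqrt_le_sqrt (hβ (Nat.le_add_left 1 n) ((Nat.le_add_left 1 n).trans hn') hn')
    _ ≤ √(β T) * √(T * (constC1 s * (maxInfoGain P X f ε T).toReal)) := by
        rw [← Finset.mul_sum]
        gcongr
    _ = √(constC1 s * T * β T * (maxInfoGain P X f ε T).toReal) := by
        rw [← Real.sqrt_mul' _ (mul_nonneg (Nat.cast_nonneg T)
          ((Finset.sum_nonneg fun n _ => hv_nonneg n).trans hsum))]
        congr 1
        ring

/-- Two ways to bound by `B` the excess of the expected regret of one query over the width of its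
confidence interval, when the confidence parameter is `β`: by discretization, the objective being
nearly maximized on a finite subset of `X`, or by a bound on its oscillation on `X`. -/
inductive StepBound (P : Measure Ω) (X : Set (Pt d)) (f : Pt d → Ω → ℝ) (β B : ℝ) : Prop
  | net (N : Finset (Pt d)) (δ : Ω → ℝ) (subset : ∀ y ∈ N, y ∈ X) (integrable : Integrable δ P)
    (exists_le : ∀ᵐ ω ∂P, ∀ x ∈ X, ∃ y ∈ N, f x ω ≤ f y ω + δ ω)
    (le : N.card * excessBound β + ∫ ω, δ ω ∂P ≤ B)
  | oscillation (δ : Ω → ℝ) (integrable : Integrable δ P)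
    (le_add : ∀ᵐ ω ∂P, ∀ x ∈ X, ∀ y ∈ X, f x ω ≤ f y ω + δ ω) (le : ∫ ω, δ ω ∂P ≤ B)

lemma StepBound.congr {f' : Pt d → Ω → ℝ} {β B : ℝ} (h : StepBound P X f β B)
    (hf : ∀ᵐ ω ∂P, ∀ x ∈ X, f x ω = f' x ω) : StepBound P X f' β B := by
  rcases h with ⟨N, δ, hN, hδi, hδ, hB⟩ | ⟨δ, hδi, hδ, hB⟩
  · refine .net N δ hN hδi ?_ hB
    filter_upwards [hδ, hf] with ω hδω hfω x hx
    obtain ⟨y, hy, hle⟩ := hδω x hx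
    exact ⟨y, hy, by rwa [← hfω x hx, ← hfω y (hN y hy)]⟩
  · refine .oscillation δ hδi ?_ hB
    filter_upwards [hδ, hf] with ω hδω hfω x hx y hy
    rw [← hfω x hx, ← hfω y hy]
    exact hδω x hx y hy

lemma sum_inv_sq_le (T : ℕ) :
    ∑ n ∈ Finset.range T, 1 / ((n + 1 : ℕ) : ℝ) ^ 2 ≤ Real.pi ^ 2 / 6 := by
  have hsum := (hasSum_nat_add_iff' (f := fun n : ℕ => 1 / (n : ℝ) ^ 2) 1).2 hasSum_zeta_two
  refine (sum_le_hasSum (Finset.range T) (fun n _ => by positivity) hsum).trans_eq ?_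
  simp

namespace IsMeasurableGPModel

variable [IsProbabilityMeasure P] {xstar : Ω → Pt d}

lemma integral_sub_query_le_of_stepBound (h : IsMeasurableGPModel P X k s f ε) (hs : 0 < s)
    (hX : MeasurableSet X) (hk : ∀ x ∈ X, k x x ≤ 1) (hπ : IsGPUCB X k s β π)
    (hxs : ∀ᵐ ω ∂P, xstar ω ∈ X) {n : ℕ}
    (hint : Integrable (fun ω => f (xstar ω) ω - f (query π f ε n ω) ω) P) {B : ℝ}
    (hstep : StepBound P X f (β (n + 1)) B) :
    ∫ ω, (f (xstar ω) ω - f (query π f ε n ω) ω) ∂P ≤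
      B + ∫ ω, √(β (n + 1)) * √(postVar k s (history π f ε ω n) (query π f ε n ω)) ∂P := by
  rcases hstep with ⟨N, δ, hN, hδi, hδ, hle⟩ | ⟨δ, hδi, hδ, hle⟩
  · refine (h.integral_sub_query_le hs hX hk hπ hxs n hint hN hδi hδ).trans ?_
    gcongr
  · refine ((integral_mono_ae hint hδi ?_).trans hle).trans
      (le_add_of_nonneg_right (integral_nonneg fun ω => by positivity))
    filter_upwards [hxs, hδ] with ω hω hδω
    exact sub_le_iff_le_add'.2 (hδω _ hω _ (query_mem hπ.mem f ε n ω))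

theorem regret_bound (h : IsMeasurableGPModel P X k s f ε) (hs : 0 < s)
    (hX : MeasurableSet X) (hk : ∀ x ∈ X, k x x ≤ 1) (hπ : IsGPUCB X k s β π)
    (hβ : MonotoneOn β (Set.Ici 1)) (hxs : ∀ᵐ ω ∂P, xstar ω ∈ X)
    (hxm : AEStronglyMeasurable (fun ω => f (xstar ω) ω) P) {M : Ω → ℝ} (hMi : Integrable M P)
    (hM : ∀ᵐ ω ∂P, ∀ x ∈ X, |f x ω| ≤ M ω) {B : ℝ} (hB : 0 ≤ B)
    (hstep : ∀ n : ℕ, StepBound P X f (β (n + 1)) (B / ((n + 1 : ℕ) : ℝ) ^ 2)) (T : ℕ) :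
    Integrable (cumRegret π f ε xstar T) P ∧ bcr P π f ε xstar T ≤ B * (Real.pi ^ 2 / 6) +
      √(constC1 s * T * β T * (maxInfoGain P X f ε T).toReal) := by
  have hmax : Integrable (fun ω => f (xstar ω) ω) P := hMi.mono' hxm <| by
    filter_upwards [hxs, hM] with ω hω hMω using hMω _ hω
  have hquery (n : ℕ) : Integrable (fun ω => f (query π f ε n ω) ω) P :=
    hMi.mono' (h.measurable_eval.comp (((hπ.measurable n).comp
      (h.measurable_history hπ.measurable n)).prodMk measurable_id)).aestronglyMeasurable <| by
        filter_upwards [hM] with ω hMω using hMω _ (query_mem hπ.mem f ε n ω)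
  have hregret (n : ℕ) := hmax.sub (hquery n)
  refine ⟨integrable_finsetSum _ fun n _ => hregret n, ?_⟩
  have hwidth (n : ℕ) := h.integrable_width hs hk hπ.measurable hπ.mem n (β (n + 1))
  calc bcr P π f ε xstar T
      = ∑ n ∈ Finset.range T, ∫ ω, (f (xstar ω) ω - f (query π f ε n ω) ω) ∂P :=
        integral_finsetSum _ fun n _ => hregret n
    _ ≤ ∑ n ∈ Finset.range T, (B * (1 / ((n + 1 : ℕ) : ℝ) ^ 2) +
          ∫ ω, √(β (n + 1)) * √(postVar k s (history π f ε ω n) (query π f ε n ω)) ∂P) :=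
        Finset.sum_le_sum fun n _ => by
          rw [mul_one_div]
          exact h.integral_sub_query_le_of_stepBound hs hX hk hπ hxs (hregret n) (hstep n)
    _ = B * ∑ n ∈ Finset.range T, 1 / ((n + 1 : ℕ) : ℝ) ^ 2 + ∫ ω, ∑ n ∈ Finset.range T,
          √(β (n + 1)) * √(postVar k s (history π f ε ω n) (query π f ε n ω)) ∂P := by
        rw [Finset.sum_add_distrib, Finset.mul_sum, integral_finsetSum _ fun n _ => hwidth n]
    _ ≤ B * (Real.pi ^ 2 / 6) +
          ∫ _, √(constC1 s * T * β T * (maxInfoGain P X f ε T).toReal) ∂P := by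
        gcongr
        · exact sum_inv_sq_le T
        · exact integrable_finsetSum _ fun n _ => hwidth n
        · exact integrable_const _
        · exact fun ω => h.sum_width_le hs hk hπ.mem hβ T ω
    _ = _ := by simp

end IsMeasurableGPModel

end Regret

lemma maxInfoGain_congr {d : ℕ} {Ω : Type*} [MeasurableSpace Ω] {P : Measure Ω} {X : Set (Pt d)}
    {f f' : Pt d → Ω → ℝ} {ε : ℕ → Ω → ℝ} (h : ∀ᵐ ω ∂P, ∀ x ∈ X, f x ω = f' x ω) (T : ℕ) :
    maxInfoGain P X f ε T = maxInfoGain P X f' ε T := by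
  refine iSup_congr fun A => ?_
  have hval : (fun ω (i : Fin T) => f (A i) ω) =ᵐ[P] fun ω i => f' (A i) ω := by
    filter_upwards [h] with ω hω
    exact funext fun i => hω _ (A i).2
  have hobs : (fun ω (i : Fin T) => f (A i) ω + ε i ω) =ᵐ[P] fun ω i => f' (A i) ω + ε i ω := by
    filter_upwards [h] with ω hω
    exact funext fun i => by rw [hω _ (A i).2]
  simp only [mutualInfo]
  rw [Measure.map_congr hval, Measure.map_congr hobs, Measure.map_congr (hobs.prodMk hval)]

/-! ### Reduction to measurable models -/

section CongrKernel

variable {d : ℕ} {X : Set (Pt d)} {k k' : Pt d → Pt d → ℝ}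

lemma ucb_congr_kernel (hk : ∀ x ∈ X, ∀ y ∈ X, k x y = k' x y) (s : ℝ≥0) (β : ℝ) {n : ℕ}
    {D : Data d n} (hD : ∀ i, (D i).1 ∈ X) {x : Pt d} (hx : x ∈ X) :
    ucb k s β D x = ucb k' s β D x := by
  have hvec : kernelVec k D x = kernelVec k' D x := funext fun i => hk _ hx _ (hD i)
  have hmat : regKernelMatrix k s D = regKernelMatrix k' s D := by
    ext i j
    simp only [regKernelMatrix, Matrix.add_apply, Matrix.of_apply, hk _ (hD i) _ (hD j)]
  simp only [ucb, postMean, postVar, hvec, hmat, hk x hx x hx]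

lemma IsGPUCB.congr_kernel {s : ℝ≥0} {β : ℕ → ℝ} {π : Rule d} (h : IsGPUCB X k s β π)
    (hk : ∀ x ∈ X, ∀ y ∈ X, k x y = k' x y) : IsGPUCB X k' s β π where
  measurable := h.measurable
  mem := h.mem
  isMaxOn n D hD := isMaxOn_iff.2 fun x hx => by
    rw [← ucb_congr_kernel hk s _ hD hx, ← ucb_congr_kernel hk s _ hD (h.mem n D hD)]
    exact h.isMaxOn n D hD hx

end CongrKernel

lemma eq_iSup_of_isMaxOn_of_subset_closure {α : Type*} [TopologicalSpace α] {X : Set α}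
    {g : α → ℝ} (hg : ContinuousOn g X) {ι : Type*} {e : ι → α} (he : ∀ i, e i ∈ X)
    (hdense : X ⊆ closure (Set.range e)) {x : α} (hx : x ∈ X) (hmax : IsMaxOn g X x) :
    g x = ⨆ i, g (e i) := by
  have hbdd : BddAbove (Set.range fun i => g (e i)) :=
    ⟨g x, Set.forall_mem_range.2 fun i => hmax (he i)⟩
  have : Nonempty ι := Set.range_nonempty_iff_nonempty.1 (closure_nonempty_iff.1 ⟨x, hdense hx⟩)
  refine le_antisymm ?_ (ciSup_le fun i => hmax (he i))
  have hmem : g x ∈ closure (g '' Set.range e) :=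
    ((hg x hx).mono (Set.range_subset_iff.2 he)).mem_closure_image (hdense hx)
  refine closure_minimal ?_ isClosed_Iic hmem
  rw [← Set.range_comp]
  exact Set.range_subset_iff.2 fun i => le_ciSup hbdd i

lemma aestronglyMeasurable_eval_argmax {α : Type*} [TopologicalSpace α]
    [SecondCountableTopology α] {Ω : Type*} [MeasurableSpace Ω] {P : Measure Ω}
    {X : Set α} (hX : X.Nonempty) {f : α → Ω → ℝ} (hf : ∀ x ∈ X, Measurable (f x))
    (hcont : ∀ᵐ ω ∂P, ContinuousOn (fun x => f x ω) X) {xstar : Ω → α}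
    (hxstar : ∀ᵐ ω ∂P, xstar ω ∈ X ∧ IsMaxOn (fun x => f x ω) X (xstar ω)) :
    AEStronglyMeasurable (fun ω => f (xstar ω) ω) P := by
  obtain ⟨e, he, hdense⟩ := exists_seq_mem_subset_closure hX
  refine AEMeasurable.aestronglyMeasurable
    ⟨fun ω => ⨆ i, f (e i) ω, Measurable.iSup fun i => hf _ (he i), ?_⟩
  filter_upwards [hcont, hxstar] with ω hω ⟨hx, hmax⟩
  exact eq_iSup_of_isMaxOn_of_subset_closure hω he hdense hx hmax

lemma covariance_congr_ae {Ω : Type*} [MeasurableSpace Ω] {P : Measure Ω} {Y Y' Z Z' : Ω → ℝ}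
    (hY : Y =ᵐ[P] Y') (hZ : Z =ᵐ[P] Z') : cov[Y, Z; P] = cov[Y', Z'; P] := by
  rw [covariance, covariance, integral_congr_ae hY, integral_congr_ae hZ]
  refine integral_congr_ae ?_
  filter_upwards [hY, hZ] with ω hYω hZω
  rw [hYω, hZω]

namespace IsGPModel

variable {d : ℕ} {Ω : Type*} [MeasurableSpace Ω] {P : Measure Ω} {X : Set (Pt d)}
  {k : Pt d → Pt d → ℝ} {s : ℝ≥0} {f : Pt d → Ω → ℝ} {ε : ℕ → Ω → ℝ}

lemma congr (hm : IsGPModel P X k s f ε) {k' : Pt d → Pt d → ℝ} {f' : Pt d → Ω → ℝ}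
    (hf' : ∀ x ∈ X, Measurable (f' x)) (hf : ∀ x ∈ X, f x =ᵐ[P] f' x)
    (hk : ∀ x ∈ X, ∀ y ∈ X, k x y = k' x y)
    (hind : IndepFun (fun ω (x : X) => f' x ω) (fun ω n => ε n ω) P) :
    IsGPModel P X k' s f' ε where
  measurable_f := hf'
  measurable_noise := hm.measurable_noise
  gaussian := hm.gaussian.congr fun x => hf x x.2
  mean x hx := (integral_congr_ae (hf x hx)).symm.trans (hm.mean x hx)
  cov x hx y hy := by
    rw [← hk x hx y hy, ← hm.cov x hx y hy, covariance_congr_ae (hf x hx) (hf y hy)]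
  noise_law := hm.noise_law
  noise_indep := hm.noise_indep
  indep := hind

variable [IsProbabilityMeasure P]

lemma integral_mul_eq (hm : IsGPModel P X k s f ε) {x y : Pt d} (hx : x ∈ X) (hy : y ∈ X) :
    ∫ ω, f x ω * f y ω ∂P = k x y := by
  rw [← hm.cov x hx y hy, covariance_eq_sub (hm.memLp_f hx) (hm.memLp_f hy), hm.mean x hx,
    zero_mul, sub_zero]
  rfl

/-- The paths are reconstructed from their values on a countable dense subset of `X`. -/
lemma exists_isMeasurableGPModel (hm : IsGPModel P X k s f ε) (hX : X.Nonempty)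
    (hcont : ∀ᵐ ω ∂P, ContinuousOn (fun x => f x ω) X) :
    ∃ (k' : Pt d → Pt d → ℝ) (f' : Pt d → Ω → ℝ), IsMeasurableGPModel P X k' s f' ε ∧
      (∀ x ∈ X, ∀ y ∈ X, k x y = k' x y) ∧ ∀ᵐ ω ∂P, ∀ x ∈ X, f x ω = f' x ω := by
  obtain ⟨e, he, hdense⟩ := exists_seq_mem_subset_closure hX
  obtain ⟨Φ, hΦ, hΦf⟩ := exists_measurable_version he hdense f
  let p : Ω → ℕ → ℝ := fun ω i => f (e i) ω
  let f' : Pt d → Ω → ℝ := fun x ω => Φ x (p ω)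
  let k' : Pt d → Pt d → ℝ := fun x y => ∫ ω, f' x ω * f' y ω ∂P
  have hp : Measurable p := measurable_pi_lambda _ fun i => hm.measurable_f _ (he i)
  have hpath : ∀ᵐ ω ∂P, ∀ x ∈ X, f x ω = f' x ω :=
    hcont.mono fun ω hω x hx => (hΦf ω hω x hx).symm
  have hae (x) (hx : x ∈ X) : f x =ᵐ[P] f' x := hpath.mono fun ω hω => hω x hx
  have hk (x) (hx : x ∈ X) (y) (hy : y ∈ X) : k x y = k' x y := by
    rw [← hm.integral_mul_eq hx hy]
    exact integral_congr_ae ((hae x hx).mul (hae y hy))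
  have hf'_meas : Measurable fun q : Pt d × Ω => f' q.1 q.2 :=
    hΦ.comp (measurable_fst.prodMk (hp.comp measurable_snd))
  have hk'_meas : Measurable fun q : Pt d × Pt d => k' q.1 q.2 := by
    have hmul : Measurable fun q : (Pt d × Pt d) × Ω => f' q.1.1 q.2 * f' q.1.2 q.2 :=
      (hf'_meas.comp (measurable_fst.fst.prodMk measurable_snd)).mul
        (hf'_meas.comp (measurable_fst.snd.prodMk measurable_snd))
    exact hmul.stronglyMeasurable.integral_prod_right.measurable
  have hind : IndepFun p (fun ω n => ε n ω) P :=
    hm.indep.comp (φ := fun u i => u ⟨e i, he i⟩)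
      (measurable_pi_lambda _ fun i => measurable_pi_apply _) measurable_id
  have hind' : IndepFun (fun ω (x : X) => f' x ω) (fun ω n => ε n ω) P :=
    hind.comp (φ := fun u (x : X) => Φ x u)
      (measurable_pi_lambda _ fun x => hΦ.comp (measurable_const.prodMk measurable_id))
      measurable_id
  exact ⟨k', f', ⟨hm.congr (fun x _ => hf'_meas.of_uncurry_left) hae hk hind', hk'_meas,
    Φ, p, hΦ, hp, hind, rfl⟩, hk, hpath⟩

theorem regret_bound (hm : IsGPModel P X k s f ε) (hs : 0 < s) (hX : MeasurableSet X)
    (hunit : ∀ x ∈ X, k x x ≤ 1) (hcont : ∀ᵐ ω ∂P, ContinuousOn (fun x => f x ω) X)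
    {β : ℕ → ℝ} {π : Rule d} (hπ : IsGPUCB X k s β π) (hβ : MonotoneOn β (Set.Ici 1))
    {xstar : Ω → Pt d} (hxstar : ∀ᵐ ω ∂P, xstar ω ∈ X ∧ IsMaxOn (fun x => f x ω) X (xstar ω))
    {M : Ω → ℝ} (hMi : Integrable M P) (hM : ∀ᵐ ω ∂P, ∀ x ∈ X, |f x ω| ≤ M ω)
    {B : ℝ} (hB : 0 ≤ B)
    (hstep : ∀ n : ℕ, StepBound P X f (β (n + 1)) (B / ((n + 1 : ℕ) : ℝ) ^ 2)) (T : ℕ) :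
    maxInfoGain P X f ε T ≠ ∞ ∧ Integrable (cumRegret π f ε xstar T) P ∧
      bcr P π f ε xstar T ≤ B * (Real.pi ^ 2 / 6) +
        √(constC1 s * T * β T * (maxInfoGain P X f ε T).toReal) := by
  obtain ⟨_, hmem, -⟩ := hxstar.exists
  have hne : X.Nonempty := ⟨_, hmem⟩
  obtain ⟨k', f', h, hk, hf⟩ := hm.exists_isMeasurableGPModel hne hcont
  have hxm : AEStronglyMeasurable (fun ω => f' (xstar ω) ω) P := by
    refine (aestronglyMeasurable_eval_argmax hne hm.measurable_f hcont hxstar).congr ?_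
    filter_upwards [hxstar, hf] with ω hx hfω using hfω _ hx.1
  have hM' : ∀ᵐ ω ∂P, ∀ x ∈ X, |f' x ω| ≤ M ω := by
    filter_upwards [hM, hf] with ω hMω hfω x hx
    exact hfω x hx ▸ hMω x hx
  obtain ⟨hint, hbcr⟩ := h.regret_bound hs hX (fun x hx => hk x hx x hx ▸ hunit x hx)
    (hπ.congr_kernel hk) hβ (hxstar.mono fun ω hω => hω.1) hxm hMi hM' hB
    (fun n => (hstep n).congr hf) T
  have hreg : cumRegret π f ε xstar T =ᵐ[P] cumRegret π f' ε xstar T := by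
    filter_upwards [hf, hxstar] with ω hω hx
    refine Finset.sum_congr rfl fun n _ => ?_
    have hquery : query π f ε n ω = query π f' ε n ω :=
      congrArg (π n) (history_congr hπ.mem hω fun _ _ => rfl)
    rw [hω _ hx.1, hω _ (query_mem hπ.mem f ε n ω), hquery]
  refine ⟨hm.maxInfoGain_ne_top hs hne hunit T, hint.congr hreg.symm, ?_⟩
  rw [maxInfoGain_congr hf T]
  exact (integral_congr_ae hreg).trans_le hbcr

end IsGPModel

/-! ### Finite domains -/

lemma mul_excessBound_le {m t β : ℝ} (ht : 0 < t)
    (h : m * t ^ 2 / √(2 * Real.pi) ≤ Real.exp (β / 2)) : m * excessBound β ≤ 1 / t ^ 2 := by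
  have hsq : β ≤ √β ^ 2 := by
    rcases le_total 0 β with hβ | hβ
    · rw [Real.sq_sqrt hβ]
    · exact hβ.trans (sq_nonneg _)
  have hexp : Real.exp (-√β ^ 2 / 2) ≤ Real.exp (-(β / 2)) := Real.exp_le_exp.2 (by linarith)
  rw [le_div_iff₀ (by positivity)]
  calc m * excessBound β * t ^ 2
      = m * t ^ 2 / √(2 * Real.pi) * Real.exp (-√β ^ 2 / 2) := by rw [excessBound]; ring
    _ ≤ Real.exp (β / 2) * Real.exp (-(β / 2)) := by gcongr
    _ = 1 := by rw [← Real.exp_add, add_neg_cancel, Real.exp_zero]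

lemma betaFinite_monotoneOn {N : ℕ} (hN : 0 < N) : MonotoneOn (betaFinite N) (Set.Ici 1) := by
  intro m (hm : 1 ≤ m) n _ hmn
  have : (0 : ℝ) < m := by exact_mod_cast hm
  have : (0 : ℝ) < N := by exact_mod_cast hN
  unfold betaFinite
  gcongr

lemma exp_half_betaFinite {N t : ℕ} (hN : 0 < N) (ht : 0 < t) :
    Real.exp (betaFinite N t / 2) = N * (t : ℝ) ^ 2 / √(2 * Real.pi) := by
  have : (0 : ℝ) < t := by exact_mod_cast ht
  have : (0 : ℝ) < N := by exact_mod_cast hN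
  rw [betaFinite, mul_div_cancel_left₀ _ two_ne_zero, Real.exp_log (by positivity)]

lemma stepBound_betaFinite {d : ℕ} {Ω : Type*} [MeasurableSpace Ω] {P : Measure Ω}
    {X : Set (Pt d)} (hX : X.Finite) (hne : X.Nonempty) (f : Pt d → Ω → ℝ) {t : ℕ} (ht : 0 < t) :
    StepBound P X f (betaFinite X.ncard t) (1 / (t : ℝ) ^ 2) := by
  refine .net hX.toFinset (fun _ => 0) (fun x hx => hX.mem_toFinset.1 hx) (integrable_zero _ _ _)
    (.of_forall fun ω x hx => ⟨x, hX.mem_toFinset.2 hx, (add_zero _).ge⟩) ?_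
  rw [integral_zero, add_zero, ← Set.ncard_eq_toFinset_card X hX]
  exact mul_excessBound_le (Nat.cast_pos.2 ht)
    (exp_half_betaFinite ((Set.ncard_pos hX).2 hne) ht).ge

theorem IsGPModel.regret_bound_finite {d : ℕ} {Ω : Type*} [MeasurableSpace Ω] {P : Measure Ω}
    [IsProbabilityMeasure P] {X : Set (Pt d)} {k : Pt d → Pt d → ℝ} {s : ℝ≥0}
    {f : Pt d → Ω → ℝ} {ε : ℕ → Ω → ℝ} {π : Rule d} (hm : IsGPModel P X k s f ε) (hs : 0 < s)
    (hunit : ∀ x ∈ X, k x x ≤ 1) {xstar : Ω → Pt d}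
    (hxstar : ∀ᵐ ω ∂P, xstar ω ∈ X ∧ IsMaxOn (fun x => f x ω) X (xstar ω)) (hX : X.Finite)
    (hπ : IsGPUCB X k s (betaFinite X.ncard) π) (T : ℕ) :
    maxInfoGain P X f ε T ≠ ∞ ∧ Integrable (cumRegret π f ε xstar T) P ∧
      bcr P π f ε xstar T ≤ Real.pi ^ 2 / 6 +
        √(constC1 s * T * betaFinite X.ncard T * (maxInfoGain P X f ε T).toReal) := by
  obtain ⟨_, hmem, -⟩ := hxstar.exists
  have hne : X.Nonempty := ⟨_, hmem⟩
  have hcont : ∀ᵐ ω ∂P, ContinuousOn (fun x => f x ω) X := .of_forall fun ω => hX.continuousOn _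
  have hMi : Integrable (fun ω => ∑ x ∈ hX.toFinset, |f x ω|) P :=
    integrable_finsetSum _ fun x hx =>
      ((hm.memLp_f (hX.mem_toFinset.1 hx)).integrable one_le_two).abs
  have hM : ∀ᵐ ω ∂P, ∀ x ∈ X, |f x ω| ≤ ∑ x ∈ hX.toFinset, |f x ω| := .of_forall fun ω x hx =>
    Finset.single_le_sum (f := fun x => |f x ω|) (fun _ _ => abs_nonneg _)
      (hX.mem_toFinset.2 hx)
  simpa only [one_mul] using hm.regret_bound hs hX.measurableSet hunit hcont hπ
    (betaFinite_monotoneOn ((Set.ncard_pos hX).2 hne)) hxstar hMi hM zero_le_one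
    (fun n => stepBound_betaFinite hX hne f n.succ_pos) T

lemma log_sqrt_log_isBigO {c : ℝ} (hc : 1 ≤ c) :
    (fun a : ℝ => Real.log (√(Real.log (a * c)) + √Real.pi / 2)) =O[Filter.atTop]
      fun a => Real.log (Real.log a) := by
  refine Asymptotics.IsBigO.of_bound 1 ?_
  filter_upwards [Filter.eventually_ge_atTop c, Filter.eventually_ge_atTop (Real.exp 4)]
    with a hac ha
  have ha_pos : 0 < a := (Real.exp_pos _).trans_le ha
  have hlog_a : 4 ≤ Real.log a := (Real.le_log_iff_exp_le ha_pos).2 ha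
  have hlog : Real.log (a * c) = Real.log a + Real.log c :=
    Real.log_mul ha_pos.ne' (by positivity)
  have hlog_c : 0 ≤ Real.log c := Real.log_nonneg hc
  have hlog_ca : Real.log c ≤ Real.log a := Real.log_le_log (by linarith) hac
  have hpi : √Real.pi ≤ 2 := Real.sqrt_le_iff.2 ⟨by norm_num, by linarith [Real.pi_le_four]⟩
  have hsqrt_le : √(Real.log (a * c)) ≤ Real.log a - 1 :=
    Real.sqrt_le_iff.2 ⟨by linarith, by nlinarith⟩
  have hle_sqrt : 1 ≤ √(Real.log (a * c)) := Real.le_sqrt_of_sq_le (by linarith)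
  have hsqrt_pi : 0 ≤ √Real.pi := Real.sqrt_nonneg _
  rw [one_mul, Real.norm_of_nonneg (Real.log_nonneg (by linarith)),
    Real.norm_of_nonneg (Real.log_nonneg (by linarith))]
  exact Real.log_le_log (by linarith) (by linarith)

theorem betaContinuous_isBigO (d : ℕ) (r b : ℝ) (t : ℕ) :
    (fun a : ℝ => betaContinuous d r a b t) =O[Filter.atTop]
      fun a : ℝ => Real.log (Real.log a) := by
  have hconst (C : ℝ) : (fun _ : ℝ => C) =O[Filter.atTop] fun a : ℝ => Real.log (Real.log a) :=
    (Asymptotics.isLittleO_const_left.2 (.inr (tendsto_norm_atTop_atTop.comp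
      (Real.tendsto_log_atTop.comp Real.tendsto_log_atTop)))).isBigO
  unfold betaContinuous
  refine (Asymptotics.IsBigO.const_mul_left ?_ _).add (hconst _)
  set c := b * d * r * (t : ℝ) ^ 2 with hc
  rcases eq_or_ne c 0 with hc_zero | hc_zero
  · simp only [hc_zero, zero_mul, Real.log_zero]
    exact hconst 0
  have hd : 1 ≤ (d : ℝ) := by
    rw [Nat.one_le_cast, Nat.one_le_iff_ne_zero]
    rintro rfl
    simp [hc] at hc_zero
  refine ((hconst (Real.log c)).add (log_sqrt_log_isBigO hd)).congr_left fun a => ?_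
  rw [Real.log_mul hc_zero (by positivity)]

/-! ### Random Lipschitz constants -/

lemma lintegral_Ioi_exp_neg_sq {b : ℝ} (hb : 0 < b) (c : ℝ) :
    ∫⁻ t in Set.Ioi c, ENNReal.ofReal (Real.exp (-((t - c) / b) ^ 2)) =
      ENNReal.ofReal (b * (√Real.pi / 2)) := by
  have hshift : ∫⁻ t in Set.Ioi c, ENNReal.ofReal (Real.exp (-((t - c) / b) ^ 2)) =
      ∫⁻ v in Set.Ioi 0, ENNReal.ofReal (Real.exp (-(b ^ 2)⁻¹ * v ^ 2)) := by
    rw [← lintegral_indicator measurableSet_Ioi, ← lintegral_indicator measurableSet_Ioi]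
    refine (lintegral_congr fun t => ?_).trans (lintegral_sub_right_eq_self _ c)
    simp only [Set.indicator_apply, Set.mem_Ioi, sub_pos, div_eq_inv_mul, mul_pow, inv_pow,
      neg_mul]
  rw [hshift, ← ofReal_integral_eq_lintegral_ofReal
    (integrable_exp_neg_mul_sq (by positivity)).integrableOn
    (.of_forall fun v => (Real.exp_pos _).le), integral_gaussian_Ioi, div_inv_eq_mul,
    Real.sqrt_mul Real.pi_pos.le, Real.sqrt_sq hb.le]
  congr 1
  ring

lemma mul_exp_neg_sqrt_log_add_sq_le {A v : ℝ} (hA : 0 ≤ A) (hv : 0 ≤ v) :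
    A * Real.exp (-(√(Real.log A) + v) ^ 2) ≤ Real.exp (-v ^ 2) := by
  have hone : A * Real.exp (-√(Real.log A) ^ 2) ≤ 1 := by
    rcases le_total A 1 with h | h
    · exact mul_le_one₀ h (Real.exp_pos _).le
        (Real.exp_le_one_iff.2 (neg_nonpos.2 (sq_nonneg _)))
    · have hA_pos : 0 < A := zero_lt_one.trans_le h
      rw [Real.sq_sqrt (Real.log_nonneg h), Real.exp_neg, Real.exp_log hA_pos,
        mul_inv_cancel₀ hA_pos.ne']
  calc A * Real.exp (-(√(Real.log A) + v) ^ 2)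
      ≤ A * Real.exp (-√(Real.log A) ^ 2 + -v ^ 2) := by
        gcongr
        nlinarith [mul_nonneg (Real.sqrt_nonneg (Real.log A)) hv]
    _ = A * Real.exp (-√(Real.log A) ^ 2) * Real.exp (-v ^ 2) := by rw [Real.exp_add, mul_assoc]
    _ ≤ Real.exp (-v ^ 2) := mul_le_of_le_one_left (Real.exp_pos _).le hone

section Tail

variable {Ω : Type*} [MeasurableSpace Ω] {P : Measure Ω} {Z : Ω → ℝ≥0∞} {A b : ℝ}

lemma ae_ne_top_of_tendsto_tail {u : ℝ → ℝ≥0∞}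
    (htail : ∀ l : ℝ, 0 < l → P {ω | ENNReal.ofReal l < Z ω} ≤ u l)
    (hu : Filter.Tendsto u Filter.atTop (nhds 0)) : ∀ᵐ ω ∂P, Z ω ≠ ∞ := by
  have hle : P {ω | Z ω = ∞} ≤ 0 := by
    refine ge_of_tendsto hu ?_
    filter_upwards [Filter.eventually_gt_atTop 0] with l hl
    exact (measure_mono fun ω (hω : Z ω = ∞) => by simp [hω]).trans (htail l hl)
  simpa only [ae_iff, not_not] using nonpos_iff_eq_zero.1 hle

lemma tendsto_subGaussian_tail (A : ℝ) (hb : 0 < b) :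
    Filter.Tendsto (fun l => ENNReal.ofReal (A * Real.exp (-(l / b) ^ 2))) Filter.atTop
      (nhds 0) := by
  rw [← ENNReal.ofReal_zero, ← mul_zero A]
  exact ENNReal.tendsto_ofReal <| (Real.tendsto_exp_atBot.comp <|
    Filter.tendsto_neg_atTop_atBot.comp <| (Filter.tendsto_pow_atTop two_ne_zero).comp <|
      Filter.tendsto_id.atTop_div_const hb).const_mul A

lemma lintegral_toReal_le_of_subGaussian_tail [IsProbabilityMeasure P] (hZ : Measurable Z)
    (hA : 0 ≤ A) (hb : 0 < b) (htail : ∀ l : ℝ, 0 < l →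
      P {ω | ENNReal.ofReal l < Z ω} ≤ ENNReal.ofReal (A * Real.exp (-(l / b) ^ 2))) :
    ∫⁻ ω, ENNReal.ofReal (Z ω).toReal ∂P ≤
      ENNReal.ofReal (b * (√(Real.log A) + √Real.pi / 2)) := by
  set c := b * √(Real.log A) with hc
  have hc_nonneg : 0 ≤ c := by positivity
  have htail_Ioi (t : ℝ) (ht : c < t) : P {ω | t < (Z ω).toReal} ≤
      ENNReal.ofReal (Real.exp (-((t - c) / b) ^ 2)) := by
    have ht_pos : 0 < t := hc_nonneg.trans_lt ht
    have hsub : {ω | t < (Z ω).toReal} ⊆ {ω | ENNReal.ofReal t < Z ω} := fun ω hω =>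
      (ENNReal.ofReal_lt_ofReal_iff (ht_pos.trans hω)).2 hω |>.trans_le ENNReal.ofReal_toReal_le
    refine (measure_mono hsub).trans ((htail t ht_pos).trans (ENNReal.ofReal_le_ofReal ?_))
    have hshift : t / b = √(Real.log A) + (t - c) / b := by
      rw [hc]
      field_simp
      ring
    rw [hshift]
    exact mul_exp_neg_sqrt_log_add_sq_le hA (div_nonneg (sub_nonneg.2 ht.le) hb.le)
  rw [lintegral_eq_lintegral_meas_lt P (.of_forall fun ω => ENNReal.toReal_nonneg)
    hZ.ennreal_toReal.aemeasurable, ← Set.Ioc_union_Ioi_eq_Ioi hc_nonneg, mul_add,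
    ENNReal.ofReal_add hc_nonneg (by positivity), ← lintegral_Ioi_exp_neg_sq hb c]
  refine (lintegral_union_le _ _ _).trans (add_le_add ?_ ?_)
  · refine (lintegral_mono fun t => prob_le_one).trans_eq ?_
    rw [lintegral_one, Measure.restrict_apply_univ, Real.volume_Ioc, sub_zero]
  · exact setLIntegral_mono' measurableSet_Ioi htail_Ioi

lemma integral_toReal_le_of_subGaussian_tail [IsProbabilityMeasure P] (hZ : Measurable Z)
    (hA : 0 ≤ A) (hb : 0 < b) (htail : ∀ l : ℝ, 0 < l →
      P {ω | ENNReal.ofReal l < Z ω} ≤ ENNReal.ofReal (A * Real.exp (-(l / b) ^ 2))) :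
    Integrable (fun ω => (Z ω).toReal) P ∧
      ∫ ω, (Z ω).toReal ∂P ≤ b * (√(Real.log A) + √Real.pi / 2) := by
  have hle := lintegral_toReal_le_of_subGaussian_tail hZ hA hb htail
  have hnonneg : 0 ≤ᵐ[P] fun ω => (Z ω).toReal := .of_forall fun ω => ENNReal.toReal_nonneg
  refine ⟨(lintegral_ofReal_ne_top_iff_integrable hZ.ennreal_toReal.aestronglyMeasurable
    hnonneg).1 (hle.trans_lt ENNReal.ofReal_lt_top).ne, ?_⟩
  rw [integral_eq_lintegral_of_nonneg_ae hnonneg hZ.ennreal_toReal.aestronglyMeasurable]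
  exact ENNReal.toReal_le_of_le_ofReal (by positivity) hle

end Tail

/-- The norm `‖x‖₁`, with respect to which a bound on the partial derivatives is a Lipschitz
constant. -/
noncomputable def l1Norm {d : ℕ} (x : Pt d) : ℝ := ∑ j, |x j|

section L1Norm

variable {d : ℕ} {X : Set (Pt d)}

lemma l1Norm_nonneg (x : Pt d) : 0 ≤ l1Norm x := Finset.sum_nonneg fun _ _ => abs_nonneg _

lemma l1Norm_eq_zero {x : Pt d} : l1Norm x = 0 ↔ x = 0 := by
  rw [l1Norm, Finset.sum_eq_zero_iff_of_nonneg fun _ _ => abs_nonneg _]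
  simp [PiLp.ext_iff]

lemma continuous_l1Norm : Continuous (l1Norm : Pt d → ℝ) := by unfold l1Norm; fun_prop

lemma l1Norm_le_sqrt_mul_norm (x : Pt d) : l1Norm x ≤ √d * ‖x‖ := by
  rw [EuclideanSpace.norm_eq, ← Real.sqrt_mul (Nat.cast_nonneg d)]
  refine Real.le_sqrt_of_sq_le ((sq_sum_le_card_mul_sum_sq (s := Finset.univ)
    (f := fun j => |x j|)).trans_eq ?_)
  simp

lemma l1Norm_sub_le_of_mem_box {r : ℝ} {x y : Pt d} (hx : ∀ j, x j ∈ Set.Icc 0 r)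
    (hy : ∀ j, y j ∈ Set.Icc 0 r) : l1Norm (x - y) ≤ d * r := by
  refine (Finset.sum_le_sum fun j _ => ?_).trans_eq (show ∑ _j : Fin d, r = d * r by simp)
  rw [PiLp.sub_apply]
  exact abs_le.2 ⟨by linarith [(hx j).1, (hy j).2], by linarith [(hx j).2, (hy j).1]⟩

lemma abs_apply_le_mul_l1Norm (φ : Pt d →L[ℝ] ℝ) {l : ℝ}
    (hφ : ∀ j, |φ (EuclideanSpace.single j 1)| ≤ l) (x : Pt d) : |φ x| ≤ l * l1Norm x := by
  have hsum : x = ∑ j, x j • EuclideanSpace.single j (1 : ℝ) := by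
    ext i
    simp [Pi.single_apply]
  calc |φ x| = |∑ j, x j * φ (EuclideanSpace.single j 1)| := by
        conv_lhs => rw [hsum, map_sum]
        simp only [map_smul, smul_eq_mul]
    _ ≤ ∑ j, |x j * φ (EuclideanSpace.single j 1)| := Finset.abs_sum_le_sum_abs _ _
    _ ≤ l * l1Norm x := by
        rw [l1Norm, Finset.mul_sum]
        refine Finset.sum_le_sum fun j _ => ?_
        rw [abs_mul, mul_comm]
        exact mul_le_mul_of_nonneg_right (hφ j) (abs_nonneg _)

lemma abs_sub_le_of_partialDeriv_le (hX : Convex ℝ X) {g : Pt d → ℝ} {G : Pt d → Pt d →L[ℝ] ℝ}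
    (hg : ∀ x ∈ X, HasFDerivWithinAt g (G x) X x) {l : ℝ}
    (hG : ∀ x ∈ X, ∀ j, |G x (EuclideanSpace.single j 1)| ≤ l) {x y : Pt d} (hx : x ∈ X)
    (hy : y ∈ X) : |g x - g y| ≤ l * l1Norm (x - y) := by
  have hseg (t : ℝ) (ht : t ∈ Set.Icc (0 : ℝ) 1) : AffineMap.lineMap y x t ∈ X :=
    hX.lineMap_mem hy hx ht
  have hderiv (t : ℝ) (ht : t ∈ Set.Icc (0 : ℝ) 1) :
      HasDerivWithinAt (fun t => g (AffineMap.lineMap y x t))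
        (G (AffineMap.lineMap y x t) (x - y)) (Set.Icc 0 1) t :=
    (hg _ (hseg t ht)).comp_hasDerivWithinAt t AffineMap.hasDerivWithinAt_lineMap hseg
  simpa only [AffineMap.lineMap_apply_one, AffineMap.lineMap_apply_zero, Real.norm_eq_abs] using
    norm_image_sub_le_of_norm_deriv_le_segment_01' hderiv
      fun t ht => abs_apply_le_mul_l1Norm _ (hG _ (hseg t ⟨ht.1, ht.2.le⟩)) (x - y)

/-- The optimal `ℓ¹`-Lipschitz constant of `g` along the sequence `e`. Along a dense sequence it is
a measurable substitute for the Lipschitz constant of a continuous function. -/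
noncomputable def seqLipschitz (e : ℕ → Pt d) (g : Pt d → ℝ) : ℝ≥0∞ :=
  ⨆ i, ⨆ j, ENNReal.ofReal (|g (e i) - g (e j)| / l1Norm (e i - e j))

lemma seqLipschitz_le {e : ℕ → Pt d} {g : Pt d → ℝ} {l : ℝ} (hl : 0 ≤ l)
    (h : ∀ i j, |g (e i) - g (e j)| ≤ l * l1Norm (e i - e j)) :
    seqLipschitz e g ≤ ENNReal.ofReal l :=
  iSup₂_le fun i j => ENNReal.ofReal_le_ofReal (div_le_of_le_mul₀ (l1Norm_nonneg _) hl (h i j))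

lemma abs_sub_le_seqLipschitz {e : ℕ → Pt d} {g : Pt d → ℝ} (h : seqLipschitz e g ≠ ∞) (i j : ℕ) :
    |g (e i) - g (e j)| ≤ (seqLipschitz e g).toReal * l1Norm (e i - e j) := by
  rcases (l1Norm_nonneg (e i - e j)).eq_or_lt with hzero | hpos
  · rw [sub_eq_zero.1 (l1Norm_eq_zero.1 hzero.symm)]
    simp [l1Norm]
  · rw [← div_le_iff₀ hpos]
    exact (ENNReal.ofReal_le_iff_le_toReal h).1
      (le_iSup₂ (f := fun i j => ENNReal.ofReal (|g (e i) - g (e j)| / l1Norm (e i - e j))) i j)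

lemma abs_sub_le_of_continuousOn {e : ℕ → Pt d} (he : ∀ i, e i ∈ X)
    (hdense : X ⊆ closure (Set.range e)) {g : Pt d → ℝ} (hg : ContinuousOn g X) {l : ℝ}
    (h : ∀ i j, |g (e i) - g (e j)| ≤ l * l1Norm (e i - e j)) {x y : Pt d} (hx : x ∈ X)
    (hy : y ∈ X) : |g x - g y| ≤ l * l1Norm (x - y) := by
  have happrox (z : Pt d) (hz : z ∈ X) : ∃ u : ℕ → Pt d, (∀ n, u n ∈ Set.range e) ∧
      Filter.Tendsto u Filter.atTop (nhds z) ∧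
      Filter.Tendsto (fun n => g (u n)) Filter.atTop (nhds (g z)) := by
    obtain ⟨u, hu, hlim⟩ := mem_closure_iff_seq_limit.1 (hdense hz)
    exact ⟨u, hu, hlim, (hg z hz).tendsto.comp (tendsto_nhdsWithin_iff.2
      ⟨hlim, .of_forall fun n => Set.range_subset_iff.2 he (hu n)⟩)⟩
  obtain ⟨u, hu, hux, hgu⟩ := happrox x hx
  obtain ⟨v, hv, hvy, hgv⟩ := happrox y hy
  refine le_of_tendsto_of_tendsto' (hgu.sub hgv).abs
    (((continuous_l1Norm.tendsto _).comp (hux.sub hvy)).const_mul l) fun n => ?_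
  obtain ⟨i, hi⟩ := hu n
  obtain ⟨j, hj⟩ := hv n
  simpa only [hi, hj, Function.comp_apply] using h i j

end L1Norm

/-- `Λ` is an integrable random Lipschitz constant, for the norm `‖·‖₁`, of the sample paths of `f`
on `X`. -/
structure IsLipschitzConst {d : ℕ} {Ω : Type*} [MeasurableSpace Ω] (P : Measure Ω)
    (X : Set (Pt d)) (f : Pt d → Ω → ℝ) (Λ : Ω → ℝ) : Prop where
  integrable : Integrable Λ P
  nonneg : ∀ ω, 0 ≤ Λ ω
  abs_sub_le : ∀ᵐ ω ∂P, ∀ x ∈ X, ∀ y ∈ X, |f x ω - f y ω| ≤ Λ ω * l1Norm (x - y)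

namespace DerivTail

variable {d : ℕ} {Ω : Type*} [MeasurableSpace Ω] {P : Measure Ω} {X : Set (Pt d)}
  {f : Pt d → Ω → ℝ} {r a b : ℝ}

lemma continuousOn (h : DerivTail P X f r a b) : ∀ᵐ ω ∂P, ContinuousOn (fun x => f x ω) X := by
  obtain ⟨G, hG, -⟩ := h.tail
  filter_upwards [hG] with ω hω x hx using (hω x hx).continuousWithinAt

lemma measure_seqLipschitz_gt_le (h : DerivTail P X f r a b) {e : ℕ → Pt d} (he : ∀ i, e i ∈ X)
    {l : ℝ} (hl : 0 < l) : P {ω | ENNReal.ofReal l < seqLipschitz e (fun x => f x ω)} ≤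
      ENNReal.ofReal (a * d * Real.exp (-(l / b) ^ 2)) := by
  obtain ⟨G, hG, htail⟩ := h.tail
  have hsub : {ω | ENNReal.ofReal l < seqLipschitz e (fun x => f x ω)} ≤ᵐ[P] ⋃ j : Fin d,
      {ω | ENNReal.ofReal l < ⨆ x ∈ X, ‖G ω x (EuclideanSpace.single j 1)‖ₑ} := by
    filter_upwards [hG] with ω hω hlt
    by_contra hnot
    have hle (j : Fin d) : ⨆ x ∈ X, ‖G ω x (EuclideanSpace.single j 1)‖ₑ ≤ ENNReal.ofReal l :=
      not_lt.1 fun hj => hnot (Set.mem_iUnion.2 ⟨j, hj⟩)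
    have hpartial (x) (hx : x ∈ X) (j : Fin d) : |G ω x (EuclideanSpace.single j 1)| ≤ l := by
      have hx_le := (iSup₂_le_iff.1 (hle j)) x hx
      rwa [Real.enorm_eq_ofReal_abs, ENNReal.ofReal_le_ofReal_iff hl.le] at hx_le
    exact hlt.not_ge (seqLipschitz_le hl.le fun i j =>
      abs_sub_le_of_partialDeriv_le h.convex hω hpartial (he i) (he j))
  calc P {ω | ENNReal.ofReal l < seqLipschitz e (fun x => f x ω)}
      ≤ ∑ j : Fin d, P {ω | ENNReal.ofReal l < ⨆ x ∈ X, ‖G ω x (EuclideanSpace.single j 1)‖ₑ} :=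
        (measure_mono_ae hsub).trans (measure_iUnion_fintype_le _ _)
    _ ≤ ∑ _j : Fin d, ENNReal.ofReal (a * Real.exp (-(l / b) ^ 2)) :=
        Finset.sum_le_sum fun j _ => htail j l hl
    _ = ENNReal.ofReal (a * d * Real.exp (-(l / b) ^ 2)) := by
        rw [Finset.sum_const, Finset.card_univ, Fintype.card_fin, nsmul_eq_mul,
          ← ENNReal.ofReal_natCast, ← ENNReal.ofReal_mul (Nat.cast_nonneg d)]
        congr 1
        ring

lemma exists_isLipschitzConst [IsProbabilityMeasure P] (h : DerivTail P X f r a b)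
    (hX : X.Nonempty) (hf : ∀ x ∈ X, Measurable (f x)) :
    ∃ Λ, IsLipschitzConst P X f Λ ∧
      ∫ ω, Λ ω ∂P ≤ b * (√(Real.log (a * d)) + √Real.pi / 2) := by
  obtain ⟨e, he, hdense⟩ := exists_seq_mem_subset_closure hX
  have hmeas : Measurable fun ω => seqLipschitz e (fun x => f x ω) :=
    .iSup fun i => .iSup fun j =>
      (((hf _ (he i)).sub (hf _ (he j))).abs.div_const _).ennreal_ofReal
  have htail (l : ℝ) (hl : 0 < l) := h.measure_seqLipschitz_gt_le he hl
  obtain ⟨hint, hle⟩ := integral_toReal_le_of_subGaussian_tail hmeas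
    (mul_nonneg h.a_pos.le (Nat.cast_nonneg d)) h.b_pos htail
  refine ⟨_, ⟨hint, fun ω => ENNReal.toReal_nonneg, ?_⟩, hle⟩
  filter_upwards [ae_ne_top_of_tendsto_tail htail (tendsto_subGaussian_tail _ h.b_pos),
    h.continuousOn] with ω hω hcont x hx y hy
  exact abs_sub_le_of_continuousOn he hdense hcont (abs_sub_le_seqLipschitz hω) hx hy

end DerivTail

/-! ### Continuous domains -/

lemma exists_abs_sub_cell_center_le {r x : ℝ} (hr : 0 < r) {n : ℕ} (hn : 0 < n)
    (hx : x ∈ Set.Icc 0 r) : ∃ i : Fin n, |x - ((i : ℝ) + 1 / 2) * (r / n)| ≤ r / (2 * n) := by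
  have hn_pos : (0 : ℝ) < n := Nat.cast_pos.2 hn
  have hcell : ∃ i : Fin n, (i : ℝ) ≤ x * n / r ∧ x * n / r ≤ i + 1 := by
    have hnonneg : 0 ≤ x * n / r := div_nonneg (mul_nonneg hx.1 hn_pos.le) hr.le
    rcases hx.2.eq_or_lt with rfl | hlt
    · refine ⟨⟨n - 1, Nat.sub_one_lt_of_lt hn⟩, ?_⟩
      simp [mul_div_cancel_left₀ _ hr.ne', Nat.cast_sub (Nat.succ_le_of_lt hn)]
    · refine ⟨⟨⌊x * n / r⌋₊, ?_⟩, Nat.floor_le hnonneg, (Nat.lt_floor_add_one _).le⟩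
      rw [Nat.floor_lt hnonneg, div_lt_iff₀ hr, mul_comm]
      exact mul_lt_mul_of_pos_left hlt hn_pos
  obtain ⟨i, hle, hge⟩ := hcell
  rw [le_div_iff₀ hr] at hle
  rw [div_le_iff₀ hr] at hge
  have hcenter : x - (i + 1 / 2) * (r / n) = (x * n - (i + 1 / 2) * r) / n := by field_simp
  refine ⟨i, ?_⟩
  rw [hcenter, ← div_div, abs_div, abs_of_pos hn_pos]
  exact div_le_div_of_nonneg_right (abs_le.2 ⟨by linarith, by linarith⟩) hn_pos.le

section Net

variable {d : ℕ}

/-- The centre of the cell with index `g` in the subdivision of the box `[0, r]^d` into `n ^ d`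
congruent cells. -/
noncomputable def gridCenter (r : ℝ) (n : ℕ) (g : Fin d → Fin n) : Pt d :=
  WithLp.toLp 2 fun j => ((g j : ℝ) + 1 / 2) * (r / n)

lemma exists_norm_sub_gridCenter_le {r : ℝ} (hr : 0 < r) {n : ℕ} (hn : 0 < n) {x : Pt d}
    (hx : ∀ j, x j ∈ Set.Icc 0 r) :
    ∃ g : Fin d → Fin n, ‖x - gridCenter r n g‖ ≤ √d * (r / (2 * n)) := by
  choose g hg using fun j => exists_abs_sub_cell_center_le hr hn (hx j)
  have hmesh : 0 ≤ r / (2 * n) := by positivity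
  refine ⟨g, ?_⟩
  rw [EuclideanSpace.norm_eq, ← Real.sqrt_sq hmesh, ← Real.sqrt_mul (Nat.cast_nonneg d)]
  refine Real.sqrt_le_sqrt ((Finset.sum_le_sum fun j _ => ?_).trans_eq
    (show ∑ _j : Fin d, (r / (2 * n)) ^ 2 = _ by simp))
  exact pow_le_pow_left₀ (norm_nonneg _) (hg j) 2

lemma exists_projection {E : Type*} [NormedAddCommGroup E] [InnerProductSpace ℝ E] {X : Set E}
    (hne : X.Nonempty) (hX : IsComplete X) (hconv : Convex ℝ X) (u : E) :
    ∃ v ∈ X, ∀ x ∈ X, ‖x - v‖ ≤ ‖x - u‖ := by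
  obtain ⟨v, hv, hmin⟩ := exists_norm_eq_iInf_of_complete_convex hne hX hconv u
  refine ⟨v, hv, fun x hx => ?_⟩
  have hinner := (norm_eq_iInf_iff_real_inner_le_zero hconv hv).1 hmin x hx
  have hsq : ‖x - u‖ ^ 2 = ‖x - v‖ ^ 2 - 2 * inner ℝ (u - v) (x - v) + ‖u - v‖ ^ 2 := by
    rw [← sub_sub_sub_cancel_right x u v, norm_sub_sq_real, real_inner_comm]
  refine le_of_sq_le_sq ?_ (norm_nonneg _)
  linarith [sq_nonneg ‖u - v‖]

lemma exists_net {X : Set (Pt d)} (hne : X.Nonempty) (hX : IsClosed X) (hconv : Convex ℝ X)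
    {r : ℝ} (hr : 0 < r) (hbox : ∀ x ∈ X, ∀ j, x j ∈ Set.Icc 0 r) {n : ℕ} (hn : 0 < n) :
    ∃ N : Finset (Pt d), (∀ x ∈ N, x ∈ X) ∧ N.card ≤ n ^ d ∧
      ∀ x ∈ X, ∃ y ∈ N, l1Norm (x - y) ≤ d * r / (2 * n) := by
  classical
  -- The cell centres need not lie in `X`; projecting them onto `X` only brings them closer.
  choose proj hproj_mem hproj using exists_projection hne hX.isComplete hconv
  refine ⟨Finset.univ.image fun g => proj (gridCenter r n g), fun x hx => ?_,
    Finset.card_image_le.trans_eq (by simp), fun x hx => ?_⟩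
  · obtain ⟨g, -, rfl⟩ := Finset.mem_image.1 hx
    exact hproj_mem _
  · obtain ⟨g, hg⟩ := exists_norm_sub_gridCenter_le hr hn (hbox x hx)
    refine ⟨_, Finset.mem_image_of_mem _ (Finset.mem_univ g), ?_⟩
    calc l1Norm (x - proj (gridCenter r n g)) ≤ √d * ‖x - proj (gridCenter r n g)‖ :=
          l1Norm_le_sqrt_mul_norm _
      _ ≤ √d * (√d * (r / (2 * n))) := by gcongr; exact (hproj _ x hx).trans hg
      _ = d * r / (2 * n) := by
          rw [← mul_assoc, Real.mul_self_sqrt (Nat.cast_nonneg d), mul_div_assoc]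

end Net

/-- The paper's number `τ_t` of cells per coordinate of the discretization used at step `t`; it is
a real number. -/
noncomputable def netSize (d : ℕ) (r a b : ℝ) (t : ℕ) : ℝ :=
  b * d * r * (t : ℝ) ^ 2 * (√(Real.log (a * d)) + √Real.pi / 2)

section BetaContinuous

variable {d : ℕ} {r a b : ℝ}

lemma mul_le_netSize {m : ℝ} (hm : m ≤ b * (√(Real.log (a * d)) + √Real.pi / 2)) (hr : 0 ≤ r)
    (t : ℕ) : m * (d * r) * (t : ℝ) ^ 2 ≤ netSize d r a b t := by
  calc m * (d * r) * (t : ℝ) ^ 2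
      ≤ b * (√(Real.log (a * d)) + √Real.pi / 2) * (d * r) * (t : ℝ) ^ 2 := by gcongr
    _ = netSize d r a b t := by rw [netSize]; ring

lemma exp_half_betaContinuous {t : ℕ} (hτ : 0 < netSize d r a b t) (ht : 0 < t) :
    Real.exp (betaContinuous d r a b t / 2) =
      netSize d r a b t ^ d * (t : ℝ) ^ 2 / √(2 * Real.pi) := by
  have : (0 : ℝ) < t := Nat.cast_pos.2 ht
  have hβ : betaContinuous d r a b t / 2 =
      d * Real.log (netSize d r a b t) + Real.log ((t : ℝ) ^ 2 / √(2 * Real.pi)) := by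
    rw [betaContinuous, netSize]
    ring
  rw [hβ, Real.exp_add, Real.exp_nat_mul, Real.exp_log hτ, Real.exp_log (by positivity),
    mul_div_assoc]

lemma betaContinuous_monotoneOn (d : ℕ) (a : ℝ) (hr : 0 < r) (hb : 0 < b) :
    MonotoneOn (betaContinuous d r a b) (Set.Ici 1) := by
  intro m (hm : 1 ≤ m) n _ hmn
  have : (0 : ℝ) < m := Nat.cast_pos.2 hm
  unfold betaContinuous
  rcases d.eq_zero_or_pos with rfl | hd
  · simp only [Nat.cast_zero, mul_zero, zero_mul, zero_add]
    gcongr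
  · have : (0 : ℝ) < d := Nat.cast_pos.2 hd
    gcongr

end BetaContinuous

section StepBound

variable {d : ℕ} {Ω : Type*} [MeasurableSpace Ω] {P : Measure Ω} {X : Set (Pt d)}
  {f : Pt d → Ω → ℝ} {Λ : Ω → ℝ} {r a b : ℝ}

namespace IsLipschitzConst

lemma le_add (hΛ : IsLipschitzConst P X f Λ) (ρ : ℝ) : ∀ᵐ ω ∂P, ∀ x ∈ X, ∀ y ∈ X,
    l1Norm (x - y) ≤ ρ → f x ω ≤ f y ω + Λ ω * ρ := by
  filter_upwards [hΛ.abs_sub_le] with ω hω x hx y hy hxy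
  exact sub_le_iff_le_add'.1 ((le_abs_self _).trans
    ((hω x hx y hy).trans (mul_le_mul_of_nonneg_left hxy (hΛ.nonneg ω))))

lemma stepBound_oscillation (hΛ : IsLipschitzConst P X f Λ)
    (hbox : ∀ x ∈ X, ∀ j, x j ∈ Set.Icc 0 r) (β : ℝ) {B : ℝ}
    (hB : (∫ ω, Λ ω ∂P) * (d * r) ≤ B) : StepBound P X f β B := by
  refine .oscillation (fun ω => Λ ω * (d * r)) (hΛ.integrable.mul_const _) ?_
    (by rwa [integral_mul_const])
  filter_upwards [hΛ.le_add (d * r)] with ω hω x hx y hy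
  exact hω x hx y hy (l1Norm_sub_le_of_mem_box (hbox x hx) (hbox y hy))

lemma stepBound_net (hΛ : IsLipschitzConst P X f Λ) (hne : X.Nonempty) (hX : IsClosed X)
    (hconv : Convex ℝ X) (hr : 0 < r) (hbox : ∀ x ∈ X, ∀ j, x j ∈ Set.Icc 0 r) {n : ℕ}
    (hn : 0 < n) {t β : ℝ} (ht : 0 < t)
    (hβ : (n : ℝ) ^ d * t ^ 2 / √(2 * Real.pi) ≤ Real.exp (β / 2))
    (hmean : (∫ ω, Λ ω ∂P) * (d * r) * t ^ 2 ≤ 2 * n) : StepBound P X f β (2 / t ^ 2) := by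
  obtain ⟨N, hN_mem, hN_card, hN⟩ := exists_net hne hX hconv hr hbox hn
  refine .net N (fun ω => Λ ω * (d * r / (2 * n))) hN_mem (hΛ.integrable.mul_const _) ?_ ?_
  · filter_upwards [hΛ.le_add (d * r / (2 * n))] with ω hω x hx
    obtain ⟨y, hy, hxy⟩ := hN x hx
    exact ⟨y, hy, hω x hx y (hN_mem y hy) hxy⟩
  · have hexcess : N.card * excessBound β ≤ 1 / t ^ 2 := by
      refine mul_excessBound_le ht (le_trans ?_ hβ)
      gcongr
      exact_mod_cast hN_card
    have hint : ∫ ω, Λ ω * (d * r / (2 * n)) ∂P ≤ 1 / t ^ 2 := by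
      rw [integral_mul_const, ← mul_div_assoc, div_le_div_iff₀ (by positivity) (by positivity),
        one_mul]
      exact hmean
    exact (add_le_add hexcess hint).trans_eq (by ring)

end IsLipschitzConst

lemma DerivTail.stepBound (h : DerivTail P X f r a b) (hX : X.Nonempty)
    (hΛ : IsLipschitzConst P X f Λ)
    (hle : ∫ ω, Λ ω ∂P ≤ b * (√(Real.log (a * d)) + √Real.pi / 2)) {t : ℕ} (ht : 0 < t) :
    StepBound P X f (betaContinuous d r a b t) (2 / (t : ℝ) ^ 2) := by
  have ht_pos : (0 : ℝ) < t := Nat.cast_pos.2 ht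
  have hmean := mul_le_netSize hle h.r_pos.le t
  set τ := netSize d r a b t with hτ_def
  rcases lt_or_ge τ 1 with hτ | hτ
  · refine hΛ.stepBound_oscillation h.subset_box _ ?_
    rw [le_div_iff₀ (by positivity)]
    linarith
  · have hfloor_pos : 0 < ⌊τ⌋₊ := Nat.floor_pos.2 hτ
    have hfloor_one : (1 : ℝ) ≤ ⌊τ⌋₊ := Nat.one_le_cast.2 hfloor_pos
    have hfloor_le : (⌊τ⌋₊ : ℝ) ≤ τ := Nat.floor_le (zero_le_one.trans hτ)
    refine hΛ.stepBound_net hX h.compact.isClosed h.convex h.r_pos h.subset_box hfloor_pos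
      ht_pos ?_ (by linarith [Nat.lt_floor_add_one τ])
    rw [exp_half_betaContinuous (zero_lt_one.trans_le hτ) ht, ← hτ_def]
    gcongr

end StepBound

theorem IsGPModel.regret_bound_continuous {d : ℕ} {Ω : Type*} [MeasurableSpace Ω] {P : Measure Ω}
    [IsProbabilityMeasure P] {X : Set (Pt d)} {k : Pt d → Pt d → ℝ} {s : ℝ≥0}
    {f : Pt d → Ω → ℝ} {ε : ℕ → Ω → ℝ} {π : Rule d} (hm : IsGPModel P X k s f ε) (hs : 0 < s)
    (hunit : ∀ x ∈ X, k x x ≤ 1) {xstar : Ω → Pt d}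
    (hxstar : ∀ᵐ ω ∂P, xstar ω ∈ X ∧ IsMaxOn (fun x => f x ω) X (xstar ω))
    {r a b : ℝ} (h : DerivTail P X f r a b) (hπ : IsGPUCB X k s (betaContinuous d r a b) π)
    (T : ℕ) :
    maxInfoGain P X f ε T ≠ ∞ ∧ Integrable (cumRegret π f ε xstar T) P ∧
      bcr P π f ε xstar T ≤ Real.pi ^ 2 / 3 +
        √(constC1 s * T * betaContinuous d r a b T * (maxInfoGain P X f ε T).toReal) := by
  obtain ⟨ω₀, hx₀, -⟩ := hxstar.exists
  obtain ⟨Λ, hΛ, hle⟩ := h.exists_isLipschitzConst ⟨_, hx₀⟩ hm.measurable_f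
  have hM : ∀ᵐ ω ∂P, ∀ x ∈ X, |f x ω| ≤ |f (xstar ω₀) ω| + Λ ω * (d * r) := by
    filter_upwards [hΛ.abs_sub_le] with ω hω x hx
    have hdist := l1Norm_sub_le_of_mem_box (h.subset_box x hx) (h.subset_box _ hx₀)
    linarith [abs_sub_abs_le_abs_sub (f x ω) (f (xstar ω₀) ω), hω x hx _ hx₀,
      mul_le_mul_of_nonneg_left hdist (hΛ.nonneg ω)]
  obtain ⟨hgain, hint, hbcr⟩ := hm.regret_bound hs h.compact.isClosed.measurableSet hunit
    h.continuousOn hπ (betaContinuous_monotoneOn d a h.r_pos h.b_pos) hxstar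
    (((hm.memLp_f hx₀).integrable one_le_two).abs.add (hΛ.integrable.mul_const _)) hM zero_le_two
    (fun n => h.stepBound ⟨_, hx₀⟩ hΛ hle n.succ_pos) T
  exact ⟨hgain, hint, hbcr.trans_eq (by ring)⟩

end GPUCB

theorem theorem5_general {d : ℕ} {Ω : Type*} [MeasurableSpace Ω] (P : Measure Ω)
    [IsProbabilityMeasure P] (X : Set (GPUCB.Pt d)) (k : GPUCB.Pt d → GPUCB.Pt d → ℝ)
    (s : ℝ≥0) (hs : 0 < s)
    (f : GPUCB.Pt d → Ω → ℝ) (ε : ℕ → Ω → ℝ) (hmodel : GPUCB.IsGPModel P X k s f ε)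
    (hunit : ∀ x ∈ X, k x x ≤ 1) (xstar : Ω → GPUCB.Pt d)
    (hxstar : ∀ᵐ ω ∂P, xstar ω ∈ X ∧ IsMaxOn (fun x => f x ω) X (xstar ω)) :
    (X.Finite → ∀ π : GPUCB.Rule d, GPUCB.IsGPUCB X k s (GPUCB.betaFinite X.ncard) π → ∀ T : ℕ,
      GPUCB.maxInfoGain P X f ε T ≠ ∞ ∧
      Integrable (GPUCB.cumRegret π f ε xstar T) P ∧
      GPUCB.bcr P π f ε xstar T ≤ Real.pi ^ 2 / 6 +
        Real.sqrt (GPUCB.constC1 s * T * GPUCB.betaFinite X.ncard T *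
          (GPUCB.maxInfoGain P X f ε T).toReal)) ∧
    (∀ r a b : ℝ, GPUCB.DerivTail P X f r a b →
      ∀ π : GPUCB.Rule d, GPUCB.IsGPUCB X k s (GPUCB.betaContinuous d r a b) π → ∀ T : ℕ,
      GPUCB.maxInfoGain P X f ε T ≠ ∞ ∧
      Integrable (GPUCB.cumRegret π f ε xstar T) P ∧
      GPUCB.bcr P π f ε xstar T ≤ Real.pi ^ 2 / 3 +
        Real.sqrt (GPUCB.constC1 s * T * GPUCB.betaContinuous d r a b T *
          (GPUCB.maxInfoGain P X f ε T).toReal)) ∧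
    (∀ (r b : ℝ) (t : ℕ), (fun a : ℝ => GPUCB.betaContinuous d r a b t) =O[Filter.atTop]
      (fun a : ℝ => Real.log (Real.log a))) :=
  ⟨fun hX _ hπ T => hmodel.regret_bound_finite hs hunit hxstar hX hπ T,
    fun _ _ _ h _ hπ T => hmodel.regret_bound_continuous hs hunit hxstar h hπ T,
    GPUCB.betaContinuous_isBigO d⟩

theorem theorem5 {d : ℕ} {Ω : Type*} [MeasurableSpace Ω] (P : Measure Ω) [IsProbabilityMeasure P]
    (X : Set (GPUCB.Pt d)) (k : GPUCB.Pt d → GPUCB.Pt d → ℝ) (s : ℝ≥0) (hs : 0 < s)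
    (f : GPUCB.Pt d → Ω → ℝ) (ε : ℕ → Ω → ℝ) (hmodel : GPUCB.IsGPModel P X k s f ε)
    (hstat : GPUCB.IsStationaryOn X k) (hunit : ∀ x ∈ X, k x x = 1)
    (xstar : Ω → GPUCB.Pt d)
    (hxstar : ∀ᵐ ω ∂P, xstar ω ∈ X ∧ IsMaxOn (fun x => f x ω) X (xstar ω)) :
    -- (i) finite domain
    (X.Finite → ∀ π : GPUCB.Rule d, GPUCB.IsGPUCB X k s (GPUCB.betaFinite X.ncard) π → ∀ T : ℕ,
      GPUCB.maxInfoGain P X f ε T ≠ ∞ ∧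
      Integrable (GPUCB.cumRegret π f ε xstar T) P ∧
      GPUCB.bcr P π f ε xstar T ≤ Real.pi ^ 2 / 6 +
        Real.sqrt (GPUCB.constC1 s * T * GPUCB.betaFinite X.ncard T *
          (GPUCB.maxInfoGain P X f ε T).toReal)) ∧
    -- (ii) continuous domain
    (X.Infinite → ∀ r a b : ℝ, GPUCB.DerivTail P X f r a b →
      ∀ π : GPUCB.Rule d, GPUCB.IsGPUCB X k s (GPUCB.betaContinuous d r a b) π → ∀ T : ℕ,
      GPUCB.maxInfoGain P X f ε T ≠ ∞ ∧
      Integrable (GPUCB.cumRegret π f ε xstar T) P ∧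
      GPUCB.bcr P π f ε xstar T ≤ Real.pi ^ 2 / 3 +
        Real.sqrt (GPUCB.constC1 s * T * GPUCB.betaContinuous d r a b T *
          (GPUCB.maxInfoGain P X f ε T).toReal)) ∧
    -- dependence on the constant `a` in the continuous case
    (∀ (r b : ℝ) (t : ℕ), (fun a : ℝ => GPUCB.betaContinuous d r a b t) =O[Filter.atTop]
      (fun a : ℝ => Real.log (Real.log a))) := by
  have ⟨hfinite, hcontinuous, hbeta⟩ := theorem5_general P X k s hs f ε hmodel
    (fun x hx => (hunit x hx).le) xstar hxstar
  exact ⟨hfinite, fun _ => hcontinuous, hbeta⟩
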